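/- For each $n$ let $p=p(n)=\frac{\log n+\log\log n+\omega}{n}$, where $\omega=\omega(n)\to\infty$ and $\omega=o(\log\log n)$, and let $s_0=s_0(n)=\omega_1 n/\log n$ be a non-negative integer, where $\omega_1=\omega_1(n)=o(\log\log\log n)$ as $n\to\infty$. Let $G_{n,p}$ be the random graph on the vertex set $\{1,\dots,n\}$ in which each of the $\binom n2$ possible edges is present independently with probability $p$. Then, with probability tending to $1$ as $n\to\infty$, $G_{n,p}$ contains a Hamilton cycle in which the vertices $1,2,\dots,s_0$ appear in their natural order, not necessarily consecutively (that is, for some starting point and direction, traversing the cycle once meets them in the order $1,2,\dots,s_0$). -/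

import Mathlib

open Filter Asymptotics
open scoped Topology

/-- The graph `G` on the `n` labelled vertices `Fin n` (the vertex `i : Fin n` carries the label
`i + 1`) has a Hamilton cycle in which the vertices labelled `1, …, s` appear in their natural order,
not necessarily consecutively: for a suitable starting point `a` and direction, the closed walk `c`
around the cycle first meets the vertex `u` before the vertex `v` whenever `u < v` are both among
the first `s` vertices. -/
def HasOrderedHamiltonCycle {n : ℕ} (G : SimpleGraph (Fin n)) (s : ℕ) : Prop :=
  ∃ (a : Fin n) (c : G.Walk a a), c.IsHamiltonianCycle ∧
    ∀ u v : Fin n, u < v → (v : ℕ) < s → c.support.idxOf u < c.support.idxOf v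

/-! Write `D` for an integer near `(log n)^(1/8)` and `m` for about `n / D^7`, and call the first
`s` vertices special. The edge probability is split into two independent rounds: the first keeps
`log n + log log n + ω/2` of `np`, the second still has expected degree at least `ω/2`.

With high probability the first round is a `TypicalGraph`: any two disjoint sets of `m` vertices are
joined, small sets span few edges, vertices of low degree lie far apart, and the degree conditions
at every vertex hold. In such a graph a path is threaded through the special vertices in decreasing
order. Consecutive ones are connected by growing from each a tree with branching `D` until it has at
least `m` leaves; some edge joins the two leaf sets, and only the branches it uses are kept. A
connection has about `2 log n / log D` vertices. Since `log D` has order `log log n` and `s log n`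
is at most `n log D / 100`, the whole path occupies a small fraction of the graph.

What keeps the construction going is an invariant of Friedman–Pippenger type: every small set has
enough untaken neighbours to meet its demand, children already given being counted.
`Extendable.exists_child` adds a child without breaking it, because tight sets are closed under
union, and `Extendable.restrict` gives unused branches back. A low-degree vertex with fewer than two
neighbours outside the special ones could not be covered later, so the path visits it right next to
a special neighbour.

Once the path is finished the invariant says that the leftover expands. The interior of the path is
contracted to one vertex adjacent to both endpoints; a Hamilton cycle of the contracted graph passes
through that vertex and so unfolds to one containing the path. The contracted graph expands twofold
up to size `K = n/8`, so by Pósa rotations every non-Hamiltonian graph obtained by adding edges has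
at least `K^2/2` boosters (`card_boosters`). If the second round fails to close the cycle, it
contains a set `E` of at most `n` edges such that it avoids every booster of the first-round graph
plus `E` (`exists_stuck`). A union bound over `E` gives this probability at most `exp (-n)` as soon
as `n p₂` exceeds a constant (`prG_stuck_le`). -/

/-! ### Extendability in the manner of Friedman and Pippenger. -/

section Extendability

variable {V : Type*} [Fintype V] [DecidableEq V]

/-- The vertices with at least one neighbour in `U`. -/
noncomputable def nbr (G : SimpleGraph V) (U : Finset V) : Finset V := by
  classical exact Finset.univ.filter fun w => ∃ u ∈ U, G.Adj u w

omit [DecidableEq V] in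
@[simp] lemma mem_nbr {G : SimpleGraph V} {U : Finset V} {w : V} :
    w ∈ nbr G U ↔ ∃ u ∈ U, G.Adj u w := by
  classical simp [nbr]

lemma nbr_union (G : SimpleGraph V) (U U' : Finset V) : nbr G (U ∪ U') = nbr G U ∪ nbr G U' := by
  ext w; simp only [mem_nbr, Finset.mem_union]; grind

omit [DecidableEq V] in
lemma nbr_mono (G : SimpleGraph V) {U U' : Finset V} (h : U ⊆ U') : nbr G U ⊆ nbr G U' := by
  intro w; simp only [mem_nbr]; rintro ⟨u, hu, h'⟩; exact ⟨u, h hu, h'⟩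

/-- The vertices that are blocked, or are the child of an oriented edge of `A`. -/
def taken (W : Finset V) (A : Finset (V × V)) : Finset V := W ∪ A.image Prod.snd

/-- The number of children of `x`. -/
def outdeg (A : Finset (V × V)) (x : V) : ℕ := (A.filter fun e => e.1 = x).card

/-- The finset `A` of oriented (parent, child) edges, with distinct children outside `W`, can be
extended greedily: small vertex sets can still meet their demand `f`, when the children they already
have are counted. -/
structure Extendable (G : SimpleGraph V) (M : ℕ) (f : V → ℕ) (W : Finset V)
    (A : Finset (V × V)) : Prop where
  adj : ∀ e ∈ A, G.Adj e.1 e.2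
  snd_notMem : ∀ e ∈ A, e.2 ∉ W
  inj : ∀ e ∈ A, ∀ e' ∈ A, e.2 = e'.2 → e = e'
  fst_mem : ∀ e ∈ A, e.1 ∈ taken W A
  demand : ∀ U : Finset V, U.card ≤ M →
    ∑ x ∈ U, f x ≤ (nbr G U \ taken W A).card + (A.filter fun e => e.1 ∈ U).card

omit [Fintype V] in
lemma mem_taken {W : Finset V} {A : Finset (V × V)} {x : V} :
    x ∈ taken W A ↔ x ∈ W ∨ ∃ p, (p, x) ∈ A := by
  simp [taken]

omit [Fintype V] in
lemma taken_mono {W : Finset V} {A A' : Finset (V × V)} (h : A ⊆ A') : taken W A ⊆ taken W A' := by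
  intro x; simp only [mem_taken]; grind

omit [Fintype V] in
lemma card_taken_le (W : Finset V) (A : Finset (V × V)) : (taken W A).card ≤ W.card + A.card :=
  (Finset.card_union_le _ _).trans (Nat.add_le_add_left Finset.card_image_le _)

omit [Fintype V] in
lemma taken_insert (W : Finset V) (A : Finset (V × V)) (e : V × V) :
    taken W (insert e A) = insert e.2 (taken W A) := by
  ext x; simp only [mem_taken, Finset.mem_insert]; grind

/-- Removing oriented edges from an extendable family keeps it extendable. -/
lemma Extendable.restrict {G : SimpleGraph V} {M : ℕ} {f : V → ℕ} {W : Finset V}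
    {A A' : Finset (V × V)} (h : Extendable G M f W A') (hA : A ⊆ A')
    (hfst : ∀ e ∈ A, e.1 ∈ taken W A) : Extendable G M f W A where
  adj e he := h.adj e (hA he)
  snd_notMem e he := h.snd_notMem e (hA he)
  inj e he e' he' := h.inj e (hA he) e' (hA he')
  fst_mem := hfst
  demand U hU := by
    refine (h.demand U hU).trans ?_
    have h1 : (A'.filter fun e => e.1 ∈ U) =
        (A.filter fun e => e.1 ∈ U) ∪ ((A' \ A).filter fun e => e.1 ∈ U) := by
      ext e; simp only [Finset.mem_filter, Finset.mem_union, Finset.mem_sdiff]; grind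
    set R := ((A' \ A).filter fun e => e.1 ∈ U) with hR
    have h2 : (R.image Prod.snd).card = R.card := by
      refine Finset.card_image_of_injOn ?_
      intro e he e' he' hee
      simp only [hR, Finset.coe_filter, Finset.mem_sdiff, Set.mem_ofPred_eq] at he he'
      exact h.inj e he.1.1 e' he'.1.1 hee
    -- The child of a removed edge leaving `U` is a free neighbour of `U` again, and distinct edges
    -- have distinct children: what the edge count loses, the free neighbourhood regains.
    have h3 : (nbr G U \ taken W A') ∪ R.image Prod.snd ⊆ nbr G U \ taken W A := by
      intro x hx
      rcases Finset.mem_union.1 hx with hx | hx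
      · simp only [Finset.mem_sdiff] at hx ⊢
        exact ⟨hx.1, fun h' => hx.2 (taken_mono hA h')⟩
      · obtain ⟨e, he, rfl⟩ := Finset.mem_image.1 hx
        simp only [hR, Finset.mem_filter, Finset.mem_sdiff] at he
        simp only [Finset.mem_sdiff, mem_nbr, mem_taken, not_or, not_exists]
        refine ⟨⟨e.1, he.2, h.adj e he.1.1⟩, h.snd_notMem e he.1.1, fun p hp => he.1.2 ?_⟩
        have := h.inj _ (hA hp) _ he.1.1 rfl
        exact this ▸ hp
    have h4 : Disjoint (nbr G U \ taken W A') (R.image Prod.snd) := by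
      rw [Finset.disjoint_left]
      intro x hx hx'
      obtain ⟨e, he, rfl⟩ := Finset.mem_image.1 hx'
      simp only [hR, Finset.mem_filter, Finset.mem_sdiff] at he hx
      exact hx.2 (mem_taken.2 (Or.inr ⟨e.1, he.1.1⟩))
    have h5 := Finset.card_le_card h3
    rw [Finset.card_union_of_disjoint h4, h2] at h5
    have h6 := Finset.card_union_le (A.filter fun e => e.1 ∈ U) R
    rw [h1]
    omega

/-- One more child can be attached to a vertex with spare demand. -/
lemma Extendable.exists_child {G : SimpleGraph V} {m w : ℕ} {f : V → ℕ} {W : Finset V}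
    {A : Finset (V × V)} (h : Extendable G (2 * m) f W A) (hm : 1 ≤ m)
    (hbig : ∀ T U : Finset V, T.card ≤ w → m ≤ U.card → U.card ≤ 2 * m →
      ∑ x ∈ U, f x < (nbr G U \ T).card)
    (hw : (taken W A).card ≤ w) {s : V} (hs : s ∈ taken W A) (hsf : outdeg A s < f s) :
    ∃ y, y ∉ taken W A ∧ G.Adj s y ∧ Extendable G (2 * m) f W (insert (s, y) A) := by
  classical
  set T := taken W A with hT
  have hdem : ∀ U : Finset V, U.card ≤ 2 * m →
      ∑ x ∈ U, f x ≤ (nbr G U \ T).card + (A.filter fun e => e.1 ∈ U).card := h.demand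
  by_contra hcon
  push Not at hcon
  -- If attaching `y` to `s` breaks the demand of some `U`, then `U` met its demand with equality,
  -- misses `s` and sees `y`.
  let Tight : Finset V → Prop := fun U =>
    (nbr G U \ T).card + (A.filter fun e => e.1 ∈ U).card = ∑ x ∈ U, f x
  -- Sizes from `m` to `2 * m` have strict expansion, so a tight set is smaller than `m`; hence the
  -- union of two of them is still within the range of the demand condition.
  have tight_small : ∀ U, Tight U → U.card ≤ 2 * m → U.card < m := by
    intro U hU h2
    by_contra h3
    have := hbig T U hw (by omega) h2
    simp only [Tight] at hU
    omega
  have hy : ∀ y, y ∉ T → G.Adj s y → ∃ U, Tight U ∧ U.card < m ∧ s ∉ U ∧ y ∈ nbr G U := by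
    intro y hyT hsy
    have h1 := hcon y hyT hsy
    by_contra h2
    push Not at h2
    apply h1
    refine ⟨?_, ?_, ?_, ?_, ?_⟩
    · intro e he
      rcases Finset.mem_insert.1 he with rfl | he
      · exact hsy
      · exact h.adj e he
    · intro e he
      rcases Finset.mem_insert.1 he with rfl | he
      · intro h'; exact hyT (mem_taken.2 (Or.inl h'))
      · exact h.snd_notMem e he
    · intro e he e' he' hee
      rcases Finset.mem_insert.1 he with rfl | he <;> rcases Finset.mem_insert.1 he' with rfl | he'
      · rfl
      · exact absurd (mem_taken.2 (Or.inr ⟨e'.1, by rw [show y = e'.2 from hee]; exact he'⟩)) hyT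
      · exact absurd (mem_taken.2 (Or.inr ⟨e.1, by rw [show y = e.2 from hee.symm]; exact he⟩)) hyT
      · exact h.inj e he e' he' hee
    · intro e he
      rw [taken_insert]
      rcases Finset.mem_insert.1 he with rfl | he
      · exact Finset.mem_insert_of_mem hs
      · exact Finset.mem_insert_of_mem (h.fst_mem e he)
    · intro U hU
      have hd := hdem U hU
      rw [taken_insert]
      have hsyA : (s, y) ∉ A := fun h' => hyT (mem_taken.2 (Or.inr ⟨s, h'⟩))
      have e1 : (nbr G U \ T).card ≤ (nbr G U \ insert y T).card +
          (if y ∈ nbr G U then 1 else 0) := by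
        split_ifs with hyU
        · have : nbr G U \ T ⊆ insert y (nbr G U \ insert y T) := by
            intro x; simp only [Finset.mem_sdiff, Finset.mem_insert]; grind
          exact (Finset.card_le_card this).trans (Finset.card_insert_le _ _)
        · refine Finset.card_le_card ?_
          intro x; simp only [Finset.mem_sdiff, Finset.mem_insert]; grind
      have e2 : ((insert (s, y) A).filter fun e => e.1 ∈ U).card =
          (A.filter fun e => e.1 ∈ U).card + (if s ∈ U then 1 else 0) := by
        rw [Finset.filter_insert]
        split_ifs with hsU
        · rw [Finset.card_insert_of_notMem (by simp [hsyA])]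
        · rfl
      rw [e2]
      by_cases hsU : s ∈ U
      · simp only [hsU, if_true]
        split_ifs at e1 <;> (change _ ≤ (nbr G U \ insert y T).card + _; omega)
      · by_cases hyU : y ∈ nbr G U
        · have hnt : ¬ Tight U := fun hti => h2 U hti (tight_small U hti hU) hsU hyU
          simp only [hyU, if_true, hsU, if_false] at e1 ⊢
          change ¬ (_ = _) at hnt
          change _ ≤ (nbr G U \ insert y T).card + _
          omega
        · simp only [hyU, hsU, if_false] at e1 ⊢
          change _ ≤ (nbr G U \ insert y T).card + _
          omega
  obtain ⟨U, hU, hmax⟩ := Finset.exists_max_image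
    (Finset.univ.filter fun U : Finset V => Tight U ∧ U.card < m ∧ s ∉ U) Finset.card
    ⟨∅, by
      simp only [Finset.mem_filter, Finset.mem_univ, true_and, Tight]
      refine ⟨?_, by simp; omega, by simp⟩
      have : nbr G (∅ : Finset V) = ∅ := by ext; simp
      simp [this]⟩
  simp only [Finset.mem_filter, Finset.mem_univ, true_and] at hU hmax
  obtain ⟨hUt, hUm, hsU⟩ := hU
  have hcover : nbr G {s} \ T ⊆ nbr G U := by
    intro y hy'
    simp only [Finset.mem_sdiff, mem_nbr, Finset.mem_singleton, exists_eq_left] at hy'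
    obtain ⟨U', hU't, hU'm, hsU', hyU'⟩ := hy y hy'.2 hy'.1
    have hle : (U ∪ U').card ≤ 2 * m := (Finset.card_union_le _ _).trans (by omega)
    -- The number of free neighbours is submodular in `U`, whereas demand and edge count are
    -- modular; equality for two sets therefore passes to their union.
    have htight : Tight (U ∪ U') := by
      have d1 := hdem _ hle
      have d2 := hdem (U ∩ U') ((Finset.card_le_card Finset.inter_subset_left).trans (by omega))
      have s1 := Finset.sum_union_inter (s₁ := U) (s₂ := U') (f := f)
      have c1 := Finset.card_union_add_card_inter (nbr G U \ T) (nbr G U' \ T)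
      have c2 := Finset.card_union_add_card_inter
        (A.filter fun e => e.1 ∈ U) (A.filter fun e => e.1 ∈ U')
      have i1 : (nbr G U \ T) ∪ (nbr G U' \ T) = nbr G (U ∪ U') \ T := by
        rw [nbr_union, Finset.union_sdiff_distrib]
      have i2 : nbr G (U ∩ U') \ T ⊆ (nbr G U \ T) ∩ (nbr G U' \ T) := by
        intro x hx
        simp only [Finset.mem_sdiff, Finset.mem_inter] at hx ⊢
        exact ⟨⟨nbr_mono G Finset.inter_subset_left hx.1, hx.2⟩,
          ⟨nbr_mono G Finset.inter_subset_right hx.1, hx.2⟩⟩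
      have i3 : (A.filter fun e => e.1 ∈ U) ∪ (A.filter fun e => e.1 ∈ U') =
          A.filter fun e => e.1 ∈ U ∪ U' := by
        rw [← Finset.filter_or]; simp only [Finset.mem_union]
      have i4 : (A.filter fun e => e.1 ∈ U) ∩ (A.filter fun e => e.1 ∈ U') =
          A.filter fun e => e.1 ∈ U ∩ U' := by
        rw [← Finset.filter_and]; simp only [Finset.mem_inter]
      rw [i1] at c1
      rw [i3, i4] at c2
      have i2' := Finset.card_le_card i2
      simp only [Tight] at hUt hU't ⊢
      omega
    have := hmax (U ∪ U') ⟨htight, tight_small _ htight hle, by simp [hsU, hsU']⟩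
    have hEq : U = U ∪ U' := Finset.eq_of_subset_of_card_le Finset.subset_union_left this
    rw [hEq, nbr_union]
    exact Finset.mem_union_right _ hyU'
  -- The maximal tight set already sees every free neighbour of `s`. Adding `s` raises the demand by
  -- `f s` but the supply only by the number of children of `s`, which is smaller.
  have hd := hdem (insert s U) ((Finset.card_insert_le _ _).trans (by omega))
  rw [Finset.sum_insert hsU] at hd
  have j1 : nbr G (insert s U) \ T ⊆ nbr G U \ T := by
    intro x hx
    rw [Finset.insert_eq, nbr_union] at hx
    simp only [Finset.mem_sdiff, Finset.mem_union] at hx ⊢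
    refine ⟨?_, hx.2⟩
    rcases hx.1 with h' | h'
    · exact hcover (Finset.mem_sdiff.2 ⟨h', hx.2⟩)
    · exact h'
  have j2 : (A.filter fun e => e.1 ∈ insert s U).card ≤
      outdeg A s + (A.filter fun e => e.1 ∈ U).card := by
    simp only [Finset.mem_insert, Finset.filter_or]
    exact Finset.card_union_le _ _
  have j1' := Finset.card_le_card j1
  simp only [Tight] at hUt
  change _ ≤ (nbr G (insert s U) \ T).card + _ at hd
  omega

end Extendability

/-! ### Connecting two vertices by trees whose leaves are joined. -/

section Connecting

variable {V : Type*} [Fintype V] [DecidableEq V]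

/-- The conditions under which trees can be grown: sets with at least `m` and at most `2 * m`
vertices expand beyond their demand even when `w` vertices are taken, and the demand of an unblocked
vertex is `D`. -/
structure GrowthSetting (G : SimpleGraph V) (m w D : ℕ) (f : V → ℕ) (W : Finset V) : Prop where
  one_le : 1 ≤ m
  big : ∀ T U : Finset V, T.card ≤ w → m ≤ U.card → U.card ≤ 2 * m →
    ∑ x ∈ U, f x < (nbr G U \ T).card
  demand_eq : ∀ x, x ∉ W → f x = D
  joined : ∀ X Y : Finset V, Disjoint X Y → m ≤ X.card → m ≤ Y.card →
    ∃ x ∈ X, ∃ y ∈ Y, G.Adj x y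

omit [Fintype V] in
lemma outdeg_union_le (A B : Finset (V × V)) (x : V) :
    outdeg (A ∪ B) x ≤ outdeg A x + outdeg B x := by
  unfold outdeg; rw [Finset.filter_union]; exact Finset.card_union_le _ _

omit [Fintype V] in
lemma outdeg_eq_zero {A : Finset (V × V)} {x : V} (h : ∀ e ∈ A, e.1 ≠ x) : outdeg A x = 0 := by
  unfold outdeg; rw [Finset.card_eq_zero, Finset.filter_eq_empty_iff]; exact fun e he => h e he

variable {G : SimpleGraph V} {m w D : ℕ} {f : V → ℕ} {W : Finset V}

/-- The family `B` consists of new oriented edges extending `A`. -/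
structure IsExtension (G : SimpleGraph V) (m : ℕ) (f : V → ℕ) (W : Finset V)
    (A B : Finset (V × V)) : Prop where
  ext : Extendable G (2 * m) f W (A ∪ B)
  fresh : ∀ e ∈ B, e.2 ∉ taken W A

omit [Fintype V] in
lemma mem_taken_union {A B : Finset (V × V)} {x : V} :
    x ∈ taken W (A ∪ B) ↔ x ∈ taken W A ∨ ∃ p, (p, x) ∈ B := by
  simp only [mem_taken, Finset.mem_union]; grind

omit [Fintype V] in
lemma card_taken_union_le (A B : Finset (V × V)) :
    (taken W (A ∪ B)).card ≤ (taken W A).card + B.card := by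
  have : taken W (A ∪ B) ⊆ taken W A ∪ B.image Prod.snd := by
    intro x; rw [mem_taken_union, Finset.mem_union, Finset.mem_image]; grind
  exact (Finset.card_le_card this).trans ((Finset.card_union_le _ _).trans
    (Nat.add_le_add_left Finset.card_image_le _))

lemma IsExtension.trans {A B C : Finset (V × V)} (h : IsExtension G m f W A B)
    (h' : IsExtension G m f W (A ∪ B) C) : IsExtension G m f W A (B ∪ C) where
  ext := by rw [← Finset.union_assoc]; exact h'.ext
  fresh e he := by
    rcases Finset.mem_union.1 he with he | he
    · exact h.fresh e he
    · exact fun h2 => h'.fresh e he (mem_taken_union.2 (Or.inl h2))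

lemma GrowthSetting.exists_children (hS : GrowthSetting G m w D f W) {A : Finset (V × V)}
    (hA : Extendable G (2 * m) f W A) {y : V} (hy : y ∈ taken W A) (t : ℕ)
    (ht : outdeg A y + t ≤ f y) (hw : (taken W A).card + t ≤ w) :
    ∃ B, IsExtension G m f W A B ∧ (∀ e ∈ B, e.1 = y) ∧ B.card = t := by
  induction t with
  | zero => exact ⟨∅, ⟨by simpa using hA, by simp⟩, by simp, by simp⟩
  | succ t ih =>
    obtain ⟨B, hB, hBy, hBc⟩ := ih (by omega) (by omega)
    have hdeg : outdeg (A ∪ B) y ≤ outdeg A y + t := by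
      refine (outdeg_union_le _ _ _).trans (Nat.add_le_add_left ?_ _)
      exact hBc ▸ Finset.card_filter_le _ _
    obtain ⟨c, hc, -, hext⟩ := hB.ext.exists_child hS.one_le hS.big
      (by have := card_taken_union_le (W := W) A B; omega)
      (s := y) (mem_taken_union.2 (Or.inl hy)) (by omega)
    have hcB : (y, c) ∉ B := fun h => hc (mem_taken_union.2 (Or.inr ⟨y, h⟩))
    refine ⟨insert (y, c) B, ⟨by rw [Finset.union_insert]; exact hext, ?_⟩, ?_, ?_⟩
    · intro e he
      rcases Finset.mem_insert.1 he with rfl | he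
      · exact fun h => hc (mem_taken_union.2 (Or.inl h))
      · exact hB.fresh e he
    · intro e he
      rcases Finset.mem_insert.1 he with rfl | he
      · rfl
      · exact hBy e he
    · rw [Finset.card_insert_of_notMem hcB, hBc]

lemma GrowthSetting.exists_level (hS : GrowthSetting G m w D f W) {A : Finset (V × V)}
    (hA : Extendable G (2 * m) f W A) (Y : Finset V)
    (hY : ∀ y ∈ Y, y ∈ taken W A ∧ outdeg A y = 0 ∧ f y = D)
    (hw : (taken W A).card + D * Y.card ≤ w) :
    ∃ B, IsExtension G m f W A B ∧ (∀ e ∈ B, e.1 ∈ Y) ∧ B.card = D * Y.card := by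
  induction Y using Finset.induction_on with
  | empty => exact ⟨∅, ⟨by simpa using hA, by simp⟩, by simp, by simp⟩
  | insert y Y hyY ih =>
    rw [Finset.card_insert_of_notMem hyY, Nat.mul_succ] at hw
    obtain ⟨B, hB, hBY, hBc⟩ := ih (fun z hz => hY z (Finset.mem_insert_of_mem hz)) (by omega)
    obtain ⟨h1, h2, h3⟩ := hY y (Finset.mem_insert_self _ _)
    have h4 : outdeg B y = 0 := outdeg_eq_zero fun e he h => hyY (h ▸ hBY e he)
    have h5 := outdeg_union_le A B y
    obtain ⟨C, hC, hCy, hCc⟩ := hS.exists_children hB.ext (mem_taken_union.2 (Or.inl h1)) D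
      (by omega) (by have := card_taken_union_le (W := W) A B; omega)
    have hdisj : Disjoint B C := by
      rw [Finset.disjoint_left]
      exact fun e he he' => hC.fresh e he' (mem_taken_union.2 (Or.inr ⟨e.1, he⟩))
    refine ⟨B ∪ C, hB.trans hC, ?_, ?_⟩
    · intro e he
      rcases Finset.mem_union.1 he with he | he
      · exact Finset.mem_insert_of_mem (hBY e he)
      · rw [hCy e he]; exact Finset.mem_insert_self _ _
    · rw [Finset.card_union_of_disjoint hdisj, hBc, hCc, Finset.card_insert_of_notMem hyY,
        Nat.mul_succ]

/-- A tree of depth `h + 1` with `D ^ h` leaves, below a root with a unit of spare demand. -/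
lemma GrowthSetting.exists_tree (hS : GrowthSetting G m w D f W) (hD : 2 ≤ D)
    {A : Finset (V × V)} (hA : Extendable G (2 * m) f W A) {r : V} (hr : r ∈ taken W A)
    (hrf : outdeg A r < f r) (h : ℕ) (hw : (taken W A).card + 2 * D ^ h ≤ w) :
    ∃ (B : Finset (V × V)) (Y : Finset V), IsExtension G m f W A B ∧ B.card ≤ 2 * D ^ h ∧
      (∀ e ∈ B, e.1 = r ∨ e.1 ∉ taken W A) ∧ Y.card = D ^ h ∧
      ∀ y ∈ Y, outdeg (A ∪ B) y = 0 ∧ y ∉ taken W A ∧ ∃ z : List V,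
        List.IsChain (fun a b => (b, a) ∈ B) (y :: z ++ [r]) ∧ (y :: z).Nodup ∧ z.length = h ∧
        ∀ x ∈ y :: z, ∃ p, (p, x) ∈ B := by
  induction h with
  | zero =>
    -- The root gets a single child, so that a connection costs it only one unit of demand;
    -- branching starts one level below.
    obtain ⟨B, hB, hBr, hBc⟩ := hS.exists_children hA hr 1 (by omega) (by simp at hw; omega)
    obtain ⟨e, rfl⟩ := Finset.card_eq_one.1 hBc
    have her : e.1 = r := hBr e (by simp)
    have hf := hB.fresh e (by simp)
    refine ⟨{e}, {e.2}, hB, by simp, by simp [her], by simp, ?_⟩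
    simp only [Finset.mem_singleton, forall_eq]
    refine ⟨?_, hf, [], by simp [← her], by simp, rfl, ?_⟩
    · refine outdeg_eq_zero fun e' he' h' => ?_
      rcases Finset.mem_union.1 he' with he' | he'
      · exact hf (h' ▸ hA.fst_mem e' he')
      · rw [Finset.mem_singleton.1 he', her] at h'
        exact hf (h' ▸ hr)
    · intro x hx
      rw [List.mem_singleton.1 hx]
      exact ⟨e.1, rfl⟩
  | succ h ih =>
    -- As `D ≥ 2`, the new level is at least as large as the bound for the old tree, so twice the
    -- last level bounds the total.
    have hpow : 2 * D ^ h ≤ D ^ (h + 1) := by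
      rw [pow_succ, mul_comm]; exact Nat.mul_le_mul_left _ hD
    obtain ⟨B, Y, hB, hBc, hBr, hYc, hY⟩ := ih (by omega)
    have hYt : ∀ y ∈ Y, y ∈ taken W (A ∪ B) := by
      intro y hy
      obtain ⟨-, -, z, -, -, -, hz⟩ := hY y hy
      exact mem_taken_union.2 (Or.inr (hz y (by simp)))
    have hlev := hS.exists_level hB.ext Y (fun y hy => ⟨hYt y hy, (hY y hy).1,
      hS.demand_eq y fun h' => (hY y hy).2.1 (mem_taken.2 (Or.inl h'))⟩)
      (by
        have := card_taken_union_le (W := W) A B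
        rw [hYc, ← pow_succ']; omega)
    obtain ⟨C, hC, hCY, hCc⟩ := hlev
    rw [hYc, ← pow_succ'] at hCc
    have hCsnd : ∀ e ∈ C, ∀ e' ∈ C, e.2 = e'.2 → e = e' := fun e he e' he' =>
      hC.ext.inj e (Finset.mem_union_right _ he) e' (Finset.mem_union_right _ he')
    refine ⟨B ∪ C, C.image Prod.snd, hB.trans hC, ?_, ?_, ?_, ?_⟩
    · exact (Finset.card_union_le _ _).trans (by omega)
    · intro e he
      rcases Finset.mem_union.1 he with he | he
      · exact hBr e he
      · exact Or.inr (hY _ (hCY e he)).2.1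
    · rw [Finset.card_image_of_injOn (fun e he e' he' => hCsnd e he e' he'), hCc]
    · intro y' hy'
      obtain ⟨e, he, rfl⟩ := Finset.mem_image.1 hy'
      have hfr := hC.fresh e he
      refine ⟨?_, fun h' => hfr (mem_taken_union.2 (Or.inl h')), ?_⟩
      · refine outdeg_eq_zero fun e' he' h' => ?_
        rw [← Finset.union_assoc] at he'
        rcases Finset.mem_union.1 he' with he' | he'
        · exact hfr (h' ▸ hB.ext.fst_mem e' he')
        · exact hfr (h' ▸ hYt _ (hCY e' he'))
      · obtain ⟨-, -, z, hz1, hz2, hz3, hz4⟩ := hY _ (hCY e he)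
        refine ⟨e.1 :: z, ?_, ?_, by simp [hz3], ?_⟩
        · rw [List.cons_append, List.isChain_cons]
          refine ⟨?_, hz1.imp fun a b hab => Finset.mem_union_left _ hab⟩
          intro b hb
          simp only [List.cons_append, List.head?_cons, Option.mem_def, Option.some.injEq] at hb
          exact hb ▸ Finset.mem_union_right _ he
        · rw [List.nodup_cons]
          refine ⟨fun hmem => ?_, hz2⟩
          exact hfr (mem_taken_union.2 (Or.inr (hz4 _ hmem)))
        · intro x hx
          rcases List.mem_cons.1 hx with rfl | hx
          · exact ⟨e.1, Finset.mem_union_right _ he⟩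
          · obtain ⟨p, hp⟩ := hz4 x hx
            exact ⟨p, Finset.mem_union_left _ hp⟩

/-- The pairs (next element, element) of a list. -/
def backPairs : List V → Finset (V × V)
  | [] => ∅
  | [_] => ∅
  | a :: b :: l => insert (b, a) (backPairs (b :: l))

omit [Fintype V] in
lemma backPairs_subset {R : Finset (V × V)} :
    ∀ l : List V, List.IsChain (fun a b => (b, a) ∈ R) l → backPairs l ⊆ R
  | [], _ => by simp [backPairs]
  | [_], _ => by simp [backPairs]
  | a :: b :: l, h => by
    rw [List.isChain_cons_cons] at h
    exact Finset.insert_subset h.1 (backPairs_subset (b :: l) h.2)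

omit [Fintype V] in
lemma mem_of_mem_backPairs_fst {e : V × V} :
    ∀ l : List V, e ∈ backPairs l → e.1 ∈ l.tail
  | [], h => by simp [backPairs] at h
  | [_], h => by simp [backPairs] at h
  | a :: b :: l, h => by
    rcases Finset.mem_insert.1 h with rfl | h
    · simp
    · exact List.mem_of_mem_tail (mem_of_mem_backPairs_fst (b :: l) h)

omit [Fintype V] in
lemma mem_backPairs_snd {e : V × V} {r : V} :
    ∀ l : List V, e ∈ backPairs (l ++ [r]) → e.2 ∈ l
  | [], h => by simp [backPairs] at h
  | [a], h => by simp [backPairs] at h; simp [h]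
  | a :: b :: l, h => by
    rcases Finset.mem_insert.1 h with rfl | h
    · simp
    · exact List.mem_cons_of_mem _ (mem_backPairs_snd (b :: l) h)

omit [Fintype V] in
lemma exists_mem_backPairs {x r : V} :
    ∀ l : List V, x ∈ l → ∃ p, (p, x) ∈ backPairs (l ++ [r])
  | [], h => by simp at h
  | [a], h => by
    rw [List.mem_singleton] at h; subst h; exact ⟨r, by simp [backPairs]⟩
  | a :: b :: l, h => by
    rcases List.mem_cons.1 h with rfl | h
    · exact ⟨b, Finset.mem_insert_self _ _⟩
    · obtain ⟨p, hp⟩ := exists_mem_backPairs (b :: l) h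
      exact ⟨p, Finset.mem_insert_of_mem hp⟩

omit [Fintype V] in
lemma card_backPairs_le : ∀ l : List V, (backPairs l).card ≤ l.length - 1
  | [] => by simp [backPairs]
  | [_] => by simp [backPairs]
  | a :: b :: l => by
    refine (Finset.card_insert_le _ _).trans ?_
    have := card_backPairs_le (b :: l)
    simp at this ⊢; omega

omit [Fintype V] in
lemma outdeg_backPairs_le {r : V} : ∀ l : List V, r ∉ l → outdeg (backPairs (l ++ [r])) r ≤ 1
  | [], _ => by simp [backPairs, outdeg]
  | [a], _ => by
    have : backPairs ([a] ++ [r]) = {(r, a)} := by simp [backPairs]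
    rw [this]; exact Finset.card_filter_le _ _
  | a :: b :: l, h => by
    have ih := outdeg_backPairs_le (b :: l) fun h' => h (List.mem_cons_of_mem _ h')
    have : b ≠ r := by rintro rfl; simp at h
    change outdeg (insert (b, a) (backPairs (b :: l ++ [r]))) r ≤ 1
    unfold outdeg at ih ⊢
    rw [Finset.filter_insert, if_neg this]
    exact ih

/-- Two taken vertices with spare demand are joined by a path of `2 * h + 2` new vertices, and
extendability survives. -/
lemma GrowthSetting.exists_connection (hS : GrowthSetting G m w D f W) (hD : 2 ≤ D)
    {A : Finset (V × V)} (hA : Extendable G (2 * m) f W A) {r r' : V} (hr : r ∈ taken W A)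
    (hr' : r' ∈ taken W A) (hne : r ≠ r') (hrf : outdeg A r < f r) (hrf' : outdeg A r' < f r')
    {h : ℕ} (hm : m ≤ D ^ h) (hw : (taken W A).card + 4 * D ^ h ≤ w) :
    ∃ (mid : List V) (B : Finset (V × V)), List.IsChain G.Adj (r' :: mid ++ [r]) ∧ mid.Nodup ∧
      mid.length = 2 * h + 2 ∧ (∀ x ∈ mid, x ∉ taken W A) ∧ Extendable G (2 * m) f W (A ∪ B) ∧
      (∀ e ∈ B, e.2 ∈ mid ∧ (e.1 = r ∨ e.1 = r' ∨ e.1 ∈ mid)) ∧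
      (∀ x ∈ mid, x ∈ taken W (A ∪ B)) ∧
      outdeg B r ≤ 1 ∧ outdeg B r' ≤ 1 ∧ B.card ≤ 2 * h + 2 := by
  obtain ⟨B₁, Y₁, hB₁, hB₁c, hB₁r, hY₁c, hY₁⟩ := hS.exists_tree hD hA hr hrf h (by omega)
  have hdeg : outdeg B₁ r' = 0 := by
    refine outdeg_eq_zero fun e he h' => ?_
    rcases hB₁r e he with h1 | h1
    · exact hne (h1.symm.trans h')
    · exact h1 (h' ▸ hr')
  have h1 := outdeg_union_le A B₁ r'
  have h2 := card_taken_union_le (W := W) A B₁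
  -- The second tree extends the family that already contains the first, which makes the two trees
  -- disjoint; the first tree gave `r'` no child, so its spare demand is intact.
  obtain ⟨B₂, Y₂, hB₂, hB₂c, hB₂r, hY₂c, hY₂⟩ := hS.exists_tree hD hB₁.ext (r := r')
    (mem_taken_union.2 (Or.inl hr')) (by omega) h (by omega)
  have hY₁t : ∀ z : List V, (∀ x ∈ z, ∃ p, (p, x) ∈ B₁) → ∀ x ∈ z, x ∈ taken W (A ∪ B₁) :=
    fun z hz x hx => mem_taken_union.2 (Or.inr (hz x hx))
  have hdisj : Disjoint Y₁ Y₂ := by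
    rw [Finset.disjoint_left]
    intro y hy hy'
    obtain ⟨-, -, z, -, -, -, hz⟩ := hY₁ y hy
    exact (hY₂ y hy').2.1 (hY₁t _ hz y (by simp))
  obtain ⟨y₁, hy₁, y₂, hy₂, hadj⟩ := hS.joined Y₁ Y₂ hdisj (by omega) (by omega)
  obtain ⟨-, -, z₁, c₁, n₁, l₁, p₁⟩ := hY₁ y₁ hy₁
  obtain ⟨-, -, z₂, c₂, n₂, l₂, p₂⟩ := hY₂ y₂ hy₂
  have hext := hB₂.ext
  set q₁ := y₁ :: z₁ with hq₁
  set q₂ := y₂ :: z₂ with hq₂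
  have f₁ : ∀ x ∈ q₁, x ∉ taken W A := fun x hx => by
    obtain ⟨p, hp⟩ := p₁ x hx; exact hB₁.fresh _ hp
  have f₂' : ∀ x ∈ q₂, x ∉ taken W (A ∪ B₁) := fun x hx => by
    obtain ⟨p, hp⟩ := p₂ x hx; exact hB₂.fresh _ hp
  have f₂ : ∀ x ∈ q₂, x ∉ taken W A := fun x hx h' =>
    f₂' x hx (mem_taken_union.2 (Or.inl h'))
  have hrq₁ : r ∉ q₁ := fun h' => f₁ _ h' hr
  have hrq₂ : r ∉ q₂ := fun h' => f₂ _ h' hr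
  have hr'q₁ : r' ∉ q₁ := fun h' => f₁ _ h' hr'
  have hr'q₂ : r' ∉ q₂ := fun h' => f₂ _ h' hr'
  set P₁ := backPairs (q₁ ++ [r])
  set P₂ := backPairs (q₂ ++ [r'])
  have s₁ : P₁ ⊆ B₁ := backPairs_subset _ c₁
  have s₂ : P₂ ⊆ B₂ := backPairs_subset _ c₂
  have t₁ : ∀ e ∈ P₁, e.2 ∈ q₁ ∧ (e.1 = r ∨ e.1 ∈ q₁) := fun e he => by
    refine ⟨mem_backPairs_snd _ he, ?_⟩
    have := List.mem_of_mem_tail (mem_of_mem_backPairs_fst _ he)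
    simp only [List.mem_append, List.mem_singleton] at this
    tauto
  have t₂ : ∀ e ∈ P₂, e.2 ∈ q₂ ∧ (e.1 = r' ∨ e.1 ∈ q₂) := fun e he => by
    refine ⟨mem_backPairs_snd _ he, ?_⟩
    have := List.mem_of_mem_tail (mem_of_mem_backPairs_fst _ he)
    simp only [List.mem_append, List.mem_singleton] at this
    tauto
  have hcov : ∀ x ∈ q₂.reverse ++ q₁, x ∈ taken W (A ∪ (P₁ ∪ P₂)) := by
    intro x hx
    rw [mem_taken_union]
    right
    rcases List.mem_append.1 hx with hx | hx
    · obtain ⟨p, hp⟩ := exists_mem_backPairs (r := r') q₂ (List.mem_reverse.1 hx)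
      exact ⟨p, Finset.mem_union_right _ hp⟩
    · obtain ⟨p, hp⟩ := exists_mem_backPairs (r := r) q₁ hx
      exact ⟨p, Finset.mem_union_left _ hp⟩
  have hsrc : ∀ e ∈ P₁ ∪ P₂, e.2 ∈ q₂.reverse ++ q₁ ∧
      (e.1 = r ∨ e.1 = r' ∨ e.1 ∈ q₂.reverse ++ q₁) := by
    intro e he
    simp only [List.mem_append, List.mem_reverse]
    rcases Finset.mem_union.1 he with he | he
    · have := t₁ e he; tauto
    · have := t₂ e he; tauto
  refine ⟨q₂.reverse ++ q₁, P₁ ∪ P₂, ?_, ?_, ?_, ?_, ?_, hsrc, hcov, ?_, ?_, ?_⟩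
  · have e : r' :: (q₂.reverse ++ q₁) ++ [r] = (q₂ ++ [r']).reverse ++ (q₁ ++ [r]) := by simp
    rw [e, List.isChain_append]
    refine ⟨?_, ?_, ?_⟩
    · rw [List.isChain_reverse]
      exact c₂.imp fun a b hab => hext.adj _ (Finset.mem_union_right _ hab)
    · exact c₁.imp fun a b hab => (hB₁.ext.adj _ (Finset.mem_union_right _ hab)).symm
    · intro a ha b hb
      rw [List.getLast?_reverse] at ha
      simp only [hq₁, hq₂, List.cons_append, List.head?_cons, Option.mem_def,
        Option.some.injEq] at ha hb
      subst ha hb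
      exact hadj.symm
  · rw [List.nodup_append]
    refine ⟨List.nodup_reverse.2 n₂, n₁, ?_⟩
    rintro a ha b hb rfl
    exact f₂' a (List.mem_reverse.1 ha) (hY₁t _ p₁ a hb)
  · simp [hq₁, hq₂, l₁, l₂]; omega
  · intro x hx
    rcases List.mem_append.1 hx with hx | hx
    · exact f₂ x (List.mem_reverse.1 hx)
    · exact f₁ x hx
  -- Only the two branches that end at the joining edge are kept; all other tree vertices become
  -- free again.
  · refine hext.restrict ?_ ?_
    · intro e he
      simp only [Finset.mem_union] at he ⊢
      rcases he with he | he | he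
      · exact Or.inl (Or.inl he)
      · exact Or.inl (Or.inr (s₁ he))
      · exact Or.inr (s₂ he)
    · intro e he
      rcases Finset.mem_union.1 he with he | he
      · exact mem_taken_union.2 (Or.inl (hA.fst_mem e he))
      · rcases (hsrc e he).2 with h' | h' | h'
        · rw [h']; exact mem_taken_union.2 (Or.inl hr)
        · rw [h']; exact mem_taken_union.2 (Or.inl hr')
        · exact hcov _ h'
  · refine (outdeg_union_le _ _ _).trans ?_
    have a1 : outdeg P₁ r ≤ 1 := outdeg_backPairs_le q₁ hrq₁
    have a2 : outdeg P₂ r = 0 := outdeg_eq_zero fun e he h' => by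
      rcases (t₂ e he).2 with h3 | h3
      · exact hne (h'.symm.trans h3)
      · exact hrq₂ (h' ▸ h3)
    omega
  · refine (outdeg_union_le _ _ _).trans ?_
    have a1 : outdeg P₂ r' ≤ 1 := outdeg_backPairs_le q₂ hr'q₂
    have a2 : outdeg P₁ r' = 0 := outdeg_eq_zero fun e he h' => by
      rcases (t₁ e he).2 with h3 | h3
      · exact hne (h3.symm.trans h')
      · exact hr'q₁ (h' ▸ h3)
    omega
  · refine (Finset.card_union_le _ _).trans ?_
    have a1 := card_backPairs_le (q₁ ++ [r])
    have a2 := card_backPairs_le (q₂ ++ [r'])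
    simp only [hq₁, hq₂, List.length_append, List.length_cons, l₁, l₂, List.length_nil] at a1 a2
    change P₁.card ≤ _ at a1
    change P₂.card ≤ _ at a2
    omega

end Connecting

/-! ### Threading a path through the special vertices. -/

section Threading

variable {n : ℕ}

/-- The setting for a path through the first `s` vertices: `X` is a set of further vertices, each
attached to a neighbour `g v` among the first `s`, which the path has to visit as well. -/
structure ThreadSetting (G : SimpleGraph (Fin n)) (s m w D : ℕ) (f : Fin n → ℕ)
    (W X : Finset (Fin n)) (g : Fin n → Fin n) : Prop extends GrowthSetting G m w D f W where
  two_le : 2 ≤ D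
  special_mem : ∀ x : Fin n, x.val < s → x ∈ W
  mem_of_attached : ∀ v ∈ X, v ∈ W
  le_of_attached : ∀ v ∈ X, s ≤ v.val
  g_lt : ∀ v ∈ X, (g v).val < s
  g_adj : ∀ v ∈ X, G.Adj v (g v)
  g_inj : ∀ v ∈ X, ∀ v' ∈ X, g v = g v' → v = v'
  two_le_demand : ∀ x : Fin n, x.val < s → 2 ≤ f x
  one_le_demand : ∀ v ∈ X, 1 ≤ f v
  extendable : Extendable G (2 * m) f W ∅

/-- A path `hd :: tl ++ [a]` visiting, in decreasing order, the first `i` vertices, and the attached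
vertices that belong to the first `j`. -/
structure Thread (G : SimpleGraph (Fin n)) (s m h : ℕ) (f : Fin n → ℕ)
    (W X : Finset (Fin n)) (g : Fin n → Fin n) (i j : ℕ) (A : Finset (Fin n × Fin n))
    (hd : Fin n) (tl : List (Fin n)) (a : Fin n) : Prop where
  ext : Extendable G (2 * m) f W A
  chain : List.IsChain G.Adj (hd :: tl ++ [a])
  nodup : (hd :: tl ++ [a]).Nodup
  end_notMem : a ∉ W
  mem_taken : ∀ x ∈ hd :: tl ++ [a], x ∈ taken W A
  src_mem : ∀ e ∈ A, e.1 ∈ hd :: tl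
  outdeg_lt : outdeg A hd < f hd
  special_iff : ∀ x : Fin n, x.val < s → (x ∈ hd :: tl ↔ x.val < i)
  attached_iff : ∀ v ∈ X, (v ∈ hd :: tl ↔ (g v).val < j)
  sorted : ((hd :: tl).filter fun x => x.val < s).Pairwise (· > ·)
  card_le : A.card ≤ 1 + i * (2 * h + 2)
  length_le : tl.length + 1 ≤ i * (2 * h + 3) + j

variable {G : SimpleGraph (Fin n)} {s m w D h : ℕ} {f : Fin n → ℕ} {W X : Finset (Fin n)}
  {g : Fin n → Fin n}

/-- If an attached vertex is assigned to the special vertex just reached, it must be visited at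
once: it becomes the new head, and its demand is untouched because it has no children. Injectivity
of `g` leaves at most one such vertex. -/
lemma ThreadSetting.cap (hS : ThreadSetting G s m w D f W X g) {i : ℕ}
    {A : Finset (Fin n × Fin n)} {hd : Fin n} {tl : List (Fin n)} {a : Fin n}
    (hT : Thread G s m h f W X g (i + 1) i A hd tl a) (hhd : hd.val = i) :
    ∃ hd' tl', Thread G s m h f W X g (i + 1) (i + 1) A hd' tl' a := by
  by_cases hex : ∃ v ∈ X, (g v).val = i
  · obtain ⟨v, hv, hgv⟩ := hex
    have hghd : g v = hd := Fin.ext (hgv.trans hhd.symm)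
    have hvl : v ∉ hd :: tl := fun h' => by
      have := (hT.attached_iff v hv).1 h'; omega
    have hva : v ≠ a := fun h' => hT.end_notMem (h' ▸ hS.mem_of_attached v hv)
    have hvs := hS.le_of_attached v hv
    refine ⟨v, hd :: tl, ⟨hT.ext, ?_, ?_, hT.end_notMem, ?_, ?_, ?_, ?_, ?_, ?_, hT.card_le, ?_⟩⟩
    · rw [List.cons_append, List.isChain_cons]
      refine ⟨?_, hT.chain⟩
      intro b hb
      simp only [List.cons_append, List.head?_cons, Option.mem_def, Option.some.injEq] at hb
      rw [← hb, ← hghd]; exact hS.g_adj v hv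
    · rw [List.cons_append, List.nodup_cons]
      refine ⟨?_, hT.nodup⟩
      rw [List.mem_append, List.mem_singleton]
      tauto
    · intro x hx
      rw [List.cons_append] at hx
      rcases List.mem_cons.1 hx with rfl | hx
      · exact Finset.mem_union_left _ (hS.mem_of_attached _ hv)
      · exact hT.mem_taken x hx
    · exact fun e he => List.mem_cons_of_mem _ (hT.src_mem e he)
    · rw [outdeg_eq_zero (x := v) fun e he h' => hvl (h' ▸ hT.src_mem e he)]
      exact hS.one_le_demand v hv
    · intro x hx
      rw [← hT.special_iff x hx, List.mem_cons (a := x) (b := v)]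
      refine or_iff_right fun h' => ?_
      subst h'; omega
    · intro v' hv'
      rw [List.mem_cons (a := v') (b := v), hT.attached_iff v' hv']
      constructor
      · rintro (rfl | h') <;> omega
      · intro h'
        rcases Nat.lt_succ_iff_lt_or_eq.1 h' with h' | h'
        · exact Or.inr h'
        · exact Or.inl (hS.g_inj v' hv' v hv (Fin.ext (h'.trans hgv.symm)))
    · rw [List.filter_cons_of_neg (by simpa using hvs)]
      exact hT.sorted
    · have := hT.length_le
      simp; omega
  · push Not at hex
    refine ⟨hd, tl, ⟨hT.ext, hT.chain, hT.nodup, hT.end_notMem, hT.mem_taken, hT.src_mem,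
      hT.outdeg_lt, hT.special_iff, ?_, hT.sorted, hT.card_le, ?_⟩⟩
    · intro v hv
      rw [hT.attached_iff v hv]
      have := hex v hv
      omega
    · have := hT.length_le
      omega

lemma ThreadSetting.exists_start (hS : ThreadSetting G s m w D f W X g) (hs : 0 < s) (hsn : s ≤ n)
    (hw : W.card ≤ w) :
    ∃ A hd tl a, Thread G s m h f W X g 1 1 A hd tl a := by
  let x : Fin n := ⟨0, by omega⟩
  have hxW : x ∈ W := hS.special_mem x hs
  have h2 := hS.two_le_demand x hs
  obtain ⟨a, ha, hadj, hext⟩ := hS.extendable.exists_child hS.one_le hS.big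
    (by simpa [taken] using hw) (s := x) (by simpa [taken] using hxW)
    (by rw [outdeg_eq_zero (by simp)]; omega)
  have haW : a ∉ W := by simpa [taken] using ha
  have hne : x ≠ a := fun h' => haW (h' ▸ hxW)
  have hone : outdeg (insert (x, a) ∅) x ≤ 1 := by
    exact (Finset.card_filter_le _ _).trans (by simp)
  suffices h' : Thread G s m h f W X g 1 0 (insert (x, a) ∅) x [] a by
    obtain ⟨hd, tl, h''⟩ := hS.cap (i := 0) h' rfl
    exact ⟨_, hd, tl, a, h''⟩
  refine ⟨hext, by simpa using hadj, by simpa using hne, haW, ?_, by simp, by omega, ?_, ?_, ?_,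
    by simp, by simp⟩
  · simp [mem_taken, hxW]
  · intro y _
    simp [x, Fin.ext_iff]
  · intro v hv
    have h1 := hS.le_of_attached v hv
    simp only [List.mem_singleton, not_lt_zero, iff_false]
    rintro rfl
    simp [x] at h1; omega
  · simp [x, hs]

/-- A connection spends one unit of demand at each of its ends. The new special vertex has demand at
least 2, so it can be continued either to the next special vertex or through its attached vertex. -/
lemma ThreadSetting.exists_next (hS : ThreadSetting G s m w D f W X g) (hsn : s ≤ n)
    (hm : m ≤ D ^ h) (hw : W.card + (2 + s * (2 * h + 2)) + 4 * D ^ h ≤ w) {i : ℕ} (hi : i < s)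
    {A : Finset (Fin n × Fin n)} {hd : Fin n} {tl : List (Fin n)} {a : Fin n}
    (hT : Thread G s m h f W X g i i A hd tl a) :
    ∃ A' hd' tl', Thread G s m h f W X g (i + 1) (i + 1) A' hd' tl' a := by
  let x : Fin n := ⟨i, by omega⟩
  have hxW : x ∈ W := hS.special_mem x hi
  have h2 := hS.two_le_demand x hi
  have hxl : x ∉ hd :: tl := fun h' => by have := (hT.special_iff x hi).1 h'; simp [x] at this
  have hxdeg : outdeg A x = 0 := outdeg_eq_zero fun e he h' => hxl (h' ▸ hT.src_mem e he)
  have hmul : i * (2 * h + 2) ≤ s * (2 * h + 2) := Nat.mul_le_mul_right _ hi.le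
  have hct := card_taken_le W A
  have hAc := hT.card_le
  obtain ⟨mid, B, c1, c2, c3, c4, c5, c6, c7, c8, c9, c10⟩ :=
    hS.toGrowthSetting.exists_connection hS.two_le hT.ext (r := hd) (r' := x)
      (hT.mem_taken hd (by simp)) (Finset.mem_union_left _ hxW) (fun h' => hxl (by simp [← h']))
      hT.outdeg_lt (by omega) hm (by omega)
  have hmidl : ∀ y ∈ mid, y ∉ hd :: tl ++ [a] := fun y hy h' => c4 y hy (hT.mem_taken y h')
  have hmidW : ∀ y ∈ mid, y ∉ W := fun y hy h' => c4 y hy (Finset.mem_union_left _ h')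
  have hxa : x ≠ a := fun h' => hT.end_notMem (h' ▸ hxW)
  refine ⟨A ∪ B, ?_⟩
  refine hS.cap (i := i) (hd := x) (tl := mid ++ hd :: tl) ?_ rfl
  refine ⟨c5, ?_, ?_, hT.end_notMem, ?_, ?_, ?_, ?_, ?_, ?_, ?_, ?_⟩
  · have e1 : x :: (mid ++ hd :: tl) ++ [a] = (x :: mid ++ [hd]) ++ (tl ++ [a]) := by simp
    rw [e1]
    refine List.IsChain.append_overlap (l₂ := [hd]) (by simpa using c1) ?_ (by simp)
    simpa using hT.chain
  · have e1 : x :: (mid ++ hd :: tl) ++ [a] = (x :: mid) ++ (hd :: tl ++ [a]) := by simp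
    rw [e1, List.nodup_append]
    refine ⟨?_, hT.nodup, ?_⟩
    · exact List.nodup_cons.2 ⟨fun h' => hmidW x h' hxW, c2⟩
    · rintro y hy y' hy' rfl
      rcases List.mem_cons.1 hy with rfl | hy
      · rw [List.mem_append, List.mem_singleton] at hy'
        tauto
      · exact hmidl y hy hy'
  · intro y hy
    have e1 : x :: (mid ++ hd :: tl) ++ [a] = x :: (mid ++ (hd :: tl ++ [a])) := by simp
    rw [e1] at hy
    rcases List.mem_cons.1 hy with rfl | hy
    · exact Finset.mem_union_left _ hxW
    · rcases List.mem_append.1 hy with hy | hy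
      · exact c7 y hy
      · exact taken_mono Finset.subset_union_left (hT.mem_taken y hy)
  · intro e he
    rcases Finset.mem_union.1 he with he | he
    · exact List.mem_cons_of_mem _ (List.mem_append_right _ (hT.src_mem e he))
    · rcases (c6 e he).2 with h' | h' | h'
      · rw [h']; simp
      · rw [h']; simp
      · exact List.mem_cons_of_mem _ (List.mem_append_left _ h')
  · have := outdeg_union_le A B x
    omega
  · intro y hy
    have hym : y ∉ mid := fun h' => hmidW y h' (hS.special_mem y hy)
    rw [List.mem_cons (b := x), List.mem_append, hT.special_iff y hy]
    simp only [hym, false_or, x, Fin.ext_iff]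
    omega
  · intro v hv
    have hvm : v ∉ mid := fun h' => hmidW v h' (hS.mem_of_attached v hv)
    have hvx : v ≠ x := fun h' => by
      have := hS.le_of_attached v hv; rw [h'] at this; simp [x] at this; omega
    rw [List.mem_cons (b := x), List.mem_append, hT.attached_iff v hv]
    simp [hvm, hvx]
  · have hmid0 : mid.filter (fun x => decide (x.val < s)) = [] := by
      rw [List.filter_eq_nil_iff]
      intro y hy h'
      exact hmidW y hy (hS.special_mem y (by simpa using h'))
    rw [List.filter_cons_of_pos (by simpa [x] using hi), List.filter_append, hmid0,
      List.nil_append, List.pairwise_cons]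
    refine ⟨?_, hT.sorted⟩
    intro y hy
    rw [List.mem_filter] at hy
    have := (hT.special_iff y (by simpa using hy.2)).1 hy.1
    exact this
  · refine (Finset.card_union_le _ _).trans ?_
    rw [Nat.add_mul]; omega
  · have := hT.length_le
    simp only [List.length_append, List.length_cons, c3]
    rw [Nat.add_mul]; omega

/-- A path through the first `s` vertices in decreasing order that leaves the remaining graph
expanding. -/
lemma ThreadSetting.exists_path (hS : ThreadSetting G s m w D f W X g) (hs : 0 < s) (hsn : s ≤ n)
    (hm : m ≤ D ^ h) (hw : W.card + (2 + s * (2 * h + 2)) + 4 * D ^ h ≤ w) :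
    ∃ (a b : Fin n) (int : List (Fin n)), int ≠ [] ∧ List.IsChain G.Adj (b :: int ++ [a]) ∧
      (b :: int ++ [a]).Nodup ∧ a ∉ W ∧ b ∉ W ∧ (∀ x : Fin n, x.val < s → x ∈ int) ∧
      (∀ v ∈ X, v ∈ int) ∧ (int.filter fun x => x.val < s).Pairwise (· > ·) ∧
      int.length ≤ s * (2 * h + 4) ∧
      ∀ U : Finset (Fin n), U.card ≤ 2 * m → (∀ x ∈ U, x ∉ int) →
        ∑ x ∈ U, f x ≤ (nbr G U \ (W ∪ (b :: int ++ [a]).toFinset)).card := by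
  have key : ∀ i, i < s → ∃ A hd tl a, Thread G s m h f W X g (i + 1) (i + 1) A hd tl a := by
    intro i
    induction i with
    | zero => exact fun _ => hS.exists_start hs hsn (by omega)
    | succ i ih =>
      intro hi
      obtain ⟨A, hd, tl, a, hT⟩ := ih (by omega)
      obtain ⟨A', hd', tl', hT'⟩ := hS.exists_next hsn hm hw hi hT
      exact ⟨A', hd', tl', a, hT'⟩
  obtain ⟨A, hd, tl, a, hT⟩ := key (s - 1) (by omega)
  rw [Nat.sub_add_cancel hs] at hT
  have hct := card_taken_le W A
  have hAc := hT.card_le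
  -- The last unit of demand of the head provides a second endpoint outside `W`, matching `a` at the
  -- other end.
  obtain ⟨b, hb, hadj, hext⟩ := hT.ext.exists_child hS.one_le hS.big (by omega)
    (hT.mem_taken hd (by simp)) hT.outdeg_lt
  refine ⟨a, b, hd :: tl, by simp, ?_, ?_, hT.end_notMem, fun h' => hb (Finset.mem_union_left _ h'),
    fun x hx => (hT.special_iff x hx).2 hx, fun v hv => (hT.attached_iff v hv).2 (hS.g_lt v hv),
    hT.sorted, ?_, ?_⟩
  · rw [List.cons_append, List.isChain_cons]
    refine ⟨?_, hT.chain⟩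
    intro c hc
    simp only [List.cons_append, List.head?_cons, Option.mem_def, Option.some.injEq] at hc
    rw [← hc]; exact hadj.symm
  · rw [List.cons_append, List.nodup_cons]
    exact ⟨fun h' => hb (hT.mem_taken b h'), hT.nodup⟩
  · have := hT.length_le
    rw [List.length_cons]
    calc _ ≤ _ := this
      _ = _ := by ring
  -- All parents lie in the interior of the path, so a set disjoint from it has no children to
  -- count, and its demand is met entirely by vertices off the path and off `W`.
  · intro U hU hUl
    have h1 := hext.demand U hU
    have h2 : ((insert (hd, b) A).filter fun e => e.1 ∈ U).card = 0 := by
      rw [Finset.card_eq_zero, Finset.filter_eq_empty_iff]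
      intro e he h'
      rcases Finset.mem_insert.1 he with rfl | he
      · exact hUl _ h' (by simp)
      · exact hUl _ h' (hT.src_mem e he)
    rw [h2, Nat.add_zero] at h1
    refine h1.trans (Finset.card_le_card (Finset.sdiff_subset_sdiff le_rfl ?_))
    intro x hx
    rw [taken_insert, Finset.mem_insert]
    rcases Finset.mem_union.1 hx with hx | hx
    · exact Or.inr (Finset.mem_union_left _ hx)
    · rw [List.mem_toFinset, List.cons_append, List.mem_cons] at hx
      exact hx.imp id (hT.mem_taken x)

end Threading

/-! ### Typical graphs and their expansion. -/

section Typical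

variable {n : ℕ}

/-- The first `s` vertices. -/
def firstVerts (n s : ℕ) : Finset (Fin n) := Finset.univ.filter fun v => v.val < s

/-- The neighbours of `v` that are not among the first `s` vertices. -/
noncomputable def freeNbr (G : SimpleGraph (Fin n)) (s : ℕ) (v : Fin n) : Finset (Fin n) :=
  nbr G {v} \ firstVerts n s

/-- The vertices with fewer than `k` neighbours outside the first `s` vertices. -/
noncomputable def smallVerts (G : SimpleGraph (Fin n)) (s k : ℕ) : Finset (Fin n) :=
  Finset.univ.filter fun v => (freeNbr G s v).card < k

/-- The properties of a sparse random graph from which a long ordered path can be built. -/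
structure TypicalGraph (G : SimpleGraph (Fin n)) (s k m D : ℕ) : Prop where
  joined : ∀ X Y : Finset (Fin n), Disjoint X Y → m ≤ X.card → m ≤ Y.card →
    ∃ x ∈ X, ∃ y ∈ Y, G.Adj x y
  sparse : ∀ X : Finset (Fin n), X.Nonempty → X.card ≤ (D + 2) * (2 * m) →
    ∀ F : Finset (Sym2 (Fin n)), (∀ e ∈ F, e ∈ G.edgeSet ∧ ∀ v ∈ e, v ∈ X) →
      F.card < D ^ 4 * X.card
  small_nonadj : ∀ u ∈ smallVerts G s k, ∀ v ∈ smallVerts G s k, ¬ G.Adj u v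
  small_common : ∀ u ∈ smallVerts G s k, ∀ v ∈ smallVerts G s k, u ≠ v → ∀ w,
    G.Adj u w → ¬ G.Adj v w
  small_path : ∀ v ∈ smallVerts G s k, ∀ v' ∈ smallVerts G s k, ∀ w u w',
    [v, w, u, w', v'].Nodup → G.Adj v w → G.Adj w u → G.Adj u w' → ¬ G.Adj w' v'
  small_cycle : ∀ v ∈ smallVerts G s k, ∀ w u w',
    [v, w, u, w'].Nodup → G.Adj v w → G.Adj w u → G.Adj u w' → ¬ G.Adj w' v
  two_le_degree : ∀ v, 2 ≤ (nbr G {v}).card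
  one_le_free : ∀ v, 1 ≤ (freeNbr G s v).card
  two_le_free : ∀ v : Fin n, v.val < s → 2 ≤ (freeNbr G s v).card

variable {G : SimpleGraph (Fin n)} {s k m D : ℕ}

lemma mem_firstVerts {v : Fin n} : v ∈ firstVerts n s ↔ v.val < s := by simp [firstVerts]

lemma mem_freeNbr {v w : Fin n} : w ∈ freeNbr G s v ↔ G.Adj v w ∧ s ≤ w.val := by
  simp [freeNbr, mem_firstVerts]

lemma mem_smallVerts {v : Fin n} : v ∈ smallVerts G s k ↔ (freeNbr G s v).card < k := by
  simp [smallVerts]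

lemma card_firstVerts_le : (firstVerts n s).card ≤ s := by
  have : (firstVerts n s).card ≤ (Finset.range s).card := by
    refine Finset.card_le_card_of_injOn Fin.val ?_ (fun a _ b _ h => Fin.ext h)
    intro v hv
    simpa [firstVerts] using hv
  simpa using this

/-- The vertices that connecting paths must avoid. -/
noncomputable def blockedVerts (G : SimpleGraph (Fin n)) (s k : ℕ) : Finset (Fin n) :=
  firstVerts n s ∪ smallVerts G s k

/-- The low-degree vertices which have to be visited next to one of the first `s` vertices. -/
noncomputable def attachedVerts (G : SimpleGraph (Fin n)) (s k : ℕ) : Finset (Fin n) :=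
  (smallVerts G s k).filter fun v => s ≤ v.val ∧ (freeNbr G s v).card < 2

/-- The number of neighbours reserved for a vertex. -/
noncomputable def demand (G : SimpleGraph (Fin n)) (s k D : ℕ) (v : Fin n) : ℕ :=
  if v ∈ smallVerts G s k then (if v ∈ attachedVerts G s k then 1 else 2) else D

lemma demand_le (hD : 2 ≤ D) (v : Fin n) : demand G s k D v ≤ D := by
  unfold demand; split_ifs <;> omega

lemma TypicalGraph.demand_le_free (hG : TypicalGraph G s k m D) {v : Fin n}
    (hv : v ∈ smallVerts G s k) : demand G s k D v ≤ (freeNbr G s v).card := by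
  unfold demand
  rw [if_pos hv]
  split_ifs with h
  · exact hG.one_le_free v
  · by_contra h'
    push Not at h'
    by_cases hs : v.val < s
    · have := hG.two_le_free v hs; omega
    · exact h (Finset.mem_filter.2 ⟨hv, by omega, h'⟩)

lemma TypicalGraph.free_eq (hG : TypicalGraph G s k m D) {v : Fin n}
    (hv : v ∈ smallVerts G s k) : freeNbr G s v = nbr G {v} \ blockedVerts G s k := by
  ext w
  simp only [freeNbr, blockedVerts, Finset.mem_sdiff, Finset.mem_union, mem_nbr,
    Finset.mem_singleton, exists_eq_left]
  have := hG.small_nonadj v hv w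
  tauto

/-- Small vertices share no neighbours and are not adjacent to each other, so their demands are met
separately by disjoint unblocked neighbourhoods. -/
lemma TypicalGraph.sum_demand_small (hG : TypicalGraph G s k m D) (U : Finset (Fin n))
    (hU : U ⊆ smallVerts G s k) :
    ∑ v ∈ U, demand G s k D v ≤ (nbr G U \ blockedVerts G s k).card := by
  have h1 : ∑ v ∈ U, demand G s k D v ≤ ∑ v ∈ U, (freeNbr G s v).card :=
    Finset.sum_le_sum fun v hv => hG.demand_le_free (hU hv)
  refine h1.trans ?_
  rw [← Finset.card_biUnion]
  · refine Finset.card_le_card ?_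
    intro w hw
    obtain ⟨v, hv, hw⟩ := Finset.mem_biUnion.1 hw
    rw [hG.free_eq (hU hv)] at hw
    rw [Finset.mem_sdiff] at hw ⊢
    exact ⟨nbr_mono G (Finset.singleton_subset_iff.2 hv) hw.1, hw.2⟩
  · intro u hu v hv huv
    rw [Function.onFun, Finset.disjoint_left]
    intro w hw hw'
    exact hG.small_common u (hU hu) v (hU hv) huv w (mem_freeNbr.1 hw).1 (mem_freeNbr.1 hw').1

/-- Otherwise `U` and its unblocked neighbours would form a set of at most `(D + 2) |U|` vertices
spanning at least `(k - 1) |U| / 2`, hence `D ^ 4 (D + 2) |U|`, edges, contrary to `sparse`. -/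
lemma TypicalGraph.card_nbr_big (hG : TypicalGraph G s k m D)
    (hk : 2 * D ^ 4 * (D + 2) + 1 ≤ k) (U : Finset (Fin n)) (hU : Disjoint U (smallVerts G s k))
    (hUm : U.card ≤ 2 * m) :
    (D + 1) * U.card ≤ (nbr G U \ blockedVerts G s k).card := by
  rcases U.eq_empty_or_nonempty with rfl | hne
  · simp
  by_contra hcon
  push Not at hcon
  set Q := nbr G U \ blockedVerts G s k with hQ
  let P : Finset (Fin n × Fin n) := U.sigma (fun u => nbr G {u} \ blockedVerts G s k) |>.map
    ⟨fun x => (x.1, x.2), fun x y h => by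
      obtain ⟨x1, x2⟩ := x; obtain ⟨y1, y2⟩ := y; simp at h; obtain ⟨rfl, rfl⟩ := h; rfl⟩
  have hPmem : ∀ e ∈ P, e.1 ∈ U ∧ e.2 ∈ Q ∧ G.Adj e.1 e.2 := by
    intro e he
    simp only [P, Finset.mem_map, Finset.mem_sigma] at he
    obtain ⟨⟨u, w⟩, ⟨h1, h2⟩, rfl⟩ := he
    simp only [Finset.mem_sdiff, mem_nbr, Finset.mem_singleton, exists_eq_left] at h1 h2
    exact ⟨h1, Finset.mem_sdiff.2 ⟨mem_nbr.2 ⟨u, h1, h2.1⟩, h2.2⟩, h2.1⟩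
  have hPcard : (k - 1) * U.card ≤ P.card := by
    simp only [P, Finset.card_map, Finset.card_sigma]
    rw [mul_comm, ← smul_eq_mul]
    refine Finset.card_nsmul_le_sum _ _ _ ?_
    intro u hu
    have hus : u ∉ smallVerts G s k := Finset.disjoint_left.1 hU hu
    have h1 : k ≤ (freeNbr G s u).card := by
      rw [mem_smallVerts] at hus; omega
    have h2 : freeNbr G s u ⊆ (nbr G {u} \ blockedVerts G s k) ∪
        (freeNbr G s u ∩ smallVerts G s k) := by
      intro w hw
      simp only [freeNbr, blockedVerts, Finset.mem_union, Finset.mem_inter,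
        Finset.mem_sdiff] at hw ⊢
      tauto
    -- Two small neighbours of `u` would have `u` as a common neighbour; this loss of one is why `k
    -- - 1` appears.
    have h3 : (freeNbr G s u ∩ smallVerts G s k).card ≤ 1 := by
      rw [Finset.card_le_one]
      intro a ha b hb
      by_contra hab
      rw [Finset.mem_inter, mem_freeNbr] at ha hb
      exact hG.small_common a ha.2 b hb.2 hab u ha.1.1.symm hb.1.1.symm
    have h4 := (Finset.card_le_card h2).trans (Finset.card_union_le _ _)
    omega
  let F : Finset (Sym2 (Fin n)) := P.image fun e => s(e.1, e.2)
  have hFcard : P.card ≤ 2 * F.card := by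
    refine Finset.card_le_mul_card_image P 2 ?_
    intro e he
    obtain ⟨e', he', rfl⟩ := Finset.mem_image.1 he
    have : (P.filter fun a => s(a.1, a.2) = s(e'.1, e'.2)) ⊆ {e', (e'.2, e'.1)} := by
      intro a ha
      rw [Finset.mem_filter, Sym2.eq_iff] at ha
      rw [Finset.mem_insert, Finset.mem_singleton]
      rcases ha.2 with h | h
      · exact Or.inl (Prod.ext h.1 h.2)
      · exact Or.inr (Prod.ext h.1 h.2)
    exact (Finset.card_le_card this).trans Finset.card_le_two
  have hXc : (U ∪ Q).card ≤ (D + 2) * U.card := by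
    have := Finset.card_union_le U Q
    calc (U ∪ Q).card ≤ U.card + (D + 1) * U.card := by omega
      _ = (D + 2) * U.card := by ring
  have hF := hG.sparse (U ∪ Q) (hne.mono Finset.subset_union_left)
    (hXc.trans (Nat.mul_le_mul_left _ hUm)) F (by
      intro e he
      obtain ⟨e', he', rfl⟩ := Finset.mem_image.1 he
      obtain ⟨h1, h2, h3⟩ := hPmem e' he'
      refine ⟨h3, ?_⟩
      intro v hv
      rcases Sym2.mem_iff.1 hv with rfl | rfl
      · exact Finset.mem_union_left _ h1
      · exact Finset.mem_union_right _ h2)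
  have h1 : D ^ 4 * (U ∪ Q).card ≤ D ^ 4 * ((D + 2) * U.card) := Nat.mul_le_mul_left _ hXc
  have h2 : (2 * D ^ 4 * (D + 2)) * U.card ≤ (k - 1) * U.card :=
    Nat.mul_le_mul_right _ (by omega)
  have h3 : 2 * (D ^ 4 * ((D + 2) * U.card)) = (2 * D ^ 4 * (D + 2)) * U.card := by ring
  omega

/-- Small and large vertices expand separately, and the extra 1 in the factor `D + 1` pays for the
overlap of the two neighbourhoods. A large vertex accounts for at most one overlap vertex: two would
put it on a path of length four between small vertices, or on a 4-cycle through one. -/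
lemma TypicalGraph.extendable (hG : TypicalGraph G s k m D)
    (hk : 2 * D ^ 4 * (D + 2) + 1 ≤ k) :
    Extendable G (2 * m) (demand G s k D) (blockedVerts G s k) ∅ := by
  refine ⟨by simp, by simp, by simp, by simp, ?_⟩
  intro U hU
  simp only [taken, Finset.image_empty, Finset.union_empty, Finset.filter_empty,
    Finset.card_empty, Nat.add_zero]
  set S := smallVerts G s k with hS
  set Us := U.filter (· ∈ S)
  set Ub := U.filter (· ∉ S)
  have hsum := Finset.sum_filter_add_sum_filter_not U (· ∈ S) (demand G s k D)
  have h1 := hG.sum_demand_small Us fun v hv => (Finset.mem_filter.1 hv).2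
  have hUb : Disjoint Ub S := by
    rw [Finset.disjoint_left]; exact fun v hv => (Finset.mem_filter.1 hv).2
  have h2 := hG.card_nbr_big hk Ub hUb ((Finset.card_filter_le _ _).trans hU)
  have h3 : ∑ v ∈ Ub, demand G s k D v = D * Ub.card := by
    rw [Finset.sum_congr rfl (g := fun _ => D), Finset.sum_const, smul_eq_mul, mul_comm]
    intro v hv
    exact if_neg (Finset.mem_filter.1 hv).2
  have h4 : nbr G U = nbr G Us ∪ nbr G Ub := by
    rw [← nbr_union, Finset.filter_union_filter_not_eq]
  rw [h4, Finset.union_sdiff_distrib]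
  set Qs := nbr G Us \ blockedVerts G s k
  set Qb := nbr G Ub \ blockedVerts G s k
  have h5 : (Qs ∩ Qb).card ≤ Ub.card := by
    have hmem : ∀ w ∈ Qs ∩ Qb, ∃ u ∈ Ub, G.Adj u w := by
      intro w hw
      exact mem_nbr.1 (Finset.mem_sdiff.1 (Finset.mem_inter.1 hw).2).1
    choose! φ hφ hφ' using hmem
    refine Finset.card_le_card_of_injOn φ hφ ?_
    intro w hw w' hw' hww
    by_contra hne
    have a1 := Finset.mem_sdiff.1 (Finset.mem_inter.1 hw).1
    have a2 := Finset.mem_sdiff.1 (Finset.mem_inter.1 hw').1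
    obtain ⟨v, hv, hvw⟩ := mem_nbr.1 a1.1
    obtain ⟨v', hv', hvw'⟩ := mem_nbr.1 a2.1
    have b1 : v ∈ S := (Finset.mem_filter.1 hv).2
    have b2 : v' ∈ S := (Finset.mem_filter.1 hv').2
    have b3 : φ w ∉ S := (Finset.mem_filter.1 (hφ w hw)).2
    have b4 : w ∉ S := fun h' => a1.2 (Finset.mem_union_right _ h')
    have b5 : w' ∉ S := fun h' => a2.2 (Finset.mem_union_right _ h')
    have c1 := (hφ' w hw)
    have c2 := (hφ' w' hw')
    rw [← hww] at c2
    have d1 := c1.ne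
    have d2 := c2.ne
    have e1 := ne_of_mem_of_not_mem b1 b3
    have e2 := ne_of_mem_of_not_mem b1 b4
    have e3 := ne_of_mem_of_not_mem b1 b5
    have e4 := ne_of_mem_of_not_mem b2 b3
    have e5 := ne_of_mem_of_not_mem b2 b4
    have e6 := ne_of_mem_of_not_mem b2 b5
    by_cases hvv : v = v'
    · subst hvv
      refine hG.small_cycle v b1 w (φ w) w' ?_ hvw c1.symm c2 hvw'.symm
      simp [e1, e2, e3, d1.symm, d2, hne]
    · refine hG.small_path v b1 v' b2 w (φ w) w' ?_ hvw c1.symm c2 hvw'.symm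
      simp [e1, e2, e3, e4.symm, e5.symm, e6.symm, d1.symm, d2, hne, hvv]
  have h6 := Finset.card_union_add_card_inter Qs Qb
  have h7 : (D + 1) * Ub.card = D * Ub.card + Ub.card := by ring
  change ∑ v ∈ Us, demand G s k D v + ∑ v ∈ Ub, demand G s k D v = _ at hsum
  rw [h3] at hsum
  rw [h7] at h2
  omega

/-- The neighbours of `m` small vertices lie among the special vertices and at most `m * k` others;
at least `m` of the remaining vertices would then have no edge to them. -/
lemma TypicalGraph.card_small_lt (hG : TypicalGraph G s k m D) (hn : 2 * m + s + m * k ≤ n) :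
    (smallVerts G s k).card < m := by
  by_contra hcon
  push Not at hcon
  obtain ⟨X, hX, hXc⟩ := Finset.exists_subset_card_eq hcon
  set Z := X ∪ (firstVerts n s ∪ X.biUnion (freeNbr G s)) with hZ
  have hZc : Z.card ≤ m + (s + m * k) := by
    refine (Finset.card_union_le _ _).trans (Nat.add_le_add hXc.le ?_)
    refine (Finset.card_union_le _ _).trans (Nat.add_le_add card_firstVerts_le ?_)
    rw [← hXc]
    refine Finset.card_biUnion_le_card_mul _ _ _ fun v hv => ?_
    exact (mem_smallVerts.1 (hX hv)).le
  have hY : m ≤ (Zᶜ).card := by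
    rw [Finset.card_compl, Fintype.card_fin]; omega
  obtain ⟨x, hx, y, hy, hxy⟩ := hG.joined X Zᶜ
    (disjoint_compl_right.mono_left Finset.subset_union_left) hXc.ge hY
  rw [Finset.mem_compl] at hy
  apply hy
  by_cases hys : y.val < s
  · exact Finset.mem_union_right _ (Finset.mem_union_left _ (mem_firstVerts.2 hys))
  · exact Finset.mem_union_right _ (Finset.mem_union_right _
      (Finset.mem_biUnion.2 ⟨x, hx, mem_freeNbr.2 ⟨hxy, by omega⟩⟩))

/-- The vertices outside `U` and its neighbourhood send no edge to `U`, so there are fewer than `m`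
of them. -/
lemma TypicalGraph.le_card_nbr_add (hG : TypicalGraph G s k m D) (U : Finset (Fin n))
    (hU : m ≤ U.card) : n ≤ (nbr G U \ U).card + U.card + m := by
  by_contra hcon
  push Not at hcon
  have h1 : m ≤ ((nbr G U ∪ U)ᶜ).card := by
    rw [Finset.card_compl, Fintype.card_fin, ← Finset.sdiff_union_self_eq_union,
      Finset.card_union_of_disjoint Finset.sdiff_disjoint]
    omega
  obtain ⟨x, hx, y, hy, hxy⟩ := hG.joined U (nbr G U ∪ U)ᶜ
    (disjoint_compl_right.mono_left Finset.subset_union_right) hU h1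
  exact Finset.mem_compl.1 hy (Finset.mem_union_left _ (mem_nbr.2 ⟨x, hx, hxy⟩))

/-- An attached vertex has degree at least 2 but fewer than two free neighbours, so it has a special
neighbour to serve as `g v`. The choice is injective because small vertices share no neighbours. -/
lemma TypicalGraph.exists_threadSetting (hG : TypicalGraph G s k m D)
    (hk : 2 * D ^ 4 * (D + 2) + 1 ≤ k) (hD : 2 ≤ D) (hm : 1 ≤ m) {w : ℕ}
    (hw : 2 * m * D + 3 * m + w < n) :
    ∃ g, ThreadSetting G s m w D (demand G s k D) (blockedVerts G s k) (attachedVerts G s k) g := by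
  have hex : ∀ v ∈ attachedVerts G s k, ∃ u : Fin n, u.val < s ∧ G.Adj v u := by
    intro v hv
    obtain ⟨-, -, hv⟩ := Finset.mem_filter.1 hv
    have h1 := hG.two_le_degree v
    by_contra hcon
    push Not at hcon
    have : nbr G {v} ⊆ freeNbr G s v := by
      intro u hu
      rw [mem_nbr] at hu
      obtain ⟨v', hv', hu⟩ := hu
      rw [Finset.mem_singleton.1 hv'] at hu
      rw [mem_freeNbr]
      refine ⟨hu, ?_⟩
      by_contra h'
      exact hcon u (by omega) hu
    have := Finset.card_le_card this
    omega
  choose! g hg hg' using hex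
  refine ⟨g, ⟨⟨hm, ?_, ?_, hG.joined⟩, hD, ?_, ?_, ?_, hg, hg', ?_, ?_, ?_, hG.extendable hk⟩⟩
  -- At least `n - 2m - m` vertices are neighbours of `U` outside `U`; even after removing `w` of
  -- them, more than the largest possible demand `2mD` remain.
  · intro T U hT hU hU2
    have h1 : ∑ x ∈ U, demand G s k D x ≤ U.card * D := by
      rw [← smul_eq_mul]; exact Finset.sum_le_card_nsmul _ _ _ fun v _ => demand_le hD v
    have h2 : U.card * D ≤ 2 * m * D := Nat.mul_le_mul_right _ hU2
    have h3 := hG.le_card_nbr_add U hU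
    have h4 : (nbr G U \ U).card ≤ (nbr G U \ T).card + T.card := by
      exact (Finset.card_le_card (Finset.sdiff_subset : nbr G U \ U ⊆ nbr G U)).trans
        Finset.card_le_card_sdiff_add_card
    omega
  · intro x hx
    exact if_neg fun h' => hx (Finset.mem_union_right _ h')
  · exact fun x hx => Finset.mem_union_left _ (mem_firstVerts.2 hx)
  · exact fun v hv => Finset.mem_union_right _ (Finset.mem_filter.1 hv).1
  · exact fun v hv => (Finset.mem_filter.1 hv).2.1
  · intro v hv v' hv' hvv
    by_contra hne
    exact hG.small_common v (Finset.mem_filter.1 hv).1 v' (Finset.mem_filter.1 hv').1 hne (g v)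
      (hg' v hv) (hvv ▸ hg' v' hv')
  · intro x hx
    unfold demand
    have : x ∉ attachedVerts G s k := fun h' => by
      have := (Finset.mem_filter.1 h').2.1; omega
    rw [if_neg this]
    split_ifs <;> omega
  · intro v _
    unfold demand
    split_ifs <;> omega

end Typical

/-! ### Pósa rotations. -/

section Rotations

variable {α : Type*}

/-- The list `l` is the vertex sequence of a path in `H`. -/
structure IsPathList (H : SimpleGraph α) (l : List α) : Prop where
  chain : l.IsChain H.Adj
  nodup : l.Nodup

/-- A Pósa rotation at the head of the path. -/
def RotStep (H : SimpleGraph α) (l l' : List α) : Prop :=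
  ∃ x A y B, l = x :: A ++ y :: B ∧ H.Adj x y ∧ l' = (x :: A).reverse ++ y :: B

/-- Consecutive elements of a list. -/
def Consec (l : List α) (y z : α) : Prop :=
  (∃ A B, l = A ++ y :: z :: B) ∨ ∃ A B, l = A ++ z :: y :: B

variable {H : SimpleGraph α}

lemma IsPathList.reverse {l : List α} (h : IsPathList H l) : IsPathList H l.reverse :=
  ⟨by rw [List.isChain_reverse]; exact h.chain.imp fun _ _ h' => h'.symm,
    List.nodup_reverse.2 h.nodup⟩

lemma RotStep.perm {l l' : List α} (h : RotStep H l l') : l'.Perm l := by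
  obtain ⟨x, A, y, B, rfl, -, rfl⟩ := h
  exact (List.reverse_perm _).append_right _

lemma RotStep.getLast? {l l' : List α} (h : RotStep H l l') : l'.getLast? = l.getLast? := by
  obtain ⟨x, A, y, B, rfl, -, rfl⟩ := h
  rw [List.getLast?_append_of_ne_nil _ (by simp), List.getLast?_append_of_ne_nil _ (by simp)]

lemma RotStep.isPathList {l l' : List α} (h : RotStep H l l') (hl : IsPathList H l) :
    IsPathList H l' := by
  refine ⟨?_, h.perm.nodup_iff.2 hl.nodup⟩
  obtain ⟨x, A, y, B, rfl, hxy, rfl⟩ := h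
  have hc := hl.chain
  rw [List.isChain_append] at hc ⊢
  refine ⟨?_, hc.2.1, ?_⟩
  · rw [List.isChain_reverse]; exact hc.1.imp fun _ _ h' => h'.symm
  · intro a ha b hb
    rw [List.getLast?_reverse] at ha
    simp only [List.head?_cons, Option.mem_def, Option.some.injEq] at ha hb
    subst ha hb
    exact hxy

lemma Consec.symm {l : List α} {y z : α} (h : Consec l y z) : Consec l z y := Or.symm h

lemma Consec.reverse {l : List α} {y z : α} (h : Consec l y z) : Consec l.reverse y z := by
  rcases h with ⟨A, B, rfl⟩ | ⟨A, B, rfl⟩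
  · exact Or.inr ⟨B.reverse, A.reverse, by simp⟩
  · exact Or.inl ⟨B.reverse, A.reverse, by simp⟩

lemma Consec.append_left {l : List α} {y z : α} (h : Consec l y z) (L : List α) :
    Consec (L ++ l) y z := by
  rcases h with ⟨A, B, rfl⟩ | ⟨A, B, rfl⟩
  · exact Or.inl ⟨L ++ A, B, by simp⟩
  · exact Or.inr ⟨L ++ A, B, by simp⟩

lemma Consec.append_right {l : List α} {y z : α} (h : Consec l y z) (L : List α) :
    Consec (l ++ L) y z := by
  rcases h with ⟨A, B, rfl⟩ | ⟨A, B, rfl⟩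
  · exact Or.inl ⟨A, B ++ L, by simp⟩
  · exact Or.inr ⟨A, B ++ L, by simp⟩

lemma consec_append_cases {L M : List α} {y z : α} (h : Consec (L ++ M) y z) :
    Consec L y z ∨ Consec M y z ∨ L.getLast? = some y ∨ L.getLast? = some z := by
  have key : ∀ y z A B, L ++ M = A ++ y :: z :: B →
      Consec L y z ∨ Consec M y z ∨ L.getLast? = some y := by
    intro y z A B h
    rcases List.append_eq_append_iff.1 h with ⟨a, h1, h2⟩ | ⟨c, h1, h2⟩
    · exact Or.inr (Or.inl (Or.inl ⟨a, B, h2⟩))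
    · match c, h1, h2 with
      | [], h1, h2 => exact Or.inr (Or.inl (Or.inl ⟨[], B, by simpa using h2.symm⟩))
      | [c], h1, h2 =>
        simp only [List.cons_append, List.nil_append, List.cons.injEq] at h2
        rw [← h2.1] at h1
        exact Or.inr (Or.inr (by rw [h1]; simp))
      | c :: d :: c', h1, h2 =>
        simp only [List.cons_append, List.cons.injEq] at h2
        obtain ⟨rfl, rfl, -⟩ := h2
        exact Or.inl (Or.inl ⟨A, c', h1⟩)
  rcases h with ⟨A, B, h⟩ | ⟨A, B, h⟩
  · have := key y z A B h; tauto
  · rcases key z y A B h with h | h | h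
    · exact Or.inl h.symm
    · exact Or.inr (Or.inl h.symm)
    · tauto

/-- A rotation separates just one pair of path neighbours, and a member of that pair becomes the new
head. -/
lemma consec_of_rotStep {l l' : List α} (h : RotStep H l l') {y z : α} (hc : Consec l y z)
    (hy : l'.head? ≠ some y) (hz : l'.head? ≠ some z) : Consec l' y z := by
  obtain ⟨x, A, w, B, rfl, -, rfl⟩ := h
  have e : ((x :: A).reverse ++ w :: B).head? = (x :: A).getLast? := by
    rw [List.head?_append_of_ne_nil _ (by simp), List.head?_reverse]
  rw [e] at hy hz
  rcases consec_append_cases hc with h | h | h | h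
  · exact h.reverse.append_right _
  · exact h.append_left _
  · exact absurd h hy
  · exact absurd h hz

lemma append_cons_unique {v : α} {L L' B B' : List α} (h : v ∉ L) (h' : v ∉ L')
    (e : L ++ v :: B = L' ++ v :: B') : L = L' ∧ B = B' := by
  rcases List.append_eq_append_iff.1 e with ⟨a, h1, h2⟩ | ⟨a, h1, h2⟩
  · match a, h1, h2 with
    | [], h1, h2 => simp at h1 h2; exact ⟨h1.symm, h2⟩
    | c :: a, h1, h2 =>
      simp only [List.cons_append, List.cons.injEq] at h2
      rw [h1, h2.1] at h'; simp at h'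
  · match a, h1, h2 with
    | [], h1, h2 => simp at h1 h2; exact ⟨h1, h2.symm⟩
    | c :: a, h1, h2 =>
      simp only [List.cons_append, List.cons.injEq] at h2
      rw [h1, h2.1] at h; simp at h

lemma consec_neighbour {v p : α} {L B : List α} (hn : (L ++ v :: B).Nodup)
    (h : Consec (L ++ v :: B) p v) : L.getLast? = some p ∨ B.head? = some p := by
  have hvL : v ∉ L := fun h' => by
    rw [List.nodup_append] at hn; exact hn.2.2 v h' v (by simp) rfl
  rcases h with ⟨C, E, h⟩ | ⟨C, E, h⟩
  · have e : C ++ p :: v :: E = (C ++ [p]) ++ v :: E := by simp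
    have hn' := hn
    rw [h, e, List.nodup_append] at hn'
    rw [e] at h
    have := append_cons_unique hvL (fun h' => hn'.2.2 v h' v (by simp) rfl) h
    left; rw [this.1]; simp
  · have hn' := hn
    rw [h, List.nodup_append] at hn'
    have := append_cons_unique hvL (fun h' => hn'.2.2 v h' v (by simp) rfl) h
    right; rw [this.2]; simp

variable [Fintype α] [DecidableEq α]

/-- The heads of the paths obtained from `l` by rotations. -/
noncomputable def rotHeads (H : SimpleGraph α) (l : List α) : Finset α := by
  classical
  exact Finset.univ.filter fun x => ∃ l', Relation.ReflTransGen (RotStep H) l l' ∧ l'.head? = some x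

omit [DecidableEq α] in
lemma mem_rotHeads {l : List α} {x : α} : x ∈ rotHeads H l ↔
    ∃ l', Relation.ReflTransGen (RotStep H) l l' ∧ l'.head? = some x := by
  simp [rotHeads]

omit [DecidableEq α] in
-- A pair is separated only when one of its members becomes head, so path neighbours that are never
-- heads stay together through all rotations.
lemma rot_invariants {l l' : List α} (h : Relation.ReflTransGen (RotStep H) l l')
    (hl : IsPathList H l) : IsPathList H l' ∧ l'.Perm l ∧ l'.getLast? = l.getLast? ∧
      ∀ y z, y ∉ rotHeads H l → z ∉ rotHeads H l → Consec l y z → Consec l' y z := by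
  induction h with
  | refl => exact ⟨hl, .refl _, rfl, fun _ _ _ _ h => h⟩
  | tail h1 h2 ih =>
    obtain ⟨a1, a2, a3, a4⟩ := ih
    refine ⟨h2.isPathList a1, h2.perm.trans a2, h2.getLast?.trans a3, fun y z hy hz hc => ?_⟩
    refine consec_of_rotStep h2 (a4 y z hy hz hc) (fun h' => hy ?_) fun h' => hz ?_
    · exact mem_rotHeads.2 ⟨_, h1.tail h2, h'⟩
    · exact mem_rotHeads.2 ⟨_, h1.tail h2, h'⟩

/-- If no path neighbour of `v` on `l` is ever a head, the pairs of `l` at `v` survive all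
rotations. Take a rotated path whose head is adjacent to `v`: one more rotation makes the
predecessor of `v` a head, so every path neighbour of `v` on `l` must be its successor there. That
leaves room for only one, and `v` is not an end of `l` either: the first vertex is a head, and the
last one has no successor. -/
lemma exists_consec_of_mem_nbr {l : List α} (hl : IsPathList H l)
    (hmax : ∀ l', IsPathList H l' → l'.length ≤ l.length) {v : α}
    (hv : v ∈ nbr H (rotHeads H l) \ rotHeads H l) :
    v ∈ l ∧ ∃ x ∈ rotHeads H l, Consec l x v := by
  rw [Finset.mem_sdiff, mem_nbr] at hv
  obtain ⟨⟨x, hx, hxv⟩, hvR⟩ := hv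
  obtain ⟨Q, hQ, hQx⟩ := mem_rotHeads.1 hx
  obtain ⟨i1, i2, i3, i4⟩ := rot_invariants hQ hl
  obtain ⟨T, rfl⟩ : ∃ T, Q = x :: T := by
    cases Q with
    | nil => simp at hQx
    | cons a T => simp at hQx; exact ⟨T, by rw [hQx]⟩
  have hvQ : v ∈ x :: T := by
    by_contra hvQ
    have := hmax (v :: x :: T) ⟨by
      rw [List.isChain_cons]
      exact ⟨by simpa using hxv.symm, i1.chain⟩, List.nodup_cons.2 ⟨hvQ, i1.nodup⟩⟩
    have := i2.length_eq
    simp at *; omega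
  have hvl : v ∈ l := i2.mem_iff.1 hvQ
  refine ⟨hvl, ?_⟩
  have hvT : v ∈ T := (List.mem_cons.1 hvQ).resolve_left hxv.ne'
  obtain ⟨A, B, rfl⟩ := List.append_of_mem hvT
  have hrot : RotStep H (x :: (A ++ v :: B)) ((x :: A).reverse ++ v :: B) :=
    ⟨x, A, v, B, rfl, hxv, rfl⟩
  obtain ⟨t, ht⟩ : ∃ t, (x :: A).getLast? = some t := ⟨_, List.getLast?_eq_some_getLast (by simp)⟩
  have htR : t ∈ rotHeads H l := by
    refine mem_rotHeads.2 ⟨_, hQ.tail hrot, ?_⟩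
    rw [List.head?_append_of_ne_nil _ (by simp), List.head?_reverse, ht]
  by_contra hcon
  push Not at hcon
  have hnb : ∀ p, Consec l p v → B.head? = some p := by
    intro p hp
    have hpR : p ∉ rotHeads H l := fun h' => hcon p h' hp
    have h1 := i4 p v hpR hvR hp
    rcases consec_neighbour (L := x :: A) (by simpa using i1.nodup) (by simpa using h1) with h2 | h2
    · rw [ht, Option.some.injEq] at h2
      exact absurd (h2 ▸ htR) hpR
    · exact h2
  obtain ⟨C, E, rfl⟩ := List.append_of_mem hvl
  rcases C.eq_nil_or_concat' with rfl | ⟨C', p, rfl⟩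
  · exact hvR (mem_rotHeads.2 ⟨_, .refl, by simp⟩)
  have hp := hnb p (Or.inl ⟨C', E, by simp⟩)
  cases E with
  -- Here `v` ends `l`. Rotations fix the last vertex, so `v` ends the rotated path too, yet `hp`
  -- gives it a successor.
  | nil =>
    rw [List.getLast?_append_of_ne_nil _ (by simp)] at i3
    have e : x :: (A ++ v :: B) = (x :: A) ++ v :: B := by simp
    rw [e, List.getLast?_append_of_ne_nil _ (by simp)] at i3
    cases B with
    | nil => simp at hp
    | cons b B =>
      simp only [List.getLast?_cons_cons, List.getLast?_singleton] at i3
      have hmem := List.mem_of_getLast? i3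
      have := i1.nodup
      rw [e, List.nodup_append] at this
      exact (List.nodup_cons.1 this.2.1).1 hmem
  | cons d E =>
    have hd := hnb d (Or.inr ⟨C' ++ [p], E, by simp⟩)
    rw [hp, Option.some.injEq] at hd
    have := hl.nodup
    rw [hd] at this
    rw [List.nodup_append] at this
    exact this.2.2 d (by simp) d (by simp) rfl

/-- **Pósa's lemma**: the rotation heads of a longest path have few outside neighbours. -/
lemma card_nbr_rotHeads_lt {l : List α} (hl : IsPathList H l) (hne : l ≠ [])
    (hmax : ∀ l', IsPathList H l' → l'.length ≤ l.length) :
    (nbr H (rotHeads H l) \ rotHeads H l).card < 2 * (rotHeads H l).card := by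
  set R := rotHeads H l with hR
  -- Outside neighbours sit at positions just after or just before a head of `l`. Position 0 belongs
  -- to a head and has nothing before it, which makes the inequality strict.
  let I := R.image l.idxOf
  have hIc : I.card ≤ R.card := Finset.card_image_le
  have h0 : 0 ∈ I := by
    obtain ⟨x, T, rfl⟩ := List.exists_cons_of_ne_nil hne
    exact Finset.mem_image.2 ⟨x, mem_rotHeads.2 ⟨_, .refl, rfl⟩, by simp⟩
  have hsub : (nbr H R \ R).card ≤ (I.image (· + 1) ∪ (I.erase 0).image (· - 1)).card := by
    refine Finset.card_le_card_of_injOn l.idxOf ?_ ?_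
    · intro v hv
      obtain ⟨hvl, x, hx, hc⟩ := exists_consec_of_mem_nbr hl hmax hv
      have hn := hl.nodup
      rw [Finset.mem_coe, Finset.mem_union, Finset.mem_image, Finset.mem_image]
      have key : ∀ (A B : List α) (a b : α), (A ++ a :: b :: B).Nodup →
          (A ++ a :: b :: B).idxOf b = (A ++ a :: b :: B).idxOf a + 1 := by
        intro A B a b h
        rw [List.nodup_append] at h
        have ha : a ∉ A := fun h' => h.2.2 a h' a (by simp) rfl
        have hb : b ∉ A := fun h' => h.2.2 b h' b (by simp) rfl
        have hab : a ≠ b := by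
          rintro rfl; simp at h
        rw [List.idxOf_append_of_notMem ha, List.idxOf_append_of_notMem hb, List.idxOf_cons_self,
          List.idxOf_cons_ne _ hab, List.idxOf_cons_self]
      rcases hc with ⟨A, B, e⟩ | ⟨A, B, e⟩
      · left
        refine ⟨l.idxOf x, Finset.mem_image_of_mem _ hx, ?_⟩
        rw [e] at hn ⊢
        exact (key A B x v hn).symm
      · right
        have h1 : l.idxOf x = l.idxOf v + 1 := by
          rw [e] at hn ⊢
          exact key A B v x hn
        refine ⟨l.idxOf x, Finset.mem_erase.2 ⟨by omega, Finset.mem_image_of_mem _ hx⟩, ?_⟩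
        simp only []; omega
    · intro v hv v' _ h
      obtain ⟨hvl, -⟩ := exists_consec_of_mem_nbr hl hmax hv
      exact (List.idxOf_inj hvl).1 h
  have h1 := Finset.card_union_le (I.image (· + 1)) ((I.erase 0).image (· - 1))
  have h2 : (I.image (· + 1)).card ≤ I.card := Finset.card_image_le
  have h3 : ((I.erase 0).image (· - 1)).card ≤ (I.erase 0).card := Finset.card_image_le
  have h4 := Finset.card_erase_add_one h0
  omega

/-- In a graph where sets of at most `k` vertices expand twofold, a longest path yields many pairs
of endpoints of paths of the same length. -/
lemma exists_many_ends {k : ℕ} (hexp : ∀ A : Finset α, A.card ≤ k → 2 * A.card ≤ (nbr H A \ A).card)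
    {l : List α} (hl : IsPathList H l) (hne : l ≠ [])
    (hmax : ∀ l', IsPathList H l' → l'.length ≤ l.length) :
    ∃ R : Finset α, k < R.card ∧ ∀ x ∈ R, ∃ R' : Finset α, k < R'.card ∧ ∀ y ∈ R', ∃ Q,
      IsPathList H Q ∧ Q.length = l.length ∧ Q.head? = some y ∧ Q.getLast? = some x := by
  have hbig : ∀ l : List α, IsPathList H l → l ≠ [] →
      (∀ l', IsPathList H l' → l'.length ≤ l.length) → k < (rotHeads H l).card := by
    intro l hl hne hmax
    by_contra hcon
    have := hexp _ (not_lt.1 hcon)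
    have := card_nbr_rotHeads_lt hl hne hmax
    omega
  refine ⟨_, hbig l hl hne hmax, fun x hx => ?_⟩
  obtain ⟨Q, hQ, hQx⟩ := mem_rotHeads.1 hx
  obtain ⟨i1, i2, i3, -⟩ := rot_invariants hQ hl
  have hQl : Q.reverse.length = l.length := by rw [List.length_reverse, i2.length_eq]
  refine ⟨_, hbig Q.reverse i1.reverse ?_ (fun l' hl' => (hmax l' hl').trans hQl.ge), ?_⟩
  · intro h
    rw [List.reverse_eq_nil_iff] at h
    rw [h] at hQx; simp at hQx
  intro y hy
  obtain ⟨Q', hQ', hQy⟩ := mem_rotHeads.1 hy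
  obtain ⟨j1, j2, j3, -⟩ := rot_invariants hQ' i1.reverse
  exact ⟨Q', j1, j2.length_eq.trans hQl, hQy, by rw [j3, List.getLast?_reverse, hQx]⟩

/-- The list `l` is the vertex sequence of a Hamilton cycle of `H`. -/
structure IsHamList (H : SimpleGraph α) (l : List α) : Prop extends IsPathList H l where
  mem : ∀ v, v ∈ l
  three_le : 3 ≤ l.length
  closed : ∃ x y, l.head? = some x ∧ l.getLast? = some y ∧ H.Adj x y

/-- Closing a path in a connected graph gives a Hamilton cycle or a longer path. -/
lemma IsPathList.close {l : List α} (hl : IsPathList H l) (h3 : 3 ≤ l.length)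
    (hconn : ∀ Z : Finset α, Z.Nonempty → Zᶜ.Nonempty → ∃ u ∈ Z, ∃ v ∈ Zᶜ, H.Adj u v)
    {x y : α} (hx : l.head? = some x) (hy : l.getLast? = some y) (hxy : H.Adj x y) :
    IsHamList H l ∨ ∃ l', IsPathList H l' ∧ l.length < l'.length := by
  by_cases hall : ∀ v, v ∈ l
  · exact Or.inl ⟨hl, hall, h3, x, y, hx, hy, hxy⟩
  right
  push Not at hall
  obtain ⟨v₀, hv₀⟩ := hall
  obtain ⟨u, hu, v, hv, huv⟩ := hconn l.toFinset
    ⟨x, List.mem_toFinset.2 (List.mem_of_head? hx)⟩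
    ⟨v₀, by rw [Finset.mem_compl, List.mem_toFinset]; exact hv₀⟩
  rw [Finset.mem_compl, List.mem_toFinset] at hv
  rw [List.mem_toFinset] at hu
  obtain ⟨C, E, rfl⟩ := List.append_of_mem hu
  have hperm : (u :: E ++ C).Perm (C ++ u :: E) := List.perm_append_comm
  refine ⟨v :: (u :: E ++ C), ⟨?_, List.nodup_cons.2 ⟨fun h => hv (hperm.mem_iff.1 h),
    hperm.nodup_iff.2 hl.nodup⟩⟩, by simp; omega⟩
  have hc := hl.chain
  rw [List.isChain_append] at hc
  rw [List.isChain_cons, List.isChain_append]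
  refine ⟨by simpa using huv.symm, hc.2.1, hc.1, ?_⟩
  intro a ha b hb
  rw [List.getLast?_append_of_ne_nil _ (by simp)] at hy
  have hC : C ≠ [] := by rintro rfl; simp at hb
  rw [List.head?_append_of_ne_nil _ hC] at hx
  rw [Option.mem_def] at ha hb
  rw [hy, Option.some.injEq] at ha
  rw [hx, Option.some.injEq] at hb
  rw [← ha, ← hb]
  exact hxy.symm

end Rotations

/-! ### Contracting the path; expanders. -/

section Contraction

variable {V : Type*} [Fintype V] [DecidableEq V]

/-- Delete the vertices of `int`, and add one vertex, adjacent to `a` and `b` only. -/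
def contracted (G : SimpleGraph V) (int : List V) (a b : V) :
    SimpleGraph (Option {v : V // v ∉ int}) where
  Adj x y := match x, y with
    | some u, some v => G.Adj u v
    | none, some v => v.1 = a ∨ v.1 = b
    | some v, none => v.1 = a ∨ v.1 = b
    | none, none => False
  symm := ⟨by
    intro x y h
    match x, y, h with
    | some u, some v, h => exact SimpleGraph.Adj.symm h
    | none, some v, h => exact h
    | some v, none, h => exact h⟩
  loopless := ⟨by
    intro x h
    match x, h with
    | some u, h => exact G.irrefl h⟩

variable {G G' : SimpleGraph V} {int : List V} {a b : V}

omit [Fintype V] [DecidableEq V] in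
lemma contracted_mono (h : G ≤ G') : contracted G int a b ≤ contracted G' int a b := by
  intro x y hxy
  match x, y, hxy with
  | some u, some v, hxy => exact h hxy
  | none, some v, hxy => exact hxy
  | some v, none, hxy => exact hxy

/-- Twofold expansion of sets of size at most `K`, and connectedness. -/
structure IsExpander {α : Type*} [Fintype α] [DecidableEq α] (H : SimpleGraph α) (K : ℕ) :
    Prop where
  expand : ∀ A : Finset α, A.card ≤ K → 2 * A.card ≤ (nbr H A \ A).card
  conn : ∀ Z : Finset α, Z.Nonempty → Zᶜ.Nonempty → ∃ u ∈ Z, ∃ v ∈ Zᶜ, H.Adj u v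

lemma IsExpander.mono {α : Type*} [Fintype α] [DecidableEq α] {H H' : SimpleGraph α} {K : ℕ}
    (h : IsExpander H K) (hle : H ≤ H') : IsExpander H' K where
  expand A hA := (h.expand A hA).trans <| Finset.card_le_card <|
    Finset.sdiff_subset_sdiff (fun w hw => by
      rw [mem_nbr] at hw ⊢
      exact hw.imp fun u hu => ⟨hu.1, hle hu.2⟩) le_rfl
  conn Z h1 h2 := by
    obtain ⟨u, hu, v, hv, huv⟩ := h.conn Z h1 h2
    exact ⟨u, hu, v, hv, hle huv⟩

lemma card_le_card_nbr_contracted (A : Finset (Option {v : V // v ∉ int})) (T : Finset V)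
    (hT : ∀ v ∈ T, ∃ h : v ∉ int, some ⟨v, h⟩ ∉ A ∧
      ∃ x ∈ A, (contracted G int a b).Adj x (some ⟨v, h⟩)) :
    T.card ≤ (nbr (contracted G int a b) A \ A).card := by
  have hsub : T ⊆ ((nbr (contracted G int a b) A \ A).eraseNone).map ⟨Subtype.val,
      Subtype.val_injective⟩ := by
    intro v hv
    obtain ⟨h, h1, h2⟩ := hT v hv
    rw [Finset.mem_map]
    exact ⟨⟨v, h⟩, Finset.mem_eraseNone.2 (Finset.mem_sdiff.2 ⟨mem_nbr.2 h2, h1⟩), rfl⟩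
  refine (Finset.card_le_card hsub).trans ?_
  rw [Finset.card_map]
  exact Finset.card_eraseNone_le _

end Contraction

/-! ### The contracted leftover is an expander. -/

section Leftover

variable {n : ℕ} {G : SimpleGraph (Fin n)} {s k m D K : ℕ}

/-- The leftover of a typical graph, once a suitable path is contracted, is an expander. -/
lemma TypicalGraph.isExpander (hG : TypicalGraph G s k m D) (hD : 3 ≤ D) {a b : Fin n}
    {int : List (Fin n)} (hnodup : (b :: int ++ [a]).Nodup)
    (ha : a ∉ blockedVerts G s k) (hb : b ∉ blockedVerts G s k)
    (hX : ∀ v ∈ attachedVerts G s k, v ∈ int)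
    (hext : ∀ U : Finset (Fin n), U.card ≤ 2 * m → (∀ x ∈ U, x ∉ int) →
        ∑ x ∈ U, demand G s k D x ≤
          (nbr G U \ (blockedVerts G s k ∪ (b :: int ++ [a]).toFinset)).card)
    (hmK : m ≤ K) (hK : 3 * K + 2 + m + int.length ≤ n) :
    IsExpander (contracted G int a b) K := by
  have hai : a ∉ int := fun h => by
    rw [List.nodup_append] at hnodup
    exact hnodup.2.2 a (List.mem_cons_of_mem _ h) a (by simp) rfl
  have hbi : b ∉ int := fun h => by
    rw [List.cons_append, List.nodup_cons] at hnodup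
    exact hnodup.1 (List.mem_append_left _ h)
  have hab : a ≠ b := by
    rintro rfl
    rw [List.cons_append, List.nodup_cons] at hnodup
    exact hnodup.1 (by simp)
  set S := smallVerts G s k with hS
  let vs : Finset (Option {v : Fin n // v ∉ int}) → Finset (Fin n) := fun A =>
    (A.eraseNone).map ⟨Subtype.val, Subtype.val_injective⟩
  have hvs : ∀ A v, v ∈ vs A ↔ ∃ h : v ∉ int, some ⟨v, h⟩ ∈ A := by
    intro A v
    simp [vs]
  have hvsint : ∀ A, ∀ x ∈ vs A, x ∉ int := fun A x hx => ((hvs A x).1 hx).1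
  have hcard : ∀ A : Finset (Option {v : Fin n // v ∉ int}),
      A.card = (vs A).card + if none ∈ A then 1 else 0 := by
    intro A
    simp only [vs, Finset.card_map]
    split_ifs with h
    · have := Finset.card_pos.2 ⟨_, h⟩
      rw [Finset.card_eraseNone_of_mem h]
      omega
    · rw [Finset.card_eraseNone_of_not_mem h]; rfl
  have hexpand : ∀ A : Finset (Option {v : Fin n // v ∉ int}), A.card ≤ K →
      2 * A.card ≤ (nbr (contracted G int a b) A \ A).card := by
    intro A hA
    have hAc := hcard A
    set U := vs A with hU
    -- Sets within the range of the invariant expand because of their demand, larger ones because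
    -- fewer than `m` vertices escape their closed neighbourhood.
    by_cases hUm : U.card ≤ 2 * m
    · set Q := nbr G U \ (blockedVerts G s k ∪ (b :: int ++ [a]).toFinset) with hQ
      -- The contracted vertex pays for itself with the two endpoints, which `Q` excludes.
      set E : Finset (Fin n) := if none ∈ A then {a, b} else ∅ with hE
      have hEmem : ∀ v ∈ E, none ∈ A ∧ (v = a ∨ v = b) := by
        intro v hv
        rw [hE] at hv
        split_ifs at hv with h
        · exact ⟨h, by simpa using hv⟩
        · simp at hv
      have hEcard : E.card = if none ∈ A then 2 else 0 := by
        rw [hE]; split_ifs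
        · exact Finset.card_pair hab
        · rfl
      have hQmem : ∀ v ∈ Q, (∃ u ∈ U, G.Adj u v) ∧ v ∉ blockedVerts G s k ∧ v ≠ a ∧ v ≠ b ∧
          v ∉ int := by
        intro v hv
        rw [hQ, Finset.mem_sdiff, mem_nbr, Finset.mem_union, List.mem_toFinset] at hv
        simp only [List.cons_append, List.mem_cons, List.mem_append, List.not_mem_nil,
          or_false] at hv
        tauto
      have hdisj : Disjoint Q E := by
        rw [Finset.disjoint_left]
        intro v hv hv'
        have := hQmem v hv
        have := hEmem v hv'
        tauto
      have hT : ((Q ∪ E) \ U).card ≤ (nbr (contracted G int a b) A \ A).card := by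
        refine card_le_card_nbr_contracted A _ ?_
        intro v hv
        rw [Finset.mem_sdiff, Finset.mem_union] at hv
        obtain ⟨hv, hvU⟩ := hv
        rcases hv with hv | hv
        · obtain ⟨⟨u, hu, huv⟩, -, -, -, hvi⟩ := hQmem v hv
          obtain ⟨hui, hu⟩ := (hvs A u).1 hu
          exact ⟨hvi, fun h => hvU ((hvs A v).2 ⟨hvi, h⟩), _, hu, huv⟩
        · obtain ⟨hnone, hv⟩ := hEmem v hv
          have hvi : v ∉ int := by rcases hv with rfl | rfl <;> assumption
          exact ⟨hvi, fun h => hvU ((hvs A v).2 ⟨hvi, h⟩), none, hnone, hv⟩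
      set Us := U.filter (· ∈ S)
      set Ub := U.filter (· ∉ S)
      have hUsb : Us.card + Ub.card = U.card :=
        Finset.card_filter_add_card_filter_not (s := U) (· ∈ S)
      -- No vertex of `Q` or `E` is small, so discarding `U` loses at most one vertex per large
      -- vertex of `U`. A large vertex keeps `D - 1 ≥ 2`, and a small one keeps its full demand 2,
      -- as attached vertices are in the interior.
      have hle : (Q ∪ E).card ≤ ((Q ∪ E) \ U).card + Ub.card := by
        have : Q ∪ E ⊆ ((Q ∪ E) \ U) ∪ Ub := by
          intro v hv
          by_cases hvU : v ∈ U
          · refine Finset.mem_union_right _ (Finset.mem_filter.2 ⟨hvU, fun h => ?_⟩)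
            have hbl : v ∈ blockedVerts G s k := Finset.mem_union_right _ h
            rcases Finset.mem_union.1 hv with hv | hv
            · exact (hQmem v hv).2.1 hbl
            · rcases (hEmem v hv).2 with rfl | rfl
              · exact ha hbl
              · exact hb hbl
          · exact Finset.mem_union_left _ (Finset.mem_sdiff.2 ⟨hv, hvU⟩)
        exact (Finset.card_le_card this).trans (Finset.card_union_le _ _)
      rw [Finset.card_union_of_disjoint hdisj, hEcard] at hle
      have hf := hext U hUm (hvsint A)
      have hsum := Finset.sum_filter_add_sum_filter_not U (· ∈ S) (demand G s k D)
      have h3 : ∑ v ∈ Ub, demand G s k D v = Ub.card * D := by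
        rw [Finset.sum_congr rfl (g := fun _ => D), Finset.sum_const, smul_eq_mul]
        exact fun v hv => if_neg (Finset.mem_filter.1 hv).2
      have h4 : ∑ v ∈ Us, demand G s k D v = Us.card * 2 := by
        rw [Finset.sum_congr rfl (g := fun _ => 2), Finset.sum_const, smul_eq_mul]
        intro v hv
        obtain ⟨hvU, hvS⟩ := Finset.mem_filter.1 hv
        unfold demand
        rw [if_pos hvS, if_neg fun h => hvsint A v hvU (hX v h)]
      have h5 : Ub.card * 3 ≤ Ub.card * D := Nat.mul_le_mul_left _ hD
      change ∑ v ∈ Us, demand G s k D v + ∑ v ∈ Ub, demand G s k D v = _ at hsum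
      rw [h3, h4] at hsum
      change _ ≤ Q.card at hf
      split_ifs at hAc hle <;> omega
    · have h1 := hG.le_card_nbr_add U (by omega)
      have hT : ((nbr G U \ U) \ int.toFinset).card ≤ (nbr (contracted G int a b) A \ A).card := by
        refine card_le_card_nbr_contracted A _ ?_
        intro v hv
        rw [Finset.mem_sdiff, Finset.mem_sdiff, mem_nbr, List.mem_toFinset] at hv
        obtain ⟨⟨⟨u, hu, huv⟩, hvU⟩, hvi⟩ := hv
        obtain ⟨hui, hu⟩ := (hvs A u).1 hu
        exact ⟨hvi, fun h => hvU ((hvs A v).2 ⟨hvi, h⟩), _, hu, huv⟩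
      have h2 := Finset.card_le_card_sdiff_add_card (s := nbr G U \ U) (t := int.toFinset)
      have h3 := List.toFinset_card_le int
      split_ifs at hAc <;> omega
  refine ⟨hexpand, ?_⟩
  intro Z hZ hZc
  by_cases h1 : Z.card ≤ K
  · have h2 := hexpand Z h1
    have h3 := Finset.card_pos.2 hZ
    obtain ⟨v, hv⟩ := Finset.card_pos.1 (show 0 < (nbr (contracted G int a b) Z \ Z).card by omega)
    rw [Finset.mem_sdiff, mem_nbr] at hv
    obtain ⟨⟨u, hu, huv⟩, hv⟩ := hv
    exact ⟨u, hu, v, Finset.mem_compl.2 hv, huv⟩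
  by_cases h2 : Zᶜ.card ≤ K
  · have h2 := hexpand _ h2
    have h3 := Finset.card_pos.2 hZc
    obtain ⟨v, hv⟩ := Finset.card_pos.1
      (show 0 < (nbr (contracted G int a b) Zᶜ \ Zᶜ).card by omega)
    rw [Finset.mem_sdiff, mem_nbr] at hv
    obtain ⟨⟨u, hu, huv⟩, hv⟩ := hv
    rw [Finset.mem_compl, not_not] at hv
    exact ⟨v, hv, u, hu, huv.symm⟩
  -- Both sides exceed `K ≥ m`, so each retains `m` ordinary vertices even if it contains `none`.
  · have c1 := hcard Z
    have c2 := hcard Zᶜ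
    have hdisj : Disjoint (vs Z) (vs Zᶜ) := by
      rw [Finset.disjoint_left]
      intro v hv hv'
      obtain ⟨h, hv⟩ := (hvs _ v).1 hv
      obtain ⟨h', hv'⟩ := (hvs _ v).1 hv'
      exact Finset.mem_compl.1 hv' hv
    obtain ⟨x, hx, y, hy, hxy⟩ := hG.joined (vs Z) (vs Zᶜ) hdisj
      (by split_ifs at c1 <;> omega) (by split_ifs at c2 <;> omega)
    obtain ⟨hxi, hx⟩ := (hvs _ x).1 hx
    obtain ⟨hyi, hy⟩ := (hvs _ y).1 hy
    exact ⟨_, hx, _, hy, hxy⟩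

end Leftover

/-! ### Boosters and sets of edges without boosters. -/

section Boosters

lemma exists_longest {α : Type*} [Fintype α] (H : SimpleGraph α) :
    ∃ l, IsPathList H l ∧ ∀ l', IsPathList H l' → l'.length ≤ l.length := by
  classical
  let p : ℕ → Prop := fun k => ∃ l, IsPathList H l ∧ l.length = k
  have h0 : p 0 := ⟨[], ⟨by simp, by simp⟩, rfl⟩
  obtain ⟨l, hl, hlk⟩ : p (Nat.findGreatest p (Fintype.card α)) :=
    Nat.findGreatest_spec (Nat.zero_le _) h0
  refine ⟨l, hl, fun l' hl' => ?_⟩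
  rw [hlk]
  exact Nat.le_findGreatest hl'.nodup.length_le_card ⟨l', hl', rfl⟩

/-- The number of vertices of a longest path. -/
noncomputable def pathLen {α : Type*} [Fintype α] (H : SimpleGraph α) : ℕ :=
  (exists_longest H).choose.length

lemma le_pathLen {α : Type*} [Fintype α] {H : SimpleGraph α} {l : List α} (h : IsPathList H l) :
    l.length ≤ pathLen H := (exists_longest H).choose_spec.2 l h

lemma exists_pathLen {α : Type*} [Fintype α] (H : SimpleGraph α) :
    ∃ l, IsPathList H l ∧ l.length = pathLen H :=
  ⟨_, (exists_longest H).choose_spec.1, rfl⟩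

variable {V : Type*} [Fintype V] [DecidableEq V]

/-- Hamiltonicity of the contracted graph. -/
def ContractedHam (int : List V) (a b : V) (G : SimpleGraph V) : Prop :=
  ∃ l, IsHamList (contracted G int a b) l

/-- The non-edges whose addition makes the contracted graph Hamiltonian or its longest path
longer. -/
noncomputable def boosters (int : List V) (a b : V) (G : SimpleGraph V) : Finset (Sym2 V) := by
  classical
  exact Finset.univ.filter fun e => e ∉ G.edgeSet ∧ ¬ e.IsDiag ∧
    (ContractedHam int a b (G ⊔ SimpleGraph.fromEdgeSet {e}) ∨
      pathLen (contracted G int a b) <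
        pathLen (contracted (G ⊔ SimpleGraph.fromEdgeSet {e}) int a b))

variable {G : SimpleGraph V} {int : List V} {a b : V} {K : ℕ}

lemma mem_boosters {e : Sym2 V} : e ∈ boosters int a b G ↔ e ∉ G.edgeSet ∧ ¬ e.IsDiag ∧
    (ContractedHam int a b (G ⊔ SimpleGraph.fromEdgeSet {e}) ∨
      pathLen (contracted G int a b) <
        pathLen (contracted (G ⊔ SimpleGraph.fromEdgeSet {e}) int a b)) := by
  simp [boosters]

lemma IsExpander.three_le_pathLen {α : Type*} [Fintype α] [DecidableEq α] {H : SimpleGraph α}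
    (h : IsExpander H K) (hK : 1 ≤ K) (v : α) : 3 ≤ pathLen H := by
  have h1 := h.expand {v} (by simpa using hK)
  obtain ⟨x, hx, y, hy, hxy⟩ := Finset.one_lt_card.1
    (show 1 < (nbr H {v} \ {v}).card by simp at h1; omega)
  simp only [Finset.mem_sdiff, mem_nbr, Finset.mem_singleton, exists_eq_left] at hx hy
  refine le_pathLen (l := [x, v, y]) ⟨?_, ?_⟩
  · simp [hx.1.symm, hy.1]
  · simp [hx.2, hxy, Ne.symm hy.2]

/-- Rotating both ends of a longest path gives more than `K` choices for each end, at least `K`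
after dropping `none`; passing to unordered pairs costs the factor 2. Such a pair is not yet an
edge, for closing the path would give a Hamilton cycle or a longer path. Adding the pair makes one
of these happen. -/
lemma card_boosters (hexp : IsExpander (contracted G int a b) K) (hK : 1 ≤ K)
    (hham : ¬ ContractedHam int a b G) : K * K ≤ 2 * (boosters int a b G).card := by
  classical
  set H := contracted G int a b with hH
  obtain ⟨l, hl, hll⟩ := exists_pathLen H
  have h3 := hexp.three_le_pathLen hK none
  have hne : l ≠ [] := by rintro rfl; simp at hll; omega
  obtain ⟨R, hR, hR'⟩ := exists_many_ends hexp.expand hl hne fun l' hl' => hll ▸ le_pathLen hl'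
  choose! R' hR'c hR'p using hR'
  have herase : ∀ A : Finset (Option {v : V // v ∉ int}), K < A.card → K ≤ A.eraseNone.card := by
    intro A hA
    by_cases h : none ∈ A
    · rw [Finset.card_eraseNone_of_mem h]; omega
    · rw [Finset.card_eraseNone_of_not_mem h]; omega
  let P : Finset (Σ _ : {v : V // v ∉ int}, {v : V // v ∉ int}) :=
    R.eraseNone.sigma fun x => (R' (some x)).eraseNone
  have hP : K * K ≤ P.card := by
    rw [Finset.card_sigma]
    calc K * K ≤ R.eraseNone.card * K := Nat.mul_le_mul_right _ (herase R hR)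
      _ ≤ _ := by
        rw [← smul_eq_mul]
        exact Finset.card_nsmul_le_sum _ _ _ fun x hx =>
          herase _ (hR'c _ (Finset.mem_eraseNone.1 hx))
  let φ : (Σ _ : {v : V // v ∉ int}, {v : V // v ∉ int}) → Sym2 V := fun e => s(e.1.1, e.2.1)
  have hφ : P.card ≤ 2 * (P.image φ).card := by
    refine Finset.card_le_mul_card_image P 2 ?_
    intro e he
    obtain ⟨⟨x, y⟩, -, rfl⟩ := Finset.mem_image.1 he
    have : (P.filter fun a => φ a = φ ⟨x, y⟩) ⊆ {⟨x, y⟩, ⟨y, x⟩} := by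
      rintro ⟨x', y'⟩ ha
      rw [Finset.mem_filter, Sym2.eq_iff] at ha
      rw [Finset.mem_insert, Finset.mem_singleton]
      rcases ha.2 with h | h
      · obtain rfl : x' = x := Subtype.ext h.1
        obtain rfl : y' = y := Subtype.ext h.2
        exact Or.inl rfl
      · obtain rfl : x' = y := Subtype.ext h.1
        obtain rfl : y' = x := Subtype.ext h.2
        exact Or.inr rfl
    exact (Finset.card_le_card this).trans Finset.card_le_two
  refine hP.trans (hφ.trans (Nat.mul_le_mul_left _ (Finset.card_le_card ?_)))
  intro e he
  obtain ⟨⟨x, y⟩, hxy, rfl⟩ := Finset.mem_image.1 he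
  rw [Finset.mem_sigma, Finset.mem_eraseNone, Finset.mem_eraseNone] at hxy
  obtain ⟨Q, hQ, hQl, hQy, hQx⟩ := hR'p _ hxy.1 _ hxy.2
  have hQ3 : 3 ≤ Q.length := by omega
  have hne : x ≠ y := by
    rintro rfl
    match Q, hQ3 with
    | c :: d :: Q, _ =>
      rw [List.head?_cons, Option.some.injEq] at hQy
      rw [List.getLast?_cons_cons] at hQx
      have := List.mem_of_getLast? hQx
      have hn := hQ.nodup
      rw [List.nodup_cons] at hn
      exact hn.1 (hQy ▸ this)
  rw [mem_boosters]
  refine ⟨?_, ?_, ?_⟩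
  · intro hadj
    have hadj' : H.Adj (some y) (some x) := SimpleGraph.Adj.symm (G := G) hadj
    rcases hQ.close hQ3 hexp.conn hQy hQx hadj' with h | ⟨l', hl', hlt⟩
    · exact hham ⟨_, h⟩
    · have := le_pathLen hl'; omega
  · rw [Sym2.mk_isDiag_iff]
    exact fun h => hne (Subtype.ext h)
  · set G' := G ⊔ SimpleGraph.fromEdgeSet {φ ⟨x, y⟩} with hG'
    have hle : H ≤ contracted G' int a b := contracted_mono le_sup_left
    have hadj' : (contracted G' int a b).Adj (some y) (some x) := by
      change G'.Adj y x
      rw [hG', SimpleGraph.sup_adj, SimpleGraph.fromEdgeSet_adj]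
      right
      refine ⟨?_, fun h => hne (Subtype.ext h).symm⟩
      rw [Set.mem_singleton_iff, Sym2.eq_swap]
    have hQ' : IsPathList (contracted G' int a b) Q :=
      ⟨hQ.chain.imp fun _ _ h => hle h, hQ.nodup⟩
    rcases hQ'.close hQ3 (hexp.mono hle).conn hQy hQx hadj' with h | ⟨l', hl', hlt⟩
    · exact Or.inl ⟨_, h⟩
    · right
      have := le_pathLen hl'
      change pathLen H < _
      omega

/-- If adding `G₂` does not create a Hamilton cycle then some few edges of `G₂` lead to a graph
without boosters in `G₂`. -/
lemma exists_stuck (hint : int ≠ []) {G₂ : SimpleGraph V}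
    (h : ¬ ContractedHam int a b (G ⊔ G₂)) :
    ∃ E : Finset (Sym2 V), (↑E ⊆ G₂.edgeSet) ∧ E.card ≤ Fintype.card V ∧
      ¬ ContractedHam int a b (G ⊔ SimpleGraph.fromEdgeSet ↑E) ∧
      ∀ e ∈ boosters int a b (G ⊔ SimpleGraph.fromEdgeSet ↑E), e ∉ G₂.edgeSet := by
  classical
  let p : Finset (Sym2 V) → ℕ := fun E =>
    pathLen (contracted (G ⊔ SimpleGraph.fromEdgeSet ↑E) int a b)
  have hmono : ∀ E : Finset (Sym2 V), ↑E ⊆ G₂.edgeSet →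
      ¬ ContractedHam int a b (G ⊔ SimpleGraph.fromEdgeSet ↑E) := by
    rintro E hE ⟨l, hl⟩
    have hle : G ⊔ SimpleGraph.fromEdgeSet ↑E ≤ G ⊔ G₂ := by
      refine sup_le_sup le_rfl ?_
      intro x y hxy
      rw [SimpleGraph.fromEdgeSet_adj] at hxy
      exact hE hxy.1
    obtain ⟨x, y, hx, hy, hxy⟩ := hl.closed
    exact h ⟨l, ⟨hl.chain.imp fun _ _ h => contracted_mono hle h, hl.nodup⟩, hl.mem, hl.three_le,
      x, y, hx, hy, contracted_mono hle hxy⟩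
  -- The invariant is that `E` has no more edges than a longest path has vertices. A booster in `G₂`
  -- would lengthen the longest path, so it could be added to a maximal `E`; the invariant also
  -- bounds the size of `E`.
  obtain ⟨E, hE, hmax⟩ := Finset.exists_max_image
    (Finset.univ.filter fun E : Finset (Sym2 V) => ↑E ⊆ G₂.edgeSet ∧ E.card ≤ p E) Finset.card
    ⟨∅, by simp⟩
  simp only [Finset.mem_filter, Finset.mem_univ, true_and] at hE hmax
  refine ⟨E, hE.1, ?_, hmono E hE.1, ?_⟩
  · refine hE.2.trans ?_
    obtain ⟨l, hl, hll⟩ := exists_pathLen (contracted (G ⊔ SimpleGraph.fromEdgeSet ↑E) int a b)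
    have h1 := hl.nodup.length_le_card
    rw [hll, Fintype.card_option] at h1
    -- At least one vertex was contracted away, which compensates for the added vertex `none`.
    obtain ⟨v, hv⟩ := List.exists_mem_of_ne_nil _ hint
    have h2 : Fintype.card {v : V // v ∉ int} < Fintype.card V :=
      Fintype.card_subtype_lt (x := v) (by simpa using hv)
    exact h1.trans h2
  · intro e he heG
    rw [mem_boosters] at he
    obtain ⟨h1, h2, h3⟩ := he
    have heE : e ∉ E := by
      intro h'
      apply h1
      rw [SimpleGraph.edgeSet_sup, SimpleGraph.edgeSet_fromEdgeSet]
      exact Or.inr ⟨h', h2⟩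
    have hins : ↑(insert e E) ⊆ G₂.edgeSet := by
      rw [Finset.coe_insert]; exact Set.insert_subset heG hE.1
    have hEq : G ⊔ SimpleGraph.fromEdgeSet ↑E ⊔ SimpleGraph.fromEdgeSet {e} =
        G ⊔ SimpleGraph.fromEdgeSet ↑(insert e E) := by
      rw [sup_assoc, ← SimpleGraph.fromEdgeSet_union, Finset.coe_insert, Set.union_singleton]
    rw [hEq] at h3
    rcases h3 with h3 | h3
    · exact hmono _ hins h3
    · have h4 := Finset.card_insert_of_notMem heE
      have h5 := hE.2
      have := hmax (insert e E) ⟨hins, by rw [h4]; exact lt_of_le_of_lt h5 h3⟩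
      omega

end Boosters

/-! ### From the contracted graph to an ordered Hamilton cycle. -/

section ToCycle

lemma exists_walk_support {V : Type*} {G : SimpleGraph V} :
    ∀ (l : List V) (x y : V), (x :: l).IsChain G.Adj → (x :: l).getLast? = some y →
      ∃ w : G.Walk x y, w.support = x :: l
  | [], x, y, _, h => by
    simp only [List.getLast?_singleton, Option.some.injEq] at h
    subst h
    exact ⟨.nil, rfl⟩
  | z :: l, x, y, hc, h => by
    rw [List.isChain_cons_cons] at hc
    rw [List.getLast?_cons_cons] at h
    obtain ⟨w, hw⟩ := exists_walk_support l z y hc.2 h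
    exact ⟨.cons hc.1 w, by rw [SimpleGraph.Walk.support_cons, hw]⟩

lemma isChain_rotate {α : Type*} {R : α → α → Prop} {l₁ l₂ : List α} (h : (l₁ ++ l₂).IsChain R)
    (h12 : ∀ x y, (l₁ ++ l₂).head? = some x → (l₁ ++ l₂).getLast? = some y → R y x) :
    (l₂ ++ l₁).IsChain R := by
  rw [List.isChain_append] at h ⊢
  refine ⟨h.2.1, h.1, ?_⟩
  intro a ha b hb
  rw [Option.mem_def] at ha hb
  refine h12 b a ?_ ?_
  · have : l₁ ≠ [] := by rintro rfl; simp at hb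
    rw [List.head?_append_of_ne_nil _ this, hb]
  · have : l₂ ≠ [] := by rintro rfl; simp at ha
    rw [List.getLast?_append_of_ne_nil _ this, ha]

/-- A Hamilton cycle of the contracted graph gives a Hamilton path of the leftover. -/
lemma ContractedHam.exists_path {V : Type*} {G : SimpleGraph V} {int : List V}
    {a b : V} (h : ContractedHam int a b G) :
    ∃ mid : List V, (b :: mid ++ [a]).IsChain G.Adj ∧ (b :: mid ++ [a]).Nodup ∧
      ∀ v, v ∈ b :: mid ++ [a] ↔ v ∉ int := by
  obtain ⟨l, hl⟩ := h
  obtain ⟨C, E, rfl⟩ := List.append_of_mem (hl.mem none)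
  obtain ⟨x, y, hx, hy, hxy⟩ := hl.closed
  -- The cycle is rotated to begin at the contracted vertex; what follows it is a path whose ends
  -- are neighbours of `none`, that is, `a` and `b` in some order.
  have hchain : ((none :: E) ++ C).IsChain (contracted G int a b).Adj := by
    refine isChain_rotate hl.chain ?_
    intro x' y' hx' hy'
    rw [hx, Option.some.injEq] at hx'
    rw [hy, Option.some.injEq] at hy'
    rw [← hx', ← hy']; exact hxy.symm
  have hperm : ((none :: E) ++ C).Perm (C ++ none :: E) := List.perm_append_comm
  have hlast : ∀ z, ((none :: E) ++ C).getLast? = some z → (contracted G int a b).Adj z none := by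
    intro z hz
    rcases C.eq_nil_or_concat' with rfl | ⟨C', c, rfl⟩
    · rw [List.append_nil] at hz
      simp only [List.nil_append, List.head?_cons, Option.some.injEq] at hx
      rw [List.nil_append, hz, Option.some.injEq] at hy
      rw [hx, hy]; exact hxy.symm
    · rw [List.getLast?_append_of_ne_nil _ (by simp), List.getLast?_concat,
        Option.some.injEq] at hz
      have := hl.chain
      rw [List.isChain_append] at this
      rw [← hz]
      exact this.2.2 c (by simp) none (by simp)
  have hnodup := hperm.nodup_iff.2 hl.nodup
  have hmem : ∀ v, v ∈ (none :: E) ++ C := fun v => hperm.mem_iff.2 (hl.mem v)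
  have hlen : 3 ≤ ((none :: E) ++ C).length := hperm.length_eq ▸ hl.three_le
  clear hl hx hy hperm
  rw [List.cons_append] at hchain hnodup hmem hlen hlast
  generalize E ++ C = M at hchain hnodup hmem hlen hlast
  obtain ⟨N, rfl⟩ : ∃ N : List {v : V // v ∉ int}, M = N.map some := by
    have hM : none ∉ M := (List.nodup_cons.1 hnodup).1
    clear * - hM
    induction M with
    | nil => exact ⟨[], rfl⟩
    | cons m M ih =>
      rw [List.mem_cons, not_or] at hM
      obtain ⟨N, rfl⟩ := ih hM.2
      match m, hM with
      | some m, _ => exact ⟨m :: N, rfl⟩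
  have hNn : N.Nodup := (List.nodup_cons.1 hnodup).2.of_map _
  have hNc : (N.map Subtype.val).IsChain G.Adj := by
    rw [List.isChain_map]
    have := (List.isChain_cons.1 hchain).2
    rw [List.isChain_map] at this
    exact this
  have hNv : (N.map Subtype.val).Nodup := hNn.map Subtype.val_injective
  have hNm : ∀ v, v ∈ N.map Subtype.val ↔ v ∉ int := by
    intro v
    constructor
    · intro h
      obtain ⟨u, -, rfl⟩ := List.mem_map.1 h
      exact u.2
    · intro h
      have := hmem (some ⟨v, h⟩)
      simp only [List.mem_cons, reduceCtorEq, false_or] at this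
      obtain ⟨u, hu, hu'⟩ := List.mem_map.1 this
      rw [Option.some.injEq] at hu'
      exact List.mem_map.2 ⟨u, hu, by rw [hu']⟩
  match N, hlen with
  | c :: N, hlen =>
    rcases N.eq_nil_or_concat' with rfl | ⟨N, d, rfl⟩
    · simp at hlen
    have hc : c.1 = a ∨ c.1 = b := by
      have := (List.isChain_cons.1 hchain).1 (some c) (by simp)
      exact this
    have hd : d.1 = a ∨ d.1 = b := by
      have := hlast (some d) (by
        rw [List.getLast?_cons, List.getLast?_map, ← List.cons_append, List.getLast?_concat]; rfl)
      exact this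
    have hcd : c.1 ≠ d.1 := by
      intro h
      rw [List.nodup_cons] at hNn
      exact hNn.1 (by simp [Subtype.ext h])
    have e : (c :: (N ++ [d])).map Subtype.val = c.1 :: N.map Subtype.val ++ [d.1] := by simp
    rw [e] at hNc hNv
    have hNm' : ∀ v, v ∈ c.1 :: N.map Subtype.val ++ [d.1] ↔ v ∉ int := fun v => by
      rw [← e]; exact hNm v
    have case1 : c.1 = b ∧ d.1 = a ∨ c.1 = a ∧ d.1 = b := by
      rcases hc with hc | hc <;> rcases hd with hd | hd
      · exact absurd (hc.trans hd.symm) hcd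
      · exact Or.inr ⟨hc, hd⟩
      · exact Or.inl ⟨hc, hd⟩
      · exact absurd (hc.trans hd.symm) hcd
    rcases case1 with ⟨h1, h2⟩ | ⟨h1, h2⟩
    · rw [h1, h2] at hNc hNv hNm'
      exact ⟨_, hNc, hNv, hNm'⟩
    · rw [h1, h2] at hNc hNv hNm'
      have er : b :: (N.map Subtype.val).reverse ++ [a] =
          (a :: N.map Subtype.val ++ [b]).reverse := by simp
      refine ⟨(N.map Subtype.val).reverse, ?_, ?_, ?_⟩
      · rw [er, List.isChain_reverse]
        exact hNc.imp fun _ _ h => h.symm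
      · rw [er]; exact List.nodup_reverse.2 hNv
      · intro v; rw [er, List.mem_reverse]; exact hNm' v

/-- Repetitions are harmless, as `idxOf` looks at first occurrences; this matters because the
support of a closed walk lists its base point twice. -/
lemma idxOf_lt_of_pairwise_filter {α : Type*} [DecidableEq α] {r : α → α → Prop} {p : α → Bool}
    (hr : ∀ u v, r u v → ¬ r v u) :
    ∀ {l : List α}, (l.filter p).Pairwise r → ∀ {u v : α}, u ∈ l → v ∈ l → p u → p v → r u v →
      l.idxOf u < l.idxOf v
  | [], _, u, v, hu, _, _, _, _ => by simp at hu
  | x :: l, hs, u, v, hu, hv, hpu, hpv, huv => by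
    have huv' : u ≠ v := by rintro rfl; exact hr _ _ huv huv
    by_cases hxu : x = u
    · subst hxu
      rw [List.idxOf_cons_self, List.idxOf_cons_ne _ huv']
      omega
    · by_cases hxv : x = v
      · subst hxv
        exfalso
        have hul : u ∈ l := (List.mem_cons.1 hu).resolve_left (Ne.symm hxu)
        rw [List.filter_cons_of_pos hpv, List.pairwise_cons] at hs
        exact hr _ _ huv (hs.1 u (List.mem_filter.2 ⟨hul, hpu⟩))
      · rw [List.idxOf_cons_ne _ hxu, List.idxOf_cons_ne _ hxv]
        have hs' : (l.filter p).Pairwise r := by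
          refine hs.sublist ?_
          exact (List.sublist_cons_self x l).filter p
        have := idxOf_lt_of_pairwise_filter hr hs' ((List.mem_cons.1 hu).resolve_left (Ne.symm hxu))
          ((List.mem_cons.1 hv).resolve_left (Ne.symm hxv)) hpu hpv huv
        omega

variable {n : ℕ} {G : SimpleGraph (Fin n)} {s : ℕ} {int : List (Fin n)} {a b : Fin n}

/-- The cycle starts at `a`, follows the path backwards to `b`, which turns the decreasing order
into the natural one, and returns to `a` through the leftover. -/
lemma ContractedHam.hasOrderedHamiltonCycle (h : ContractedHam int a b G) (hne : int ≠ [])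
    (hchain : (b :: int ++ [a]).IsChain G.Adj) (hnodup : (b :: int ++ [a]).Nodup)
    (hmem : ∀ x : Fin n, x.val < s → x ∈ int)
    (hsort : (int.filter fun x => x.val < s).Pairwise (· > ·)) : HasOrderedHamiltonCycle G s := by
  obtain ⟨mid, m1, m2, m3⟩ := h.exists_path
  set F := a :: (int.reverse ++ b :: mid) with hF
  have hmid : ∀ v ∈ b :: mid, v ∉ int ∧ v ≠ a := by
    intro v hv
    refine ⟨(m3 v).1 (List.mem_append_left _ hv), ?_⟩
    rintro rfl
    rw [List.nodup_append] at m2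
    exact m2.2.2 v hv v (by simp) rfl
  have hai : a ∉ int := (m3 a).1 (by simp)
  have hFn : F.Nodup := by
    rw [hF, List.nodup_cons, List.mem_append, List.mem_reverse, not_or, List.nodup_append,
      List.nodup_reverse]
    refine ⟨⟨hai, fun h => (hmid a h).2 rfl⟩, ?_, ?_, ?_⟩
    · rw [List.cons_append, List.nodup_cons, List.nodup_append] at hnodup
      exact hnodup.2.1
    · rw [List.nodup_append] at m2
      exact m2.1
    · rintro v hv v' hv' rfl
      exact (hmid v hv').1 (List.mem_reverse.1 hv)
  have hFm : ∀ v, v ∈ F := by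
    intro v
    rw [hF, List.mem_cons, List.mem_append, List.mem_reverse]
    by_cases hv : v ∈ int
    · exact Or.inr (Or.inl hv)
    · have := (m3 v).2 hv
      rw [List.mem_append, List.mem_singleton] at this
      tauto
  have hFl : F.length = n := by
    have h1 : F.toFinset = Finset.univ := Finset.eq_univ_of_forall fun v => List.mem_toFinset.2 (hFm v)
    rw [← List.toFinset_card_of_nodup hFn, h1, Finset.card_univ, Fintype.card_fin]
  have hc : (a :: ((int.reverse ++ b :: mid) ++ [a])).IsChain G.Adj := by
    have e1 : a :: ((int.reverse ++ b :: mid) ++ [a]) =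
        (a :: int.reverse ++ [b]) ++ (mid ++ [a]) := by simp
    rw [e1]
    refine List.IsChain.append_overlap (l₂ := [b]) ?_ (by simpa using m1) (by simp)
    have e2 : a :: int.reverse ++ [b] = (b :: int ++ [a]).reverse := by simp
    rw [e2, List.isChain_reverse]
    exact hchain.imp fun _ _ h => h.symm
  obtain ⟨w, hw⟩ := exists_walk_support _ a a hc (by
    rw [← List.cons_append, List.getLast?_concat])
  have hwl : w.length = n := by
    have := SimpleGraph.Walk.length_support w
    rw [hw, ← List.cons_append, List.length_append, ← hF, hFl] at this
    simpa using this.symm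
  have hn3 : 3 ≤ n := by
    rw [← hFl, hF]
    have := List.length_pos_iff.2 hne
    simp; omega
  have hwn : ¬ w.Nil := by
    intro h
    rw [← SimpleGraph.Walk.length_eq_zero_iff] at h; omega
  refine ⟨a, w, ?_, ?_⟩
  · rw [SimpleGraph.Walk.isHamiltonianCycle_iff_isCycle_and_length_eq, Fintype.card_fin]
    refine ⟨?_, hwl⟩
    rw [SimpleGraph.Walk.isCycle_iff_isPath_tail_and_le_length]
    refine ⟨SimpleGraph.Walk.IsPath.mk' ?_, by omega⟩
    rw [SimpleGraph.Walk.support_tail_of_not_nil _ hwn, hw, List.tail_cons]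
    have hp : ((int.reverse ++ b :: mid) ++ [a]).Perm F := by
      rw [hF]; exact List.perm_append_singleton _ _
    exact hp.nodup_iff.2 hFn
  · intro u v huv hvs
    have hus : u.val < s := lt_trans huv hvs
    rw [hw]
    refine idxOf_lt_of_pairwise_filter (p := fun x => decide (x.val < s)) (r := (· < ·))
      (fun u v h => not_lt_of_gt h) ?_ ?_ ?_ (by simpa using hus) (by simpa using hvs) huv
    · have hno : ∀ x, x ∉ int → ¬ (x.val < s) := fun x hx hxs => hx (hmem x hxs)
      have f1 : (b :: mid).filter (fun x => decide (x.val < s)) = [] := by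
        rw [List.filter_eq_nil_iff]
        intro x hx
        simpa using hno x (hmid x hx).1
      rw [List.filter_cons_of_neg (by simpa using hno a hai), List.filter_append,
        List.filter_append, f1, List.filter_cons_of_neg (by simpa using hno a hai),
        List.filter_reverse]
      simpa [List.pairwise_reverse] using hsort
    · have := hFm u
      rw [← List.cons_append]; exact List.mem_append_left _ this
    · have := hFm v
      rw [← List.cons_append]; exact List.mem_append_left _ this

/-- A typical graph either yields an ordered Hamilton cycle after adding `G₂`, or `G₂` avoids all
the boosters of one of few intermediate graphs. -/
theorem TypicalGraph.exists_stuck {k m D K h w : ℕ} (hG : TypicalGraph G s k m D)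
    (hk : 2 * D ^ 4 * (D + 2) + 1 ≤ k) (hD : 3 ≤ D) (hm : 1 ≤ m) (hs : 0 < s) (hsn : s ≤ n)
    (hw : 2 * m * D + 3 * m + w < n) (hmk : 2 * m + s + m * k ≤ n) (hmh : m ≤ D ^ h)
    (hsw : s + m + (2 + s * (2 * h + 2)) + 4 * D ^ h ≤ w) (hmK : m ≤ K)
    (hK : 3 * K + 2 + m + s * (2 * h + 4) ≤ n) :
    ∃ Bst : Finset (Sym2 (Fin n)) → Finset (Sym2 (Fin n)),
      ∀ G₂ : SimpleGraph (Fin n), ¬ HasOrderedHamiltonCycle (G ⊔ G₂) s →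
        ∃ E : Finset (Sym2 (Fin n)), ↑E ⊆ G₂.edgeSet ∧ E.card ≤ n ∧ Disjoint E (Bst E) ∧
          K * K ≤ 2 * (Bst E).card ∧ (∀ e ∈ Bst E, ¬ e.IsDiag) ∧ ∀ e ∈ Bst E, e ∉ G₂.edgeSet := by
  obtain ⟨g, hS⟩ := hG.exists_threadSetting hk (by omega) hm hw
  have hsmall := hG.card_small_lt hmk
  have hbl : (blockedVerts G s k).card ≤ s + m :=
    (Finset.card_union_le _ _).trans (Nat.add_le_add card_firstVerts_le hsmall.le)
  obtain ⟨a, b, int, hne, hchain, hnodup, ha, hb, hspec, hX, hsort, hlen, hext⟩ :=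
    hS.exists_path hs hsn hmh (by omega)
  have hexp := hG.isExpander hD hnodup ha hb hX hext hmK (by omega)
  -- The path, and with it the booster sets, depends only on the first-round graph. It is fixed
  -- before `G₂` is exposed, as the later union bound requires.
  refine ⟨fun E => boosters int a b (G ⊔ SimpleGraph.fromEdgeSet ↑E), fun G₂ hG₂ => ?_⟩
  have hham : ¬ ContractedHam int a b (G ⊔ G₂) := by
    intro hham
    refine hG₂ (hham.hasOrderedHamiltonCycle hne ?_ hnodup hspec hsort)
    exact hchain.imp fun _ _ h => Or.inl h
  obtain ⟨E, h1, h2, h3, h4⟩ := _root_.exists_stuck hne hham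
  rw [Fintype.card_fin] at h2
  refine ⟨E, h1, h2, ?_, card_boosters (hexp.mono (contracted_mono le_sup_left)) (by omega) h3,
    fun e he => (mem_boosters.1 he).2.1, h4⟩
  rw [Finset.disjoint_left]
  exact fun e he he' => h4 e he' (h1 he)

end ToCycle

/-! ### The binomial random graph and two-round exposure. -/

section RandomGraph

open MeasureTheory ProbabilityTheory unitInterval

variable {V : Type*} [Fintype V] [DecidableEq V]

/-- The probability of an event for the binomial random graph. -/
noncomputable def prG (V : Type*) (p : I) (S : Set (SimpleGraph V)) : ℝ :=
  (SimpleGraph.binomialRandom V p).real S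

omit [DecidableEq V] in
lemma discreteMeasurableSpace_simpleGraph : DiscreteMeasurableSpace (SimpleGraph V) := by
  have : MeasurableSingletonClass (SimpleGraph V) := ⟨fun G => by
    have : ({G} : Set (SimpleGraph V)) = SimpleGraph.edgeSet ⁻¹' {G.edgeSet} := by
      ext G'; simp
    rw [this]
    exact SimpleGraph.measurable_edgeSet (measurableSet_singleton _)⟩
  infer_instance

/-- The graphs that contain all the edges of `A` and none of `B`. -/
def patternEvent (A B : Finset (Sym2 V)) : Set (SimpleGraph V) :=
  {G | (∀ e ∈ A, e ∈ G.edgeSet) ∧ ∀ e ∈ B, e ∉ G.edgeSet}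

lemma measure_patternEvent (p : I) {A B : Finset (Sym2 V)} (hAB : Disjoint A B)
    (hA : ∀ e ∈ A, ¬ e.IsDiag) (hB : ∀ e ∈ B, ¬ e.IsDiag) :
    SimpleGraph.binomialRandom V p (patternEvent A B) =
      (toNNReal p : ENNReal) ^ A.card * (toNNReal (σ p) : ENNReal) ^ B.card := by
  have := discreteMeasurableSpace_simpleGraph (V := V)
  rw [SimpleGraph.binomialRandom_eq_map, Measure.map_apply SimpleGraph.measurable_fromEdgeSet
    (.of_discrete), setBernoulli_apply']
  set t : Sym2 V → Set Prop := fun e => if e ∈ A then {True} else {False} with ht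
  have hset : (fun q : Sym2 V → Prop => {i | q i}) ⁻¹'
      (SimpleGraph.fromEdgeSet ⁻¹' patternEvent A B) = Set.pi ↑(A ∪ B) t := by
    ext q
    simp only [Set.mem_preimage, patternEvent, SimpleGraph.edgeSet_fromEdgeSet, Set.mem_pi,
      Finset.coe_union, Set.mem_union, Finset.mem_coe, Set.mem_ofPred_eq, Set.mem_sdiff]
    constructor
    · rintro ⟨h1, h2⟩ e he
      rcases he with he | he
      · simp only [ht, if_pos he, Set.mem_singleton_iff, eq_iff_iff, iff_true]
        exact (h1 e he).1
      · have heA : e ∉ A := fun h => Finset.disjoint_left.1 hAB h he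
        simp only [ht, if_neg heA, Set.mem_singleton_iff, eq_iff_iff, iff_false]
        exact fun h => h2 e he ⟨h, by simpa using hB e he⟩
    · intro h
      constructor
      · intro e he
        have := h e (Or.inl he)
        simp only [ht, if_pos he, Set.mem_singleton_iff, eq_iff_iff, iff_true] at this
        exact ⟨this, by simpa using hA e he⟩
      · intro e he h'
        have heA : e ∉ A := fun h => Finset.disjoint_left.1 hAB h he
        have := h e (Or.inr he)
        simp only [ht, if_neg heA, Set.mem_singleton_iff, eq_iff_iff, iff_false] at this
        exact this h'.1
  rw [hset, Measure.infinitePi_pi _ (fun _ _ => .of_discrete), Finset.prod_union hAB]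
  congr 1
  · rw [Finset.prod_congr rfl (g := fun _ => (toNNReal p : ENNReal)), Finset.prod_const]
    intro e he
    have : e ∈ (Sym2.diagSet : Set (Sym2 V))ᶜ := by simpa using hA e he
    simp only [ht, if_pos he]
    simp [this]
  · rw [Finset.prod_congr rfl (g := fun _ => (toNNReal (σ p) : ENNReal)), Finset.prod_const]
    intro e he
    have heA : e ∉ A := fun h => Finset.disjoint_left.1 hAB h he
    simp only [ht, if_neg heA]
    simp [hB e he]

lemma prG_patternEvent (p : I) {A B : Finset (Sym2 V)} (hAB : Disjoint A B)
    (hA : ∀ e ∈ A, ¬ e.IsDiag) (hB : ∀ e ∈ B, ¬ e.IsDiag) :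
    prG V p (patternEvent A B) = (p : ℝ) ^ A.card * (1 - p : ℝ) ^ B.card := by
  rw [prG, measureReal_def, measure_patternEvent p hAB hA hB]
  simp

omit [Fintype V] [DecidableEq V] in
lemma prG_nonneg (p : I) (S : Set (SimpleGraph V)) : 0 ≤ prG V p S := measureReal_nonneg

omit [DecidableEq V] in
lemma prG_mono (p : I) {S T : Set (SimpleGraph V)} (h : S ⊆ T) : prG V p S ≤ prG V p T :=
  measureReal_mono h

omit [Fintype V] [DecidableEq V] in
lemma prG_union_le (p : I) (S T : Set (SimpleGraph V)) :
    prG V p (S ∪ T) ≤ prG V p S + prG V p T := measureReal_union_le _ _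

omit [DecidableEq V] in
lemma prG_le_sum (p : I) {ι : Type*} (F : Finset ι) (S : ι → Set (SimpleGraph V))
    {T : Set (SimpleGraph V)} (h : ∀ G ∈ T, ∃ i ∈ F, G ∈ S i) :
    prG V p T ≤ ∑ i ∈ F, prG V p (S i) := by
  refine (prG_mono p (T := ⋃ i ∈ F, S i) fun G hG => ?_).trans (measureReal_biUnion_finset_le _ _)
  obtain ⟨i, hi, hG⟩ := h G hG
  exact Set.mem_biUnion hi hG

/-- The union of independent binomial random graphs is a binomial random graph. -/
lemma map_sup_binomialRandom {p p₁ p₂ : I} (h : (1 - p : ℝ) = (1 - p₁) * (1 - p₂)) :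
    ((SimpleGraph.binomialRandom V p₁).prod (SimpleGraph.binomialRandom V p₂)).map
      (fun G => G.1 ⊔ G.2) = SimpleGraph.binomialRandom V p := by
  have := discreteMeasurableSpace_simpleGraph (V := V)
  -- The events that no edge of `B` is present form a generating π-system. For a union of two graphs
  -- they are products, so agreement reduces to the relation between the three probabilities.
  set C : Set (Set (SimpleGraph V)) := {S | ∃ B : Finset (Sym2 V), (∀ e ∈ B, ¬ e.IsDiag) ∧
    S = patternEvent ∅ B} with hC
  have hmeas : Measurable fun G : SimpleGraph V × SimpleGraph V => G.1 ⊔ G.2 :=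
    measurable_of_countable _
  have : IsProbabilityMeasure (((SimpleGraph.binomialRandom V p₁).prod
      (SimpleGraph.binomialRandom V p₂)).map (fun G => G.1 ⊔ G.2)) :=
    Measure.isProbabilityMeasure_map hmeas.aemeasurable
  refine ext_of_generate_finite C ?_ ?_ ?_ ?_
  · refine le_antisymm ?_ (MeasurableSpace.generateFrom_le fun _ _ => .of_discrete)
    intro S _
    have hsing : ∀ G : SimpleGraph V, MeasurableSet[MeasurableSpace.generateFrom C] {G} := by
      intro G
      have hEv : ∀ e : Sym2 V, ¬ e.IsDiag →
          MeasurableSet[MeasurableSpace.generateFrom C] (patternEvent ∅ {e}) := fun e he =>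
        MeasurableSpace.measurableSet_generateFrom ⟨{e}, by simpa using he, rfl⟩
      classical
      have : ({G} : Set (SimpleGraph V)) = ⋂ e : {e : Sym2 V // ¬ e.IsDiag},
          if e.1 ∈ G.edgeSet then (patternEvent ∅ {e.1})ᶜ else patternEvent ∅ {e.1} := by
        ext G'
        simp only [Set.mem_singleton_iff, Set.mem_iInter]
        constructor
        · rintro rfl e
          split_ifs with he <;> simp [patternEvent, he]
        · intro hG'
          rw [← SimpleGraph.edgeSet_inj]
          ext e
          by_cases hd : e.IsDiag
          · exact iff_of_false (fun h' => G'.not_isDiag_of_mem_edgeSet h' hd)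
              (fun h' => G.not_isDiag_of_mem_edgeSet h' hd)
          · have := hG' ⟨e, hd⟩
            split_ifs at this with he
            · simp [patternEvent] at this
              exact iff_of_true this he
            · simp [patternEvent] at this
              exact iff_of_false this he
      rw [this]
      refine MeasurableSet.iInter fun e => ?_
      split_ifs
      · exact (hEv e.1 e.2).compl
      · exact hEv e.1 e.2
    rw [← Set.biUnion_of_singleton S]
    exact MeasurableSet.biUnion S.to_countable fun G _ => hsing G
  · rintro _ ⟨B, hB, rfl⟩ _ ⟨B', hB', rfl⟩ -
    refine ⟨B ∪ B', ?_, ?_⟩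
    · intro e he
      rcases Finset.mem_union.1 he with he | he
      · exact hB e he
      · exact hB' e he
    · ext G
      simp only [patternEvent, Set.mem_inter_iff, Set.mem_ofPred_eq, Finset.mem_union]
      grind
  · rintro _ ⟨B, hB, rfl⟩
    rw [Measure.map_apply hmeas .of_discrete]
    have : (fun G : SimpleGraph V × SimpleGraph V => G.1 ⊔ G.2) ⁻¹' patternEvent ∅ B =
        patternEvent ∅ B ×ˢ patternEvent ∅ B := by
      ext G
      simp only [patternEvent, Set.mem_preimage, Set.mem_ofPred_eq, Set.mem_prod,
        SimpleGraph.edgeSet_sup, Set.mem_union]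
      grind
    rw [this, Measure.prod_prod, measure_patternEvent _ (by simp) (by simp) hB,
      measure_patternEvent _ (by simp) (by simp) hB, measure_patternEvent _ (by simp) (by simp) hB]
    simp only [Finset.card_empty, pow_zero, one_mul]
    rw [← mul_pow]
    congr 1
    rw [← ENNReal.coe_mul, ENNReal.coe_inj]
    ext
    simpa using h.symm
  · rw [Measure.map_apply hmeas .univ]
    simp

/-- Two-round exposure. -/
lemma prG_compl_le_of_two_rounds {p p₁ p₂ : I} (h : (1 - p : ℝ) = (1 - p₁) * (1 - p₂))
    (S Good : Set (SimpleGraph V)) {η : ℝ} (hη : 0 ≤ η)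
    (hS : ∀ G ∈ Good, prG V p₂ {G₂ | G ⊔ G₂ ∉ S} ≤ η) :
    prG V p Sᶜ ≤ prG V p₁ Goodᶜ + η := by
  have := discreteMeasurableSpace_simpleGraph (V := V)
  set μ := SimpleGraph.binomialRandom V p₁ with hμ
  set ν := SimpleGraph.binomialRandom V p₂ with hν
  have hmeas : Measurable fun G : SimpleGraph V × SimpleGraph V => G.1 ⊔ G.2 :=
    measurable_of_countable _
  have e1 : prG V p Sᶜ = (μ.prod ν).real {G | G.1 ⊔ G.2 ∉ S} := by
    rw [prG, ← map_sup_binomialRandom h, measureReal_def, Measure.map_apply hmeas .of_discrete]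
    rfl
  set T : Set (SimpleGraph V × SimpleGraph V) := {G | G.1 ∈ Good ∧ G.1 ⊔ G.2 ∉ S} with hT
  have hsub : {G : SimpleGraph V × SimpleGraph V | G.1 ⊔ G.2 ∉ S} ⊆ (Goodᶜ ×ˢ Set.univ) ∪ T := by
    intro G hG
    by_cases h' : G.1 ∈ Good
    · exact Or.inr ⟨h', hG⟩
    · exact Or.inl ⟨h', trivial⟩
  rw [e1]
  refine (measureReal_mono hsub).trans ((measureReal_union_le _ _).trans (add_le_add ?_ ?_))
  · rw [measureReal_prod_prod]; simp [prG, hμ]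
  · rw [measureReal_def]
    refine ENNReal.toReal_le_of_le_ofReal hη ?_
    rw [Measure.prod_apply .of_discrete]
    calc ∫⁻ G, ν (Prod.mk G ⁻¹' T) ∂μ ≤ ∫⁻ _, ENNReal.ofReal η ∂μ := by
          refine lintegral_mono fun G => ?_
          by_cases hG : G ∈ Good
          · have e2 : Prod.mk G ⁻¹' T = {G₂ | G ⊔ G₂ ∉ S} := by
              ext G₂; simp [hT, hG]
            rw [e2]
            exact (ENNReal.le_ofReal_iff_toReal_le (measure_ne_top _ _) hη).2 (hS G hG)
          · have e2 : Prod.mk G ⁻¹' T = ∅ := by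
              ext G₂; simp [hT, hG]
            rw [e2]; simp
      _ = ENNReal.ofReal η := by simp

/-- Exponential Markov: each set counted has `1 ≤ L ^ (k - |T|)`, and with this weight the binomial
theorem sums over all subsets. -/
lemma sum_powerset_card_le {ι : Type*} [DecidableEq ι] (Z : Finset ι) (k : ℕ) {a b L : ℝ}
    (ha : 0 ≤ a) (hb : 0 ≤ b) (hL : 1 ≤ L) :
    ∑ T ∈ Z.powerset.filter (fun T => T.card ≤ k), a ^ T.card * b ^ (Z.card - T.card) ≤
      L ^ k * (a / L + b) ^ Z.card := by
  have hL0 : 0 < L := by linarith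
  rw [← Finset.sum_pow_mul_eq_add_pow (a / L) b Z, Finset.mul_sum]
  refine (Finset.sum_le_sum (g := fun T => L ^ k * ((a / L) ^ T.card * b ^ (Z.card - T.card)))
    fun T hT => ?_).trans
    (Finset.sum_le_sum_of_subset_of_nonneg (Finset.filter_subset _ _) fun T _ _ => by positivity)
  rw [div_pow]
  have h1 : L ^ T.card ≤ L ^ k := pow_le_pow_right₀ hL (Finset.mem_filter.1 hT).2
  have h2 : (0 : ℝ) < L ^ T.card := by positivity
  calc a ^ T.card * b ^ (Z.card - T.card)
      = L ^ T.card * (a ^ T.card / L ^ T.card * b ^ (Z.card - T.card)) := by field_simp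
    _ ≤ _ := mul_le_mul_of_nonneg_right h1 (by positivity)

/-- A second round with many edges finds the boosters it needs. -/
lemma prG_stuck_le {n : ℕ} (p : I) {K : ℕ}
    (Bst : Finset (Sym2 (Fin n)) → Finset (Sym2 (Fin n))) {S : Set (SimpleGraph (Fin n))}
    (hS : ∀ G₂ ∈ S, ∃ E : Finset (Sym2 (Fin n)), ↑E ⊆ G₂.edgeSet ∧ E.card ≤ n ∧
      Disjoint E (Bst E) ∧ K * K ≤ 2 * (Bst E).card ∧ (∀ e ∈ Bst E, ¬ e.IsDiag) ∧
      ∀ e ∈ Bst E, e ∉ G₂.edgeSet)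
    (hK : (n : ℝ) / 9 ≤ K) (hpn : 324 * 7 ≤ (p : ℝ) * n) :
    prG (Fin n) p S ≤ Real.exp (-n) := by
  classical
  have hp0 : (0 : ℝ) ≤ p := p.2.1
  have hp1 : (0 : ℝ) ≤ 1 - p := by linarith [p.2.2]
  set Z : Finset (Sym2 (Fin n)) := Finset.univ.filter fun e => ¬ e.IsDiag with hZ
  have hZc : (Z.card : ℝ) ≤ (n : ℝ) ^ 2 := by
    have h1 : Z.card ≤ Fintype.card (Sym2 (Fin n)) := Finset.card_le_univ _
    rw [Sym2.card, Fintype.card_fin, Nat.choose_two_right] at h1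
    have h2 : Z.card ≤ n * n := by
      have h3 := Sym2.card_image_offDiag (Finset.univ : Finset (Fin n))
      have h4 : Z ⊆ (Finset.univ : Finset (Fin n × Fin n)).image Sym2.mk.uncurry := by
        intro e _
        induction e with
        | h x y => exact Finset.mem_image.2 ⟨(x, y), Finset.mem_univ _, rfl⟩
      have := (Finset.card_le_card h4).trans Finset.card_image_le
      simpa using this
    rw [sq]; exact_mod_cast h2
  set F := Z.powerset.filter fun T => T.card ≤ n with hF
  let Ok : Finset (Sym2 (Fin n)) → Prop := fun E => Disjoint E (Bst E) ∧
    K * K ≤ 2 * (Bst E).card ∧ (∀ e ∈ Bst E, ¬ e.IsDiag)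
  have h1 := prG_le_sum p (F.filter Ok) (fun E => patternEvent E (Bst E)) (T := S) (by
    intro G hG
    obtain ⟨E, h1, h2, h3, h4, h5, h6⟩ := hS G hG
    refine ⟨E, Finset.mem_filter.2 ⟨Finset.mem_filter.2 ⟨Finset.mem_powerset.2 ?_, h2⟩, h3, h4, h5⟩,
      fun e he => h1 he, h6⟩
    intro e he
    exact Finset.mem_filter.2 ⟨Finset.mem_univ _, G.not_isDiag_of_mem_edgeSet (h1 he)⟩)
  refine h1.trans ?_
  -- All boosters must be absent, and there are at least `K ^ 2 / 2 ≥ n ^ 2 / 162` of them.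
  set q : ℝ := Real.exp (-(p * n ^ 2 / 162)) with hq
  have h2 : ∀ E ∈ F.filter Ok, prG (Fin n) p (patternEvent E (Bst E)) ≤ q * ((p : ℝ) ^ E.card *
      1 ^ (Z.card - E.card)) := by
    intro E hE
    obtain ⟨hE1, hE2, hE3, hE4⟩ := Finset.mem_filter.1 hE
    have hEZ := Finset.mem_powerset.1 (Finset.mem_filter.1 hE1).1
    rw [prG_patternEvent p hE2 (fun e he => (Finset.mem_filter.1 (hEZ he)).2) hE4, one_pow, mul_one,
      mul_comm]
    refine mul_le_mul_of_nonneg_right ?_ (by positivity)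
    calc (1 - p : ℝ) ^ (Bst E).card ≤ (Real.exp (-p)) ^ (Bst E).card := by
          refine pow_le_pow_left₀ hp1 ?_ _
          have := Real.add_one_le_exp (-(p : ℝ)); linarith
      _ = Real.exp (-(p * (Bst E).card)) := by
          rw [← Real.exp_nat_mul]; congr 1; ring
      _ ≤ q := by
          rw [hq]
          refine Real.exp_le_exp.2 (neg_le_neg ?_)
          have h3 : (K : ℝ) * K ≤ 2 * (Bst E).card := by exact_mod_cast hE3
          have h4 : (n : ℝ) / 9 * (n / 9) ≤ K * K := by gcongr
          have h5 : (n : ℝ) ^ 2 / 162 ≤ (Bst E).card := by nlinarith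
          calc (p : ℝ) * n ^ 2 / 162 = p * (n ^ 2 / 162) := by ring
            _ ≤ _ := by gcongr
  refine (Finset.sum_le_sum h2).trans ?_
  rw [← Finset.mul_sum]
  -- The weight 324 is chosen so that the sum over `E` costs `exp (p n ^ 2 / 324)`, half of the gain
  -- in `q`, besides `324 ^ n ≤ exp (6 n)`. What is left of the exponent is at most `-n` once `p n ≥
  -- 324 * 7`.
  have h3 : ∑ E ∈ F.filter Ok, (p : ℝ) ^ E.card * 1 ^ (Z.card - E.card) ≤
      324 ^ n * ((p : ℝ) / 324 + 1) ^ Z.card :=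
    (Finset.sum_le_sum_of_subset_of_nonneg (Finset.filter_subset _ _) fun T _ _ => by
      positivity).trans (sum_powerset_card_le Z n hp0 zero_le_one (by norm_num))
  have h4 : ((p : ℝ) / 324 + 1) ^ Z.card ≤ Real.exp (p * n ^ 2 / 324) := by
    calc ((p : ℝ) / 324 + 1) ^ Z.card ≤ (Real.exp (p / 324)) ^ Z.card :=
          pow_le_pow_left₀ (by positivity) (Real.add_one_le_exp _) _
      _ = Real.exp (Z.card * (p / 324)) := by rw [← Real.exp_nat_mul]
      _ ≤ _ := by
          refine Real.exp_le_exp.2 ?_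
          calc (Z.card : ℝ) * (p / 324) ≤ n ^ 2 * (p / 324) := by gcongr
            _ = _ := by ring
  have h5 : (324 : ℝ) ^ n ≤ Real.exp (6 * n) := by
    have : (324 : ℝ) ≤ Real.exp 6 := by
      have e1 := Real.exp_one_gt_d9
      have e2 : Real.exp 6 = Real.exp 1 ^ 6 := by rw [← Real.exp_nat_mul]; norm_num
      rw [e2]
      calc (324 : ℝ) ≤ 2.7 ^ 6 := by norm_num
        _ ≤ _ := by gcongr; linarith
    calc (324 : ℝ) ^ n ≤ (Real.exp 6) ^ n := by gcongr
      _ = _ := by rw [← Real.exp_nat_mul]; congr 1; ring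
  calc q * ∑ E ∈ F.filter Ok, (p : ℝ) ^ E.card * 1 ^ (Z.card - E.card)
      ≤ q * (Real.exp (6 * n) * Real.exp (p * n ^ 2 / 324)) := by
        refine mul_le_mul_of_nonneg_left (h3.trans ?_) (Real.exp_pos _).le
        gcongr
    _ = Real.exp (6 * n - p * n ^ 2 / 324) := by
        rw [hq, ← Real.exp_add, ← Real.exp_add]; congr 1; ring
    _ ≤ Real.exp (-n) := by
        refine Real.exp_le_exp.2 ?_
        have hn : (0 : ℝ) ≤ n := Nat.cast_nonneg n
        have : 7 * (n : ℝ) ≤ p * n ^ 2 / 324 := by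
          have := mul_le_mul_of_nonneg_right hpn hn
          nlinarith
        linarith

end RandomGraph

/-! ### First-moment bounds. -/

section FirstMoment

open MeasureTheory ProbabilityTheory unitInterval

lemma choose_le_exp_pow (n x : ℕ) (hx : 0 < x) :
    (n.choose x : ℝ) ≤ (Real.exp 1 * n / x) ^ x := by
  have hx' : (0 : ℝ) < x := by exact_mod_cast hx
  have h1 := Nat.choose_le_pow_div (α := ℝ) x n
  have h2 := Real.pow_div_factorial_le_exp (x : ℝ) hx'.le x
  have hf : (0 : ℝ) < x.factorial := by exact_mod_cast x.factorial_pos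
  calc (n.choose x : ℝ) ≤ n ^ x / x.factorial := h1
    _ = (n / x : ℝ) ^ x * ((x : ℝ) ^ x / x.factorial) := by
        rw [div_pow]; field_simp
    _ ≤ (n / x : ℝ) ^ x * Real.exp x := by gcongr
    _ = _ := by
        rw [← Real.exp_one_pow x, ← mul_pow]; congr 1; ring

section Star

variable {V : Type*} [DecidableEq V]

/-- The star with centre `y` and leaves `T`. -/
def starEdges (y : V) (T : Finset V) : Finset (Sym2 V) := T.image fun z => s(y, z)

lemma card_starEdges (y : V) (T : Finset V) : (starEdges y T).card = T.card := by
  refine Finset.card_image_of_injective _ fun a b h => ?_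
  exact Sym2.congr_right.1 h

lemma mem_starEdges {y : V} {T : Finset V} {e : Sym2 V} :
    e ∈ starEdges y T ↔ ∃ z ∈ T, s(y, z) = e := by simp [starEdges]

lemma starEdges_not_isDiag {y : V} {T : Finset V} (hy : y ∉ T) :
    ∀ e ∈ starEdges y T, ¬ e.IsDiag := by
  intro e he
  obtain ⟨z, hz, rfl⟩ := mem_starEdges.1 he
  rw [Sym2.mk_isDiag_iff]
  rintro rfl; exact hy hz

lemma starEdges_disjoint_of_disjoint {y : V} {T T' : Finset V} (h : Disjoint T T') :
    Disjoint (starEdges y T) (starEdges y T') := by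
  rw [Finset.disjoint_left] at h ⊢
  intro e he he'
  obtain ⟨z, hz, rfl⟩ := mem_starEdges.1 he
  obtain ⟨z', hz', h'⟩ := mem_starEdges.1 he'
  have : z' = z := Sym2.congr_right.1 h'
  exact h hz (this ▸ hz')

lemma starEdges_disjoint_of_ne {y y' : V} {T T' : Finset V} (h : y ≠ y') (hy : y ∉ T') :
    Disjoint (starEdges y T) (starEdges y' T') := by
  rw [Finset.disjoint_left]
  intro e he he'
  obtain ⟨z, hz, rfl⟩ := mem_starEdges.1 he
  obtain ⟨z', hz', h'⟩ := mem_starEdges.1 he'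
  rw [Sym2.eq_iff] at h'
  rcases h' with ⟨h1, h2⟩ | ⟨h1, h2⟩
  · exact h h1.symm
  · exact hy (h2 ▸ hz')

lemma disjoint_starEdges_of_forall {F : Finset (Sym2 V)} {y : V} {T W : Finset V} (hT : T ⊆ W)
    (hF : ∀ e ∈ F, ∀ z ∈ W, z ∉ e) : Disjoint F (starEdges y T) := by
  rw [Finset.disjoint_left]
  intro e he he'
  obtain ⟨z, hz, rfl⟩ := mem_starEdges.1 he'
  exact hF _ he z (hT hz) (by simp)

end Star

/-- The upper bound for the probability that a vertex has at most `j` neighbours in a given set of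
`w` vertices. -/
noncomputable def lowDegBound (p L : ℝ) (w : ℝ) (j : ℕ) : ℝ :=
  L ^ j * Real.exp (-(p * (1 - 1 / L) * w))

lemma lowDegBound_nonneg {p L w : ℝ} {j : ℕ} (hL : 1 ≤ L) : 0 ≤ lowDegBound p L w j := by
  unfold lowDegBound; positivity

lemma lowDegBound_anti {p L w w' : ℝ} {j : ℕ} (hp : 0 ≤ p) (hL : 1 ≤ L) (h : w ≤ w') :
    lowDegBound p L w' j ≤ lowDegBound p L w j := by
  unfold lowDegBound
  have : 0 ≤ 1 - 1 / L := by
    have : 1 / L ≤ 1 := by rw [div_le_one (by linarith)]; exact hL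
    linarith
  gcongr

lemma sum_star_le {ι : Type*} [DecidableEq ι] (W : Finset ι) (j : ℕ) {p L : ℝ} (hp : 0 ≤ p)
    (hp1 : p ≤ 1) (hL : 1 ≤ L) :
    ∑ T ∈ W.powerset.filter (fun T => T.card ≤ j), p ^ T.card * (1 - p) ^ (W \ T).card ≤
      lowDegBound p L W.card j := by
  have h1 : ∀ T ∈ W.powerset.filter (fun T => T.card ≤ j),
      p ^ T.card * (1 - p) ^ (W \ T).card = p ^ T.card * (1 - p) ^ (W.card - T.card) := by
    intro T hT
    rw [Finset.card_sdiff_of_subset (Finset.mem_powerset.1 (Finset.mem_filter.1 hT).1)]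
  rw [Finset.sum_congr rfl h1]
  refine (sum_powerset_card_le W j hp (by linarith) hL).trans ?_
  unfold lowDegBound
  refine mul_le_mul_of_nonneg_left ?_ (by positivity)
  have h2 : 0 ≤ p / L + (1 - p) := by
    have : 0 ≤ p / L := by positivity
    linarith
  calc (p / L + (1 - p)) ^ W.card ≤ (Real.exp (-(p * (1 - 1 / L)))) ^ W.card := by
        refine pow_le_pow_left₀ h2 ?_ _
        have := Real.add_one_le_exp (-(p * (1 - 1 / L)))
        calc p / L + (1 - p) = -(p * (1 - 1 / L)) + 1 := by ring
          _ ≤ _ := this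
    _ = _ := by rw [← Real.exp_nat_mul]; congr 1; ring

variable {V : Type*} [Fintype V] [DecidableEq V]

/-- Union bound over the exact neighbourhood of `y` in `W`. No edge of `F` meets `W`, so the edges
of `F` and those between `y` and `W` are independent. -/
lemma prG_low_degree (p : I) (F : Finset (Sym2 V)) (hFd : ∀ e ∈ F, ¬ e.IsDiag) (y : V)
    (W : Finset V) (hy : y ∉ W) (hF : ∀ e ∈ F, ∀ z ∈ W, z ∉ e) (j : ℕ) {L : ℝ} (hL : 1 ≤ L) :
    prG V p {G | (∀ e ∈ F, e ∈ G.edgeSet) ∧ (nbr G {y} ∩ W).card ≤ j} ≤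
      (p : ℝ) ^ F.card * lowDegBound p L W.card j := by
  set Fam := W.powerset.filter fun T => T.card ≤ j with hFam
  have hTW : ∀ T ∈ Fam, T ⊆ W := fun T hT => Finset.mem_powerset.1 (Finset.mem_filter.1 hT).1
  refine (prG_le_sum p Fam (fun T => patternEvent (F ∪ starEdges y T) (starEdges y (W \ T)))
    ?_).trans ?_
  · intro G hG
    refine ⟨nbr G {y} ∩ W, Finset.mem_filter.2
      ⟨Finset.mem_powerset.2 Finset.inter_subset_right, hG.2⟩, ?_, ?_⟩
    · intro e he
      rcases Finset.mem_union.1 he with he | he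
      · exact hG.1 e he
      · obtain ⟨z, hz, rfl⟩ := mem_starEdges.1 he
        simpa using (Finset.mem_inter.1 hz).1
    · intro e he
      obtain ⟨z, hz, rfl⟩ := mem_starEdges.1 he
      intro h
      rw [Finset.mem_sdiff, Finset.mem_inter] at hz
      exact hz.2 ⟨by simpa using h, hz.1⟩
  · have h1 : ∀ T ∈ Fam, prG V p (patternEvent (F ∪ starEdges y T) (starEdges y (W \ T))) =
        (p : ℝ) ^ F.card * ((p : ℝ) ^ T.card * (1 - p : ℝ) ^ (W \ T).card) := by
      intro T hT
      have hyT : y ∉ T := fun h => hy (hTW T hT h)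
      have d1 : Disjoint F (starEdges y T) := disjoint_starEdges_of_forall (hTW T hT) hF
      have d2 : Disjoint F (starEdges y (W \ T)) :=
        disjoint_starEdges_of_forall Finset.sdiff_subset hF
      rw [prG_patternEvent]
      · rw [Finset.card_union_of_disjoint d1, card_starEdges, card_starEdges, pow_add, mul_assoc]
      · exact Finset.disjoint_union_left.2
          ⟨d2, starEdges_disjoint_of_disjoint Finset.disjoint_sdiff⟩
      · intro e he
        rcases Finset.mem_union.1 he with he | he
        · exact hFd e he
        · exact starEdges_not_isDiag hyT e he
      · exact starEdges_not_isDiag fun h => hy (Finset.sdiff_subset h)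
    rw [Finset.sum_congr rfl h1, ← Finset.mul_sum]
    exact mul_le_mul_of_nonneg_left (sum_star_le W j p.2.1 p.2.2 hL) (pow_nonneg p.2.1 _)

/-- Neither centre lies in `W`, so the two stars into `W` share no edge and the bounds multiply. -/
lemma prG_two_low_degrees (p : I) (F : Finset (Sym2 V)) (hFd : ∀ e ∈ F, ¬ e.IsDiag) {y y' : V}
    (hyy : y ≠ y') (W : Finset V) (hy : y ∉ W) (hy' : y' ∉ W)
    (hF : ∀ e ∈ F, ∀ z ∈ W, z ∉ e) (j : ℕ) {L : ℝ} (hL : 1 ≤ L) :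
    prG V p {G | (∀ e ∈ F, e ∈ G.edgeSet) ∧ (nbr G {y} ∩ W).card ≤ j ∧
      (nbr G {y'} ∩ W).card ≤ j} ≤ (p : ℝ) ^ F.card * lowDegBound p L W.card j ^ 2 := by
  set Fam := W.powerset.filter fun T => T.card ≤ j with hFam
  have hTW : ∀ T ∈ Fam, T ⊆ W := fun T hT => Finset.mem_powerset.1 (Finset.mem_filter.1 hT).1
  refine (prG_le_sum p (Fam ×ˢ Fam) (fun T => patternEvent
    (F ∪ (starEdges y T.1 ∪ starEdges y' T.2)) (starEdges y (W \ T.1) ∪ starEdges y' (W \ T.2)))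
    ?_).trans ?_
  · intro G hG
    refine ⟨(nbr G {y} ∩ W, nbr G {y'} ∩ W), Finset.mem_product.2 ⟨Finset.mem_filter.2
      ⟨Finset.mem_powerset.2 Finset.inter_subset_right, hG.2.1⟩, Finset.mem_filter.2
      ⟨Finset.mem_powerset.2 Finset.inter_subset_right, hG.2.2⟩⟩, ?_, ?_⟩
    · intro e he
      rcases Finset.mem_union.1 he with he | he
      · exact hG.1 e he
      · rcases Finset.mem_union.1 he with he | he
        all_goals
          obtain ⟨z, hz, rfl⟩ := mem_starEdges.1 he
          simpa using (Finset.mem_inter.1 hz).1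
    · intro e he
      rcases Finset.mem_union.1 he with he | he
      all_goals
        obtain ⟨z, hz, rfl⟩ := mem_starEdges.1 he
        intro h
        rw [Finset.mem_sdiff, Finset.mem_inter] at hz
        exact hz.2 ⟨by simpa using h, hz.1⟩
  · have h1 : ∀ T ∈ Fam ×ˢ Fam, prG V p (patternEvent
        (F ∪ (starEdges y T.1 ∪ starEdges y' T.2))
        (starEdges y (W \ T.1) ∪ starEdges y' (W \ T.2))) =
        (p : ℝ) ^ F.card * (((p : ℝ) ^ T.1.card * (1 - p : ℝ) ^ (W \ T.1).card) *
          ((p : ℝ) ^ T.2.card * (1 - p : ℝ) ^ (W \ T.2).card)) := by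
      rintro ⟨T, T'⟩ hT
      obtain ⟨hT, hT'⟩ := Finset.mem_product.1 hT
      simp only at hT hT' ⊢
      have hs := hTW T hT
      have hs' := hTW T' hT'
      have n1 : ∀ X ⊆ W, y ∉ X := fun X hX h => hy (hX h)
      have n2 : ∀ X ⊆ W, y' ∉ X := fun X hX h => hy' (hX h)
      have dF : ∀ z, ∀ X ⊆ W, Disjoint F (starEdges z X) := fun z X hX =>
        disjoint_starEdges_of_forall hX hF
      have dyy : ∀ X ⊆ W, ∀ X' ⊆ W, Disjoint (starEdges y X) (starEdges y' X') :=
        fun X hX X' hX' => starEdges_disjoint_of_ne hyy (n1 X' hX')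
      have sd : ∀ X : Finset V, W \ X ⊆ W := fun X => Finset.sdiff_subset
      rw [prG_patternEvent]
      · rw [Finset.card_union_of_disjoint (Finset.disjoint_union_right.2
          ⟨dF y _ hs, dF y' _ hs'⟩), Finset.card_union_of_disjoint (dyy _ hs _ hs'),
          Finset.card_union_of_disjoint (dyy _ (sd _) _ (sd _)), card_starEdges, card_starEdges,
          card_starEdges, card_starEdges, pow_add, pow_add, pow_add]
        ring
      · simp only [Finset.disjoint_union_left, Finset.disjoint_union_right]
        exact ⟨⟨dF _ _ (sd _), starEdges_disjoint_of_disjoint Finset.disjoint_sdiff,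
          (dyy _ (sd _) _ hs').symm⟩, dF _ _ (sd _), dyy _ hs _ (sd _),
          starEdges_disjoint_of_disjoint Finset.disjoint_sdiff⟩
      · intro e he
        simp only [Finset.mem_union] at he
        rcases he with he | he | he
        · exact hFd e he
        · exact starEdges_not_isDiag (n1 _ hs) e he
        · exact starEdges_not_isDiag (n2 _ hs') e he
      · intro e he
        simp only [Finset.mem_union] at he
        rcases he with he | he
        · exact starEdges_not_isDiag (n1 _ (sd _)) e he
        · exact starEdges_not_isDiag (n2 _ (sd _)) e he
    rw [Finset.sum_congr rfl h1, ← Finset.mul_sum, sq,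
      ← Finset.sum_mul_sum Fam Fam (fun T => (p : ℝ) ^ T.card * (1 - p : ℝ) ^ (W \ T).card)
        (fun T => (p : ℝ) ^ T.card * (1 - p : ℝ) ^ (W \ T).card) |>.trans
        (Finset.sum_product' Fam Fam _).symm]
    have h2 := sum_star_le W j p.2.1 p.2.2 hL
    have h3 : (0 : ℝ) ≤ 1 - p := by linarith [p.2.2]
    refine mul_le_mul_of_nonneg_left (mul_le_mul h2 h2 ?_ (lowDegBound_nonneg hL))
      (pow_nonneg p.2.1 _)
    exact Finset.sum_nonneg fun T _ => mul_nonneg (pow_nonneg p.2.1 _) (pow_nonneg h3 _)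

/-- Two large sets without an edge between them. -/
lemma prG_not_joined_le (n m : ℕ) (p : I) (hm : 0 < m) :
    prG (Fin n) p {G | ∃ X Y : Finset (Fin n), Disjoint X Y ∧ m ≤ X.card ∧ m ≤ Y.card ∧
      ∀ x ∈ X, ∀ y ∈ Y, ¬ G.Adj x y} ≤
      ((Real.exp 1 * n / m) ^ 2 * Real.exp (-(p * m))) ^ m := by
  set Fam := ((Finset.univ : Finset (Fin n)).powersetCard m ×ˢ
    (Finset.univ : Finset (Fin n)).powersetCard m).filter fun X => Disjoint X.1 X.2 with hFam
  let B : Finset (Fin n) × Finset (Fin n) → Finset (Sym2 (Fin n)) := fun X =>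
    (X.1 ×ˢ X.2).image fun e => s(e.1, e.2)
  refine (prG_le_sum p Fam (fun X => patternEvent ∅ (B X)) ?_).trans ?_
  · rintro G ⟨X, Y, hXY, hX, hY, h⟩
    obtain ⟨X', hX', hXc⟩ := Finset.exists_subset_card_eq hX
    obtain ⟨Y', hY', hYc⟩ := Finset.exists_subset_card_eq hY
    refine ⟨(X', Y'), ?_, by simp, ?_⟩
    · simp only [hFam, Finset.mem_filter, Finset.mem_product, Finset.mem_powersetCard,
        Finset.subset_univ, true_and]
      exact ⟨⟨hXc, hYc⟩, (hXY.mono_left hX').mono_right hY'⟩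
    · intro e he
      obtain ⟨⟨x, y⟩, hxy, rfl⟩ := Finset.mem_image.1 he
      rw [Finset.mem_product] at hxy
      exact h x (hX' hxy.1) y (hY' hxy.2)
  · have hp1 : (0 : ℝ) ≤ 1 - p := by linarith [p.2.2]
    have h1 : ∀ X ∈ Fam, prG (Fin n) p (patternEvent ∅ (B X)) ≤ Real.exp (-(p * m)) ^ m := by
      rintro ⟨X, Y⟩ hX
      simp only [hFam, Finset.mem_filter, Finset.mem_product, Finset.mem_powersetCard,
        Finset.subset_univ, true_and] at hX
      obtain ⟨⟨hXc, hYc⟩, hXY⟩ := hX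
      rw [Finset.disjoint_left] at hXY
      have hBc : (B (X, Y)).card = m * m := by
        rw [Finset.card_image_of_injOn, Finset.card_product, hXc, hYc]
        rintro ⟨x, y⟩ h ⟨x', y'⟩ h' he
        simp only [Finset.coe_product, Set.mem_prod, Finset.mem_coe] at h h'
        rw [Sym2.eq_iff] at he
        rcases he with ⟨h1, h2⟩ | ⟨h1, h2⟩
        · exact Prod.ext h1 h2
        · simp only at h1 h2
          exact absurd h'.2 (h1 ▸ hXY h.1)
      rw [prG_patternEvent p (by simp) (by simp), hBc, Finset.card_empty, pow_zero, one_mul,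
        pow_mul]
      · refine pow_le_pow_left₀ (by positivity) ?_ _
        calc (1 - p : ℝ) ^ m ≤ Real.exp (-p) ^ m :=
              pow_le_pow_left₀ hp1 (by have := Real.add_one_le_exp (-(p : ℝ)); linarith) _
          _ = _ := by rw [← Real.exp_nat_mul]; congr 1; ring
      · intro e he
        obtain ⟨⟨x, y⟩, hxy, rfl⟩ := Finset.mem_image.1 he
        rw [Finset.mem_product] at hxy
        rw [Sym2.mk_isDiag_iff]
        exact fun h => hXY hxy.1 (show x ∈ Y from (show x = y from h) ▸ hxy.2)
    refine (Finset.sum_le_card_nsmul _ _ _ h1).trans ?_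
    rw [nsmul_eq_mul, mul_pow]
    refine mul_le_mul_of_nonneg_right ?_ (by positivity)
    have h2 : Fam.card ≤ n.choose m * n.choose m := by
      refine (Finset.card_filter_le _ _).trans ?_
      rw [Finset.card_product, Finset.card_powersetCard, Finset.card_univ, Fintype.card_fin]
    have h3 := choose_le_exp_pow n m hm
    calc (Fam.card : ℝ) ≤ n.choose m * n.choose m := by exact_mod_cast h2
      _ ≤ (Real.exp 1 * n / m) ^ m * (Real.exp 1 * n / m) ^ m := by gcongr
      _ = _ := by ring

/-- Small sets that span many edges. -/
lemma prG_not_sparse_le (n M r : ℕ) (p : I) (hr : 0 < r) :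
    prG (Fin n) p {G | ∃ X : Finset (Fin n), X.Nonempty ∧ X.card ≤ M ∧
      ∃ F : Finset (Sym2 (Fin n)), (∀ e ∈ F, e ∈ G.edgeSet ∧ ∀ v ∈ e, v ∈ X) ∧
        r * X.card ≤ F.card} ≤
      ∑ x ∈ Finset.Icc 1 M, ((Real.exp 1 * n / x) * (Real.exp 1 * x * p / r) ^ r) ^ x := by
  have hr' : (0 : ℝ) < r := by exact_mod_cast hr
  have hp0 : (0 : ℝ) ≤ p := p.2.1
  let inner : Finset (Fin n) → Finset (Sym2 (Fin n)) := fun X =>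
    ((X ×ˢ X).image fun e => s(e.1, e.2)).filter fun e => ¬ e.IsDiag
  have hinner : ∀ X, (inner X).card ≤ X.card * X.card := fun X =>
    (Finset.card_filter_le _ _).trans (Finset.card_image_le.trans (Finset.card_product _ _).le)
  let Fam : Finset (Σ _ : ℕ, Σ _ : Finset (Fin n), Finset (Sym2 (Fin n))) :=
    (Finset.Icc 1 M).sigma fun x => (Finset.univ.powersetCard x).sigma fun X =>
      (inner X).powersetCard (r * x)
  refine (prG_le_sum p Fam (fun X => patternEvent X.2.2 ∅) ?_).trans ?_
  · rintro G ⟨X, hX, hXM, F, hF, hFc⟩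
    obtain ⟨F', hF', hFc'⟩ := Finset.exists_subset_card_eq hFc
    refine ⟨⟨X.card, X, F'⟩, ?_, fun e he => (hF e (hF' he)).1, by simp⟩
    simp only [Fam, Finset.mem_sigma, Finset.mem_Icc, Finset.mem_powersetCard, Finset.subset_univ,
      true_and, and_true]
    refine ⟨⟨Finset.card_pos.2 hX, hXM⟩, ?_, hFc'⟩
    intro e he
    obtain ⟨h1, h2⟩ := hF e (hF' he)
    refine Finset.mem_filter.2 ⟨?_, G.not_isDiag_of_mem_edgeSet h1⟩
    induction e with
    | h x y => exact Finset.mem_image.2 ⟨(x, y), Finset.mem_product.2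
        ⟨h2 x (by simp), h2 y (by simp)⟩, rfl⟩
  · rw [Finset.sum_sigma]
    refine Finset.sum_le_sum fun x hx => ?_
    have hx0 : 0 < x := (Finset.mem_Icc.1 hx).1
    have hx' : (0 : ℝ) < x := by exact_mod_cast hx0
    rw [Finset.sum_sigma, mul_pow]
    have h1 : ∀ X ∈ (Finset.univ : Finset (Fin n)).powersetCard x,
        ∑ F ∈ (inner X).powersetCard (r * x), prG (Fin n) p (patternEvent F ∅) ≤
          ((Real.exp 1 * x * p / r) ^ r) ^ x := by
      intro X hX
      have hXc := (Finset.mem_powersetCard.1 hX).2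
      have h2 : ∀ F ∈ (inner X).powersetCard (r * x),
          prG (Fin n) p (patternEvent F ∅) = (p : ℝ) ^ (r * x) := by
        intro F hF
        obtain ⟨hFs, hFc⟩ := Finset.mem_powersetCard.1 hF
        rw [prG_patternEvent p (by simp) (fun e he => (Finset.mem_filter.1 (hFs he)).2) (by simp),
          hFc, Finset.card_empty, pow_zero, mul_one]
      rw [Finset.sum_congr rfl h2, Finset.sum_const, Finset.card_powersetCard, nsmul_eq_mul]
      have h3 := choose_le_exp_pow (inner X).card (r * x) (by positivity)
      have h4 : ((inner X).card : ℝ) ≤ x * x := by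
        have := hinner X
        rw [hXc] at this
        exact_mod_cast this
      calc ((inner X).card.choose (r * x) : ℝ) * p ^ (r * x)
          ≤ (Real.exp 1 * (inner X).card / (r * x : ℕ)) ^ (r * x) * p ^ (r * x) := by gcongr
        _ ≤ (Real.exp 1 * (x * x) / (r * x : ℕ)) ^ (r * x) * p ^ (r * x) := by gcongr
        _ = _ := by
            rw [← mul_pow, ← pow_mul]
            congr 1
            push_cast
            field_simp
    refine (Finset.sum_le_sum h1).trans ?_
    rw [Finset.sum_const, Finset.card_powersetCard, Finset.card_univ, Fintype.card_fin,
      nsmul_eq_mul]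
    exact mul_le_mul_of_nonneg_right (choose_le_exp_pow n x hx0) (by positivity)

end FirstMoment

/-! ### The probability that the random graph is typical. -/

section TypicalProbability

open MeasureTheory ProbabilityTheory unitInterval

variable {n s k : ℕ}

lemma card_smallVerts_inter_le {G : SimpleGraph (Fin n)} {y : Fin n} (hy : y ∈ smallVerts G s k)
    (X : Finset (Fin n)) : (nbr G {y} ∩ (firstVerts n s ∪ X)ᶜ).card ≤ k := by
  refine (Finset.card_le_card ?_).trans (mem_smallVerts.1 hy).le
  intro w hw
  rw [Finset.mem_inter, Finset.mem_compl, Finset.mem_union, not_or] at hw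
  exact Finset.mem_sdiff.2 ⟨hw.1, hw.2.1⟩

lemma le_card_compl (X : Finset (Fin n)) (c : ℕ) (hX : X.card ≤ c) :
    (n : ℝ) - s - c ≤ ((firstVerts n s ∪ X)ᶜ).card := by
  have h1 := Finset.card_union_le (firstVerts n s) X
  have h2 := card_firstVerts_le (n := n) (s := s)
  have h3 := Finset.card_compl_add_card (firstVerts n s ∪ X)
  rw [Fintype.card_fin] at h3
  have : n ≤ ((firstVerts n s ∪ X)ᶜ).card + (s + c) := by omega
  have : (n : ℝ) ≤ ((firstVerts n s ∪ X)ᶜ).card + (s + c) := by exact_mod_cast this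
  linarith

/-- Neighbours inside `X` are ignored, which separates the low degrees from the edges of `F`. The
forbidden configurations have at most five vertices, whence the 5. -/
lemma prG_two_small_le (p : I) (X : Finset (Fin n)) (hX : X.card ≤ 5) (F : Finset (Sym2 (Fin n)))
    (hFd : ∀ e ∈ F, ¬ e.IsDiag) (hFX : ∀ e ∈ F, ∀ v ∈ e, v ∈ X) {y y' : Fin n} (hy : y ∈ X)
    (hy' : y' ∈ X) (hyy : y ≠ y') {L : ℝ} (hL : 1 ≤ L) :
    prG (Fin n) p {G | (∀ e ∈ F, e ∈ G.edgeSet) ∧ y ∈ smallVerts G s k ∧ y' ∈ smallVerts G s k} ≤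
      (p : ℝ) ^ F.card * lowDegBound p L ((n : ℝ) - s - 5) k ^ 2 := by
  refine (prG_mono p ?_).trans ((prG_two_low_degrees p F hFd hyy (firstVerts n s ∪ X)ᶜ
    (by simp [hy]) (by simp [hy']) ?_ k hL).trans ?_)
  · intro G hG
    exact ⟨hG.1, card_smallVerts_inter_le hG.2.1 X, card_smallVerts_inter_le hG.2.2 X⟩
  · intro e he z hz hze
    simp only [Finset.mem_compl, Finset.mem_union, not_or] at hz
    exact hz.2 (hFX e he z hze)
  · have := lowDegBound_anti (p := p) (j := k) p.2.1 hL (le_card_compl (s := s) X 5 hX)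
    have h0 := lowDegBound_nonneg (p := p) (w := ((firstVerts n s ∪ X)ᶜ).card) (j := k) hL
    refine mul_le_mul_of_nonneg_left (pow_le_pow_left₀ h0 (by exact_mod_cast this) 2)
      (pow_nonneg p.2.1 _)

lemma prG_one_small_le (p : I) (X : Finset (Fin n)) (hX : X.card ≤ 5) (F : Finset (Sym2 (Fin n)))
    (hFd : ∀ e ∈ F, ¬ e.IsDiag) (hFX : ∀ e ∈ F, ∀ v ∈ e, v ∈ X) {y : Fin n} (hy : y ∈ X)
    {L : ℝ} (hL : 1 ≤ L) :
    prG (Fin n) p {G | (∀ e ∈ F, e ∈ G.edgeSet) ∧ y ∈ smallVerts G s k} ≤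
      (p : ℝ) ^ F.card * lowDegBound p L ((n : ℝ) - s - 5) k := by
  refine (prG_mono p ?_).trans ((prG_low_degree p F hFd y (firstVerts n s ∪ X)ᶜ
    (by simp [hy]) ?_ k hL).trans ?_)
  · intro G hG
    exact ⟨hG.1, card_smallVerts_inter_le hG.2 X⟩
  · intro e he z hz hze
    simp only [Finset.mem_compl, Finset.mem_union, not_or] at hz
    exact hz.2 (hFX e he z hze)
  · have := lowDegBound_anti (p := p) (j := k) p.2.1 hL (le_card_compl (s := s) X 5 hX)
    exact mul_le_mul_of_nonneg_left (by exact_mod_cast this) (pow_nonneg p.2.1 _)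

lemma prG_small_adj_le (p : I) {L : ℝ} (hL : 1 ≤ L) :
    prG (Fin n) p {G | ∃ u ∈ smallVerts G s k, ∃ v ∈ smallVerts G s k, G.Adj u v} ≤
      (n : ℝ) ^ 2 * (p * lowDegBound p L ((n : ℝ) - s - 5) k ^ 2) := by
  refine (prG_le_sum p (Finset.univ.filter fun x : Fin n × Fin n => x.1 ≠ x.2)
    (fun x => {G | (∀ e ∈ ({s(x.1, x.2)} : Finset (Sym2 (Fin n))), e ∈ G.edgeSet) ∧
      x.1 ∈ smallVerts G s k ∧ x.2 ∈ smallVerts G s k}) ?_).trans ?_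
  · rintro G ⟨u, hu, v, hv, huv⟩
    exact ⟨(u, v), by simpa using huv.ne, by simpa using huv, hu, hv⟩
  · refine (Finset.sum_le_card_nsmul _ _
      (p * lowDegBound p L ((n : ℝ) - s - 5) k ^ 2) ?_).trans ?_
    · rintro ⟨u, v⟩ huv
      have huv : u ≠ v := by simpa using huv
      have := prG_two_small_le (s := s) (k := k) p {u, v} (Finset.card_le_two.trans (by norm_num))
        {s(u, v)} (by simpa using huv) (by simp) (y := u) (y' := v) (by simp) (by simp) huv hL
      simpa using this
    · rw [nsmul_eq_mul]
      refine mul_le_mul_of_nonneg_right ?_ (mul_nonneg p.2.1 (sq_nonneg _))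
      have : (Finset.univ.filter fun x : Fin n × Fin n => x.1 ≠ x.2).card ≤ n ^ 2 := by
        refine (Finset.card_le_univ _).trans ?_
        simp [sq]
      exact_mod_cast this

lemma prG_small_common_le (p : I) {L : ℝ} (hL : 1 ≤ L) :
    prG (Fin n) p {G | ∃ u ∈ smallVerts G s k, ∃ v ∈ smallVerts G s k, u ≠ v ∧
      ∃ w, G.Adj u w ∧ G.Adj v w} ≤
      (n : ℝ) ^ 3 * ((p : ℝ) ^ 2 * lowDegBound p L ((n : ℝ) - s - 5) k ^ 2) := by
  refine (prG_le_sum p (Finset.univ.filter fun x : Fin n × Fin n × Fin n =>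
    [x.1, x.2.1, x.2.2].Nodup)
    (fun x => {G | (∀ e ∈ ({s(x.1, x.2.2), s(x.2.1, x.2.2)} : Finset (Sym2 (Fin n))),
      e ∈ G.edgeSet) ∧ x.1 ∈ smallVerts G s k ∧ x.2.1 ∈ smallVerts G s k}) ?_).trans ?_
  · rintro G ⟨u, hu, v, hv, huv, w, h1, h2⟩
    exact ⟨(u, v, w), by simpa using ⟨⟨huv, h1.ne⟩, h2.ne⟩, by simpa using ⟨h1, h2⟩, hu, hv⟩
  · refine (Finset.sum_le_card_nsmul _ _
      ((p : ℝ) ^ 2 * lowDegBound p L ((n : ℝ) - s - 5) k ^ 2) ?_).trans ?_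
    · rintro ⟨u, v, w⟩ h
      simp only [Finset.mem_filter, Finset.mem_univ, true_and, List.nodup_cons, List.mem_cons,
        List.not_mem_nil, or_false, not_or, List.nodup_nil, not_false_eq_true, and_true] at h
      obtain ⟨⟨huv, huw⟩, hvw⟩ := h
      have := prG_two_small_le (s := s) (k := k) p {u, v, w}
        (Finset.card_le_three.trans (by norm_num))
        {s(u, w), s(v, w)} (by simp [huw, hvw]) (by simp) (y := u) (y' := v) (by simp) (by simp)
        huv hL
      rwa [Finset.card_pair (by simp [huv, huw])] at this
    · rw [nsmul_eq_mul]
      refine mul_le_mul_of_nonneg_right ?_ (mul_nonneg (pow_nonneg p.2.1 _) (sq_nonneg _))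
      have : (Finset.univ.filter fun x : Fin n × Fin n × Fin n =>
          [x.1, x.2.1, x.2.2].Nodup).card ≤ n ^ 3 := by
        refine (Finset.card_le_univ _).trans ?_
        simp only [Fintype.card_prod, Fintype.card_fin]
        exact le_of_eq (by ring)
      exact_mod_cast this

lemma prG_small_path_le (p : I) {L : ℝ} (hL : 1 ≤ L) :
    prG (Fin n) p {G | ∃ v ∈ smallVerts G s k, ∃ v' ∈ smallVerts G s k, ∃ w u w',
      [v, w, u, w', v'].Nodup ∧ G.Adj v w ∧ G.Adj w u ∧ G.Adj u w' ∧ G.Adj w' v'} ≤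
      (n : ℝ) ^ 5 * ((p : ℝ) ^ 4 * lowDegBound p L ((n : ℝ) - s - 5) k ^ 2) := by
  refine (prG_le_sum p (Finset.univ.filter fun x : Fin n × Fin n × Fin n × Fin n × Fin n =>
    [x.1, x.2.1, x.2.2.1, x.2.2.2.1, x.2.2.2.2].Nodup)
    (fun x => {G | (∀ e ∈ ({s(x.1, x.2.1), s(x.2.1, x.2.2.1), s(x.2.2.1, x.2.2.2.1),
      s(x.2.2.2.1, x.2.2.2.2)} : Finset (Sym2 (Fin n))),
      e ∈ G.edgeSet) ∧ x.1 ∈ smallVerts G s k ∧ x.2.2.2.2 ∈ smallVerts G s k}) ?_).trans ?_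
  · rintro G ⟨v, hv, v', hv', w, u, w', hnd, h1, h2, h3, h4⟩
    refine ⟨(v, w, u, w', v'), by simpa only [Finset.mem_filter, Finset.mem_univ, true_and]
      using hnd, ?_, hv, hv'⟩
    simpa using ⟨h1, h2, h3, h4⟩
  · refine (Finset.sum_le_card_nsmul _ _
      ((p : ℝ) ^ 4 * lowDegBound p L ((n : ℝ) - s - 5) k ^ 2) ?_).trans ?_
    · rintro ⟨v, w, u, w', v'⟩ h
      simp only [Finset.mem_filter, Finset.mem_univ, true_and, List.nodup_cons, List.mem_cons,
        List.not_mem_nil, or_false, not_or, List.nodup_nil, not_false_eq_true, and_true] at h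
      obtain ⟨⟨a1, a2, a3, a4⟩, ⟨b1, b2, b3⟩, ⟨c1, c2⟩, d1⟩ := h
      have := prG_two_small_le (s := s) (k := k) p {v, w, u, w', v'} Finset.card_le_five
        {s(v, w), s(w, u), s(u, w'), s(w', v')} (by simp [a1, b1, c1, d1]) (by simp)
        (y := v) (y' := v') (by simp) (by simp) a4 hL
      have hc : ({s(v, w), s(w, u), s(u, w'), s(w', v')} : Finset (Sym2 (Fin n))).card = 4 := by
        rw [Finset.card_insert_of_notMem, Finset.card_insert_of_notMem,
          Finset.card_insert_of_notMem, Finset.card_singleton]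
        · simp [c1, c2]
        · simp [b1, b2, b3]
        · simp [a1, a2, a3, a4]
      rwa [hc] at this
    · rw [nsmul_eq_mul]
      refine mul_le_mul_of_nonneg_right ?_ (mul_nonneg (pow_nonneg p.2.1 _) (sq_nonneg _))
      have : (Finset.univ.filter fun x : Fin n × Fin n × Fin n × Fin n × Fin n =>
          [x.1, x.2.1, x.2.2.1, x.2.2.2.1, x.2.2.2.2].Nodup).card ≤ n ^ 5 := by
        refine (Finset.card_le_univ _).trans ?_
        simp only [Fintype.card_prod, Fintype.card_fin]
        exact le_of_eq (by ring)
      exact_mod_cast this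

lemma prG_small_cycle_le (p : I) {L : ℝ} (hL : 1 ≤ L) :
    prG (Fin n) p {G | ∃ v ∈ smallVerts G s k, ∃ w u w',
      [v, w, u, w'].Nodup ∧ G.Adj v w ∧ G.Adj w u ∧ G.Adj u w' ∧ G.Adj w' v} ≤
      (n : ℝ) ^ 4 * ((p : ℝ) ^ 4 * lowDegBound p L ((n : ℝ) - s - 5) k) := by
  refine (prG_le_sum p (Finset.univ.filter fun x : Fin n × Fin n × Fin n × Fin n =>
    [x.1, x.2.1, x.2.2.1, x.2.2.2].Nodup)
    (fun x => {G | (∀ e ∈ ({s(x.1, x.2.1), s(x.2.1, x.2.2.1), s(x.2.2.1, x.2.2.2),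
      s(x.2.2.2, x.1)} : Finset (Sym2 (Fin n))),
      e ∈ G.edgeSet) ∧ x.1 ∈ smallVerts G s k}) ?_).trans ?_
  · rintro G ⟨v, hv, w, u, w', hnd, h1, h2, h3, h4⟩
    refine ⟨(v, w, u, w'), by simpa only [Finset.mem_filter, Finset.mem_univ, true_and]
      using hnd, ?_, hv⟩
    simpa using ⟨h1, h2, h3, h4⟩
  · refine (Finset.sum_le_card_nsmul _ _
      ((p : ℝ) ^ 4 * lowDegBound p L ((n : ℝ) - s - 5) k) ?_).trans ?_
    · rintro ⟨v, w, u, w'⟩ h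
      simp only [Finset.mem_filter, Finset.mem_univ, true_and, List.nodup_cons, List.mem_cons,
        List.not_mem_nil, or_false, not_or, List.nodup_nil, not_false_eq_true, and_true] at h
      obtain ⟨⟨a1, a2, a3⟩, ⟨b1, b2⟩, c1⟩ := h
      have := prG_one_small_le (s := s) (k := k) p {v, w, u, w'}
        (Finset.card_le_four.trans (by norm_num))
        {s(v, w), s(w, u), s(u, w'), s(w', v)} (by simp [a1, b1, c1, Ne.symm a3]) (by simp)
        (y := v) (by simp) hL
      have hc : ({s(v, w), s(w, u), s(u, w'), s(w', v)} : Finset (Sym2 (Fin n))).card = 4 := by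
        rw [Finset.card_insert_of_notMem, Finset.card_insert_of_notMem,
          Finset.card_insert_of_notMem, Finset.card_singleton]
        · simp [c1, Ne.symm a2]
        · simp [b1, b2, Ne.symm a1]
        · simp [a1, a2, a3, b2]
      rwa [hc] at this
    · rw [nsmul_eq_mul]
      refine mul_le_mul_of_nonneg_right ?_
        (mul_nonneg (pow_nonneg p.2.1 _) (lowDegBound_nonneg hL))
      have : (Finset.univ.filter fun x : Fin n × Fin n × Fin n × Fin n =>
          [x.1, x.2.1, x.2.2.1, x.2.2.2].Nodup).card ≤ n ^ 4 := by
        refine (Finset.card_le_univ _).trans ?_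
        simp only [Fintype.card_prod, Fintype.card_fin]
        exact le_of_eq (by ring)
      exact_mod_cast this

/-- Some vertex of `Y` has at most `j` neighbours outside the first `s` vertices. -/
lemma prG_exists_low_free_le (p : I) (Y : Finset (Fin n)) (j : ℕ) {L : ℝ} (hL : 1 ≤ L) :
    prG (Fin n) p {G | ∃ v ∈ Y, (freeNbr G s v).card ≤ j} ≤
      Y.card * lowDegBound p L ((n : ℝ) - s - 1) j := by
  refine (prG_le_sum p Y (fun v => {G | (∀ e ∈ (∅ : Finset (Sym2 (Fin n))), e ∈ G.edgeSet) ∧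
    (nbr G {v} ∩ (firstVerts n s ∪ {v})ᶜ).card ≤ j}) ?_).trans ?_
  · rintro G ⟨v, hv, h⟩
    refine ⟨v, hv, by simp, (Finset.card_le_card ?_).trans h⟩
    intro w hw
    rw [Finset.mem_inter, Finset.mem_compl, Finset.mem_union, not_or] at hw
    exact Finset.mem_sdiff.2 ⟨hw.1, hw.2.1⟩
  · rw [← nsmul_eq_mul]
    refine Finset.sum_le_card_nsmul _ _ _ fun v _ => ?_
    refine (prG_low_degree p ∅ (by simp) v (firstVerts n s ∪ {v})ᶜ (by simp) (by simp) j hL).trans ?_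
    rw [Finset.card_empty, pow_zero, one_mul]
    have := le_card_compl (s := s) {v} 1 (by simp)
    exact lowDegBound_anti p.2.1 hL (by exact_mod_cast this)

/-- An explicit bound for the probability that the random graph is not typical. -/
theorem prG_not_typical_le {m D : ℕ} (p : I) (hm : 0 < m) (hD : 0 < D) {L L' : ℝ} (hL : 1 ≤ L)
    (hL' : 1 ≤ L') :
    prG (Fin n) p {G | ¬ TypicalGraph G s k m D} ≤
      ((Real.exp 1 * n / m) ^ 2 * Real.exp (-(p * m))) ^ m +
      (∑ x ∈ Finset.Icc 1 ((D + 2) * (2 * m)),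
        ((Real.exp 1 * n / x) * (Real.exp 1 * x * p / (D ^ 4 : ℕ)) ^ (D ^ 4)) ^ x +
      ((n : ℝ) ^ 2 * (p * lowDegBound p L ((n : ℝ) - s - 5) k ^ 2) +
      ((n : ℝ) ^ 3 * ((p : ℝ) ^ 2 * lowDegBound p L ((n : ℝ) - s - 5) k ^ 2) +
      ((n : ℝ) ^ 5 * ((p : ℝ) ^ 4 * lowDegBound p L ((n : ℝ) - s - 5) k ^ 2) +
      ((n : ℝ) ^ 4 * ((p : ℝ) ^ 4 * lowDegBound p L ((n : ℝ) - s - 5) k) +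
      (n * lowDegBound p L' ((n : ℝ) - 1) 1 +
      (n * lowDegBound p L' ((n : ℝ) - s - 1) 0 +
      s * lowDegBound p L' ((n : ℝ) - s - 1) 1))))))) := by
  have e1 := prG_not_joined_le n m p hm
  have e2 := prG_not_sparse_le n ((D + 2) * (2 * m)) (D ^ 4) p (by positivity)
  have e3 := prG_small_adj_le (n := n) (s := s) (k := k) p hL
  have e4 := prG_small_common_le (n := n) (s := s) (k := k) p hL
  have e5 := prG_small_path_le (n := n) (s := s) (k := k) p hL
  have e6 := prG_small_cycle_le (n := n) (s := s) (k := k) p hL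
  -- With `s := 0` there are no special vertices, and the free degree is the degree.
  have e7 := prG_exists_low_free_le (n := n) (s := 0) p Finset.univ 1 hL'
  have e8 := prG_exists_low_free_le (n := n) (s := s) p Finset.univ 0 hL'
  have e9 := prG_exists_low_free_le (n := n) (s := s) p (firstVerts n s) 1 hL'
  rw [Finset.card_univ, Fintype.card_fin] at e7 e8
  have e9' := e9.trans (mul_le_mul_of_nonneg_right
    (by exact_mod_cast card_firstVerts_le (n := n) (s := s) : ((firstVerts n s).card : ℝ) ≤ s)
    (lowDegBound_nonneg hL'))
  simp only [Nat.cast_zero, sub_zero] at e7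
  set B1 := {G : SimpleGraph (Fin n) | ∃ X Y : Finset (Fin n), Disjoint X Y ∧ m ≤ X.card ∧
    m ≤ Y.card ∧ ∀ x ∈ X, ∀ y ∈ Y, ¬ G.Adj x y} with hB1
  set B2 := {G : SimpleGraph (Fin n) | ∃ X : Finset (Fin n), X.Nonempty ∧
    X.card ≤ (D + 2) * (2 * m) ∧ ∃ F : Finset (Sym2 (Fin n)),
      (∀ e ∈ F, e ∈ G.edgeSet ∧ ∀ v ∈ e, v ∈ X) ∧ D ^ 4 * X.card ≤ F.card} with hB2
  set B3 := {G : SimpleGraph (Fin n) | ∃ u ∈ smallVerts G s k, ∃ v ∈ smallVerts G s k, G.Adj u v}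
    with hB3
  set B4 := {G : SimpleGraph (Fin n) | ∃ u ∈ smallVerts G s k, ∃ v ∈ smallVerts G s k, u ≠ v ∧
      ∃ w, G.Adj u w ∧ G.Adj v w} with hB4
  set B5 := {G : SimpleGraph (Fin n) | ∃ v ∈ smallVerts G s k, ∃ v' ∈ smallVerts G s k,
    ∃ w u w', [v, w, u, w', v'].Nodup ∧ G.Adj v w ∧ G.Adj w u ∧ G.Adj u w' ∧ G.Adj w' v'} with hB5
  set B6 := {G : SimpleGraph (Fin n) | ∃ v ∈ smallVerts G s k, ∃ w u w',
      [v, w, u, w'].Nodup ∧ G.Adj v w ∧ G.Adj w u ∧ G.Adj u w' ∧ G.Adj w' v} with hB6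
  set B7 := {G : SimpleGraph (Fin n) | ∃ v ∈ Finset.univ, (freeNbr G 0 v).card ≤ 1} with hB7
  set B8 := {G : SimpleGraph (Fin n) | ∃ v ∈ Finset.univ, (freeNbr G s v).card ≤ 0} with hB8
  set B9 := {G : SimpleGraph (Fin n) | ∃ v ∈ firstVerts n s, (freeNbr G s v).card ≤ 1} with hB9
  have hsub : {G | ¬ TypicalGraph G s k m D} ⊆
      B1 ∪ (B2 ∪ (B3 ∪ (B4 ∪ (B5 ∪ (B6 ∪ (B7 ∪ (B8 ∪ B9))))))) := by
    intro G hG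
    by_contra hcon
    simp only [Set.mem_union, not_or] at hcon
    obtain ⟨b1, b2, b3, b4, b5, b6, b7, b8, b9⟩ := hcon
    apply hG
    simp only [hB1, hB2, hB3, hB4, hB5, hB6, hB7, hB8, hB9, Set.mem_ofPred_eq] at b1 b2 b3 b4 b5 b6 b7 b8 b9
    refine ⟨?_, ?_, ?_, ?_, ?_, ?_, ?_, ?_, ?_⟩
    · intro X Y hXY hX hY
      by_contra h
      push Not at h
      exact b1 ⟨X, Y, hXY, hX, hY, h⟩
    · intro X hX hXc F hF
      by_contra h
      exact b2 ⟨X, hX, hXc, F, hF, not_lt.1 h⟩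
    · exact fun u hu v hv h => b3 ⟨u, hu, v, hv, h⟩
    · exact fun u hu v hv huv w h h' => b4 ⟨u, hu, v, hv, huv, w, h, h'⟩
    · exact fun v hv v' hv' w u w' hn h1 h2 h3 h4 =>
        b5 ⟨v, hv, v', hv', w, u, w', hn, h1, h2, h3, h4⟩
    · exact fun v hv w u w' hn h1 h2 h3 h4 => b6 ⟨v, hv, w, u, w', hn, h1, h2, h3, h4⟩
    · intro v
      by_contra h
      refine b7 ⟨v, Finset.mem_univ _, (Finset.card_le_card Finset.sdiff_subset).trans (by omega)⟩
    · intro v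
      by_contra h
      exact b8 ⟨v, Finset.mem_univ _, by omega⟩
    · intro v hv
      by_contra h
      exact b9 ⟨v, mem_firstVerts.2 hv, by omega⟩
  refine (prG_mono p hsub).trans ?_
  refine (prG_union_le p _ _).trans (add_le_add e1 ?_)
  refine (prG_union_le p _ _).trans (add_le_add e2 ?_)
  refine (prG_union_le p _ _).trans (add_le_add e3 ?_)
  refine (prG_union_le p _ _).trans (add_le_add e4 ?_)
  refine (prG_union_le p _ _).trans (add_le_add e5 ?_)
  refine (prG_union_le p _ _).trans (add_le_add e6 ?_)
  refine (prG_union_le p _ _).trans (add_le_add e7 ?_)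
  exact (prG_union_le p _ _).trans (add_le_add e8 e9')

end TypicalProbability

/-! ### Choice of parameters and numerical estimates. -/

section Numerics

open unitInterval

lemma HasOrderedHamiltonCycle.mono {n s t : ℕ} {G : SimpleGraph (Fin n)} (hst : s ≤ t)
    (h : HasOrderedHamiltonCycle G t) : HasOrderedHamiltonCycle G s := by
  obtain ⟨a, c, hc, ho⟩ := h
  exact ⟨a, c, hc, fun u v huv hv => ho u v huv (hv.trans_le hst)⟩

/-- A two-round exposure bound: the first round yields a typical graph, the second one closes
the cycle. -/
theorem prG_not_ordered_le {n s k m D K h w : ℕ} {p p₁ p₂ : I}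
    (hpp : (1 - p : ℝ) = (1 - p₁) * (1 - p₂)) (hk : 2 * D ^ 4 * (D + 2) + 1 ≤ k) (hD : 3 ≤ D)
    (hm : 1 ≤ m) (hs : 0 < s) (hsn : s ≤ n) (hw : 2 * m * D + 3 * m + w < n)
    (hmk : 2 * m + s + m * k ≤ n) (hmh : m ≤ D ^ h)
    (hsw : s + m + (2 + s * (2 * h + 2)) + 4 * D ^ h ≤ w) (hmK : m ≤ K)
    (hK : 3 * K + 2 + m + s * (2 * h + 4) ≤ n) (hnK : (n : ℝ) / 9 ≤ K)
    (hpn : 324 * 7 ≤ (p₂ : ℝ) * n) :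
    prG (Fin n) p {G | HasOrderedHamiltonCycle G s}ᶜ ≤
      prG (Fin n) p₁ {G | ¬ TypicalGraph G s k m D} + Real.exp (-n) := by
  refine prG_compl_le_of_two_rounds hpp _ {G | TypicalGraph G s k m D} (Real.exp_pos _).le ?_
  intro G hG
  obtain ⟨Bst, hB⟩ := TypicalGraph.exists_stuck (K := K) (h := h) (w := w) hG hk hD hm hs hsn hw
    hmk hmh hsw hmK hK
  exact prG_stuck_le p₂ Bst (fun G₂ hG₂ => hB G₂ hG₂) hnK hpn

/-- The size, at scale `D`, of a set that is large enough to be joined to every other such set. -/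
def joinSize (n D : ℕ) : ℕ := n / D ^ 7 + 1

lemma lt_joinSize_mul {n D : ℕ} (hD : 1 ≤ D) : n < joinSize n D * D ^ 7 := by
  rw [joinSize, mul_comm]
  exact Nat.lt_mul_div_succ n (by positivity)

lemma joinSize_mul_le {n D : ℕ} (hn : D ^ 7 ≤ n) : joinSize n D * D ^ 7 ≤ 2 * n := by
  rw [joinSize, add_mul, one_mul, two_mul]
  exact add_le_add (Nat.div_mul_le_self _ _) hn

/-- The probability bound for the failure of typicality, as a function of the scale `D` and of the
surplus `t` of the expected degree. -/
noncomputable def failureBound (D t : ℝ) : ℝ :=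
  Real.exp 2 * D ^ 14 * Real.exp (-D) + 16 * Real.exp 2 * (D ^ 4 * Real.exp (-(D ^ 4 / 2))) +
    1024 * D ^ 32 * Real.exp (-(D ^ 8 / 2)) +
    (2 * Real.exp 2 * Real.exp (-t) + Real.exp 2 * D⁻¹ + Real.exp 2 * D⁻¹)

lemma tendsto_failureBound {ι : Type*} {l : Filter ι} {D t : ι → ℝ} (hD : Tendsto D l atTop)
    (ht : Tendsto t l atTop) : Tendsto (fun i => failureBound (D i) (t i)) l (𝓝 0) := by
  have key : ∀ a : ℕ, Tendsto (fun x : ℝ => x ^ a * Real.exp (-x)) atTop (𝓝 0) :=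
    fun a => Real.tendsto_pow_mul_exp_neg_atTop_nhds_zero a
  have h1 := ((key 14).comp hD).const_mul (Real.exp 2)
  have hD4 : Tendsto (fun i => D i ^ 4 / 2) l atTop :=
    ((tendsto_pow_atTop (by norm_num)).comp hD).atTop_div_const (by norm_num)
  have hD8 : Tendsto (fun i => D i ^ 8 / 2) l atTop :=
    ((tendsto_pow_atTop (by norm_num)).comp hD).atTop_div_const (by norm_num)
  have h2 := ((key 1).comp hD4).const_mul (32 * Real.exp 2)
  have h3 := ((key 4).comp hD8).const_mul (1024 * 16)
  have h4 := (Real.tendsto_exp_neg_atTop_nhds_zero.comp ht).const_mul (2 * Real.exp 2)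
  have h5 := (tendsto_inv_atTop_zero.comp hD).const_mul (Real.exp 2)
  have := ((h1.add h2).add h3).add ((h4.add h5).add h5)
  simp only [mul_zero, add_zero] at this
  refine this.congr fun i => ?_
  simp only [Function.comp_apply, failureBound]
  ring

/-- The choice of `m` gives `n / m ≤ D ^ 7` while `q m ≥ D`, so the exponential beats the square of
the binomial factor. -/
lemma joined_term_le {n m D : ℕ} {q : ℝ} (hD : 1 ≤ D) (hm : 1 ≤ m) (hnm : n ≤ m * D ^ 7)
    (hq : 0 ≤ q) (hqn : (D : ℝ) ^ 8 ≤ q * n)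
    (h1 : Real.exp 2 * (D : ℝ) ^ 14 * Real.exp (-D) ≤ 1) :
    ((Real.exp 1 * n / m) ^ 2 * Real.exp (-(q * m))) ^ m ≤
      Real.exp 2 * (D : ℝ) ^ 14 * Real.exp (-D) := by
  have hm' : (0 : ℝ) < m := by exact_mod_cast hm
  have hD' : (0 : ℝ) < D := by exact_mod_cast hD
  have hnm' : (n : ℝ) ≤ m * (D : ℝ) ^ 7 := by exact_mod_cast hnm
  have e2 : Real.exp 2 = Real.exp 1 ^ 2 := by rw [← Real.exp_nat_mul]; norm_num
  have hb : (Real.exp 1 * n / m) ^ 2 * Real.exp (-(q * m)) ≤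
      Real.exp 2 * (D : ℝ) ^ 14 * Real.exp (-D) := by
    have a1 : Real.exp 1 * n / m ≤ Real.exp 1 * (D : ℝ) ^ 7 := by
      rw [div_le_iff₀ hm', mul_assoc]
      gcongr; linarith
    have a2 : (D : ℝ) ≤ q * m := by
      have : (D : ℝ) * D ^ 7 ≤ (q * m) * D ^ 7 := by
        calc (D : ℝ) * D ^ 7 = D ^ 8 := by ring
          _ ≤ q * n := hqn
          _ ≤ q * (m * D ^ 7) := by gcongr
          _ = _ := by ring
      exact le_of_mul_le_mul_right this (by positivity)
    calc (Real.exp 1 * n / m) ^ 2 * Real.exp (-(q * m))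
        ≤ (Real.exp 1 * (D : ℝ) ^ 7) ^ 2 * Real.exp (-D) := by gcongr
      _ = _ := by rw [e2]; ring
  calc _ ≤ ((Real.exp 1 * n / m) ^ 2 * Real.exp (-(q * m))) ^ 1 :=
        pow_le_pow_of_le_one (by positivity) (hb.trans h1) hm
    _ ≤ _ := by rw [pow_one]; exact hb

lemma sum_Icc_pow_le {ρ : ℝ} (h0 : 0 ≤ ρ) (h1 : ρ ≤ 1 / 2) (M : ℕ) :
    ∑ x ∈ Finset.Icc 1 M, ρ ^ x ≤ 2 * ρ := by
  have h : ∀ M : ℕ, ∑ x ∈ Finset.Icc 1 M, ρ ^ x ≤ 2 * ρ - ρ * ρ ^ M * 2 := by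
    intro M
    induction M with
    | zero => simp; linarith
    | succ M ih =>
      rw [Finset.sum_Icc_succ_top (by omega), pow_succ]
      have : 0 ≤ ρ ^ M := by positivity
      nlinarith [mul_nonneg (mul_nonneg h0 this) (sub_nonneg.2 h1)]
  refine (h M).trans ?_
  have : 0 ≤ ρ ^ M := by positivity
  nlinarith [mul_nonneg h0 this]

/-- For the sizes in question the base `y` is at most `1/2`. One factor `y` cancels `n / x`; the
other `D ^ 4 - 1` factors give a geometric series with tiny ratio. -/
lemma sparse_term_le {n m D : ℕ} {q : ℝ} (hD : 100 ≤ D) (hn : 0 < n) (hnm : m * D ^ 7 ≤ 2 * n)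
    (hq : 0 ≤ q) (hqn : q * n ≤ 4 * (D : ℝ) ^ 8)
    (h1 : 8 * Real.exp 2 * ((D : ℝ) ^ 4 * Real.exp (-((D : ℝ) ^ 4 / 2))) ≤ 1 / 2) :
    ∑ x ∈ Finset.Icc 1 ((D + 2) * (2 * m)),
      ((Real.exp 1 * n / x) * (Real.exp 1 * x * q / (D ^ 4 : ℕ)) ^ (D ^ 4)) ^ x ≤
      16 * Real.exp 2 * ((D : ℝ) ^ 4 * Real.exp (-((D : ℝ) ^ 4 / 2))) := by
  set ρ := 8 * Real.exp 2 * ((D : ℝ) ^ 4 * Real.exp (-((D : ℝ) ^ 4 / 2))) with hρ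
  have hn' : (0 : ℝ) < n := by exact_mod_cast hn
  have hD' : (100 : ℝ) ≤ D := by exact_mod_cast hD
  have hDpos : (0 : ℝ) < D := by linarith
  have e2 : Real.exp 2 = Real.exp 1 ^ 2 := by rw [← Real.exp_nat_mul]; norm_num
  have he3 : Real.exp 1 ≤ 3 := by linarith [Real.exp_one_lt_d9]
  have hterm : ∀ x ∈ Finset.Icc 1 ((D + 2) * (2 * m)),
      ((Real.exp 1 * n / x) * (Real.exp 1 * x * q / (D ^ 4 : ℕ)) ^ (D ^ 4)) ^ x ≤ ρ ^ x := by
    intro x hx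
    obtain ⟨hx1, hx2⟩ := Finset.mem_Icc.1 hx
    have hxpos : (0 : ℝ) < x := by exact_mod_cast hx1
    refine pow_le_pow_left₀ (by positivity) ?_ _
    set y : ℝ := 4 * Real.exp 1 * (D : ℝ) ^ 4 * x / n with hy
    have hy0 : 0 < y := by positivity
    have a1 : Real.exp 1 * x * q / (D ^ 4 : ℕ) ≤ y := by
      rw [hy, div_le_div_iff₀ (by positivity) hn']
      push_cast
      calc Real.exp 1 * x * q * n = Real.exp 1 * x * (q * n) := by ring
        _ ≤ Real.exp 1 * x * (4 * (D : ℝ) ^ 8) := by gcongr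
        _ = _ := by ring
    have a2 : y ≤ 1 / 2 := by
      rw [hy, div_le_iff₀ hn']
      have b1 : (x : ℝ) ≤ 3 * D * m := by
        have : x ≤ 3 * D * m := hx2.trans (by nlinarith)
        exact_mod_cast this
      have b2 : (m : ℝ) * D ^ 7 ≤ 2 * n := by exact_mod_cast hnm
      have b3 : (D : ℝ) ^ 5 * m * 72 ≤ n := by
        have : (D : ℝ) ^ 5 * m * 10000 ≤ D ^ 5 * m * D ^ 2 := by
          gcongr; nlinarith
        nlinarith [this, b2, show (D : ℝ) ^ 5 * m * D ^ 2 = m * D ^ 7 by ring]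
      calc 4 * Real.exp 1 * (D : ℝ) ^ 4 * x ≤ 4 * 3 * (D : ℝ) ^ 4 * (3 * D * m) := by gcongr
        _ = (D : ℝ) ^ 5 * m * 36 := by ring
        _ ≤ _ := by linarith
    have hD4 : 1 ≤ D ^ 4 := Nat.one_le_pow _ _ (by omega)
    obtain ⟨r, hr⟩ : ∃ r, D ^ 4 = r + 1 := ⟨D ^ 4 - 1, by omega⟩
    have a3 : (1 / 2 : ℝ) ^ (D ^ 4) ≤ Real.exp (-((D : ℝ) ^ 4 / 2)) := by
      have c1 : (1 / 2 : ℝ) ≤ Real.exp (-(1 / 2)) := by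
        have := Real.add_one_le_exp (-(1 / 2) : ℝ); linarith
      calc (1 / 2 : ℝ) ^ (D ^ 4) ≤ Real.exp (-(1 / 2)) ^ (D ^ 4) := by gcongr
        _ = _ := by rw [← Real.exp_nat_mul]; congr 1; push_cast; ring
    calc (Real.exp 1 * n / x) * (Real.exp 1 * x * q / (D ^ 4 : ℕ)) ^ (D ^ 4)
        ≤ (Real.exp 1 * n / x) * y ^ (D ^ 4) := by gcongr
      _ = (Real.exp 1 * n / x) * y * y ^ r := by rw [hr, pow_succ]; ring
      _ = 4 * Real.exp 2 * (D : ℝ) ^ 4 * y ^ r := by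
          rw [hy, e2]; field_simp
      _ ≤ 4 * Real.exp 2 * (D : ℝ) ^ 4 * (1 / 2) ^ r := by gcongr
      _ = 8 * Real.exp 2 * (D : ℝ) ^ 4 * (1 / 2) ^ (D ^ 4) := by rw [hr, pow_succ]; ring
      _ ≤ 8 * Real.exp 2 * (D : ℝ) ^ 4 * Real.exp (-((D : ℝ) ^ 4 / 2)) := by gcongr
      _ = ρ := by rw [hρ]; ring
  refine (Finset.sum_le_sum hterm).trans ((sum_Icc_pow_le (by positivity) h1 _).trans ?_)
  rw [hρ]; linarith

/-- The weight `L = D` costs `D ^ (D ^ 6) ≤ exp (D ^ 7)` and a share `1 / D` of the exponent, each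
at most `log n / D` on the logarithmic scale. Ignoring the special vertices costs only `q s ≤ log
D`, so `3/4` of `log n` survives with room. -/
lemma lowDegBound_small_le {n s D : ℕ} {q : ℝ} (hD : 100 ≤ D)
    (hq1 : q ≤ 1) (hlog : (D : ℝ) ^ 8 ≤ Real.log n) (hqn : Real.log n ≤ q * n)
    (hqs : q * s ≤ Real.log D) :
    lowDegBound q D ((n : ℝ) - s - 5) (D ^ 6) ≤ Real.exp (-(3 / 4 * Real.log n)) := by
  have hD' : (100 : ℝ) ≤ D := by exact_mod_cast hD
  have hDpos : (0 : ℝ) < D := by linarith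
  have hlD : Real.log D ≤ D := (Real.log_le_self hDpos.le)
  set Lg := Real.log n with hLg
  have h8 : (D : ℝ) * 10000 ≤ D ^ 8 := by
    have : (D : ℝ) ^ 8 = D * (D ^ 2 * D ^ 5) := by ring
    rw [this]
    have : (1 : ℝ) ≤ D ^ 5 := one_le_pow₀ (by linarith)
    gcongr; nlinarith
  have h7 : (D : ℝ) ^ 7 ≤ Lg / D := by
    rw [le_div_iff₀ hDpos]; calc (D : ℝ) ^ 7 * D = D ^ 8 := by ring
      _ ≤ _ := hlog
  have hLD : Lg / D ≤ Lg / 100 := by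
    apply div_le_div_of_nonneg_left _ (by norm_num) hD'
    linarith
  unfold lowDegBound
  have a1 : (D : ℝ) ^ (D ^ 6) ≤ Real.exp ((D : ℝ) ^ 7) := by
    conv_lhs => rw [← Real.exp_log hDpos, ← Real.exp_nat_mul]
    refine Real.exp_le_exp.2 ?_
    push_cast
    calc (D : ℝ) ^ 6 * Real.log D ≤ D ^ 6 * D := by gcongr
      _ = _ := by ring
  have a2 : Lg - Lg / D - D - 5 ≤ q * (1 - 1 / D) * ((n : ℝ) - s - 5) := by
    have b1 : Lg - D - 5 ≤ q * ((n : ℝ) - s - 5) := by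
      nlinarith
    have b2 : 0 ≤ 1 - 1 / (D : ℝ) := by
      rw [sub_nonneg, div_le_one hDpos]; linarith
    calc Lg - Lg / D - D - 5 ≤ (1 - 1 / D) * (Lg - D - 5) := by
          have : (1 - 1 / (D : ℝ)) * (Lg - D - 5) = Lg - Lg / D - D - 5 + (D + 5) / D := by ring
          rw [this]
          have : 0 ≤ ((D : ℝ) + 5) / D := by positivity
          linarith
      _ ≤ (1 - 1 / D) * (q * ((n : ℝ) - s - 5)) := by gcongr
      _ = _ := by ring
  calc (D : ℝ) ^ (D ^ 6) * Real.exp (-(q * (1 - 1 / D) * ((n : ℝ) - s - 5)))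
      ≤ Real.exp ((D : ℝ) ^ 7) * Real.exp (-(Lg - Lg / D - D - 5)) := by
        gcongr
    _ = Real.exp ((D : ℝ) ^ 7 - (Lg - Lg / D - D - 5)) := by rw [← Real.exp_add]; congr 1
    _ ≤ _ := Real.exp_le_exp.2 (by linarith)

/-- Powers of `q n` are polynomial in `D`. With two small vertices one factor `n` is left over, and
`n Q ^ 2 ≤ n ^ (-1/2)`; the 4-cycle has as many vertices as edges, so a single `Q` suffices. -/
lemma small_terms_le {n D : ℕ} {q Q : ℝ} (hD : 1 ≤ D) (hn : 0 < n) (hq : 0 ≤ q)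
    (hqn : q * n ≤ 4 * (D : ℝ) ^ 8) (hlog : (D : ℝ) ^ 8 ≤ Real.log n) (hQ0 : 0 ≤ Q)
    (hQ : Q ≤ Real.exp (-(3 / 4 * Real.log n))) :
    n ^ 2 * (q * Q ^ 2) + (n ^ 3 * (q ^ 2 * Q ^ 2) + (n ^ 5 * (q ^ 4 * Q ^ 2) +
      n ^ 4 * (q ^ 4 * Q))) ≤ 1024 * (D : ℝ) ^ 32 * Real.exp (-((D : ℝ) ^ 8 / 2)) := by
  have hn' : (0 : ℝ) < n := by exact_mod_cast hn
  have hD1 : (1 : ℝ) ≤ D := by exact_mod_cast hD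
  set x := q * n with hx
  have hx0 : 0 ≤ x := by positivity
  set E := Real.exp (-((D : ℝ) ^ 8 / 2)) with hE
  have hnQ : n * Q ^ 2 ≤ E := by
    have : (n : ℝ) = Real.exp (Real.log n) := (Real.exp_log hn').symm
    calc n * Q ^ 2 ≤ Real.exp (Real.log n) * (Real.exp (-(3 / 4 * Real.log n))) ^ 2 := by
          rw [← this]; gcongr
      _ = Real.exp (-(Real.log n / 2)) := by
          rw [← Real.exp_nat_mul, ← Real.exp_add]; congr 1; push_cast; ring
      _ ≤ E := Real.exp_le_exp.2 (by linarith)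
  have hQE : Q ≤ E := hQ.trans (Real.exp_le_exp.2 (by
    have : (0 : ℝ) ≤ D ^ 8 := by positivity
    linarith))
  have hE0 : 0 ≤ E := (Real.exp_pos _).le
  have hB : (1 : ℝ) ≤ 4 * D ^ 8 := by
    have : (1 : ℝ) ≤ D ^ 8 := one_le_pow₀ hD1
    linarith
  have hpow : ∀ j ≤ 4, x ^ j ≤ 256 * (D : ℝ) ^ 32 := by
    intro j hj
    calc x ^ j ≤ (4 * (D : ℝ) ^ 8) ^ j := by gcongr
      _ ≤ (4 * (D : ℝ) ^ 8) ^ 4 := pow_le_pow_right₀ hB hj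
      _ = _ := by ring
  have t1 : x ^ 1 * (n * Q ^ 2) ≤ 256 * (D : ℝ) ^ 32 * E := by gcongr; exact hpow 1 (by norm_num)
  have t2 : x ^ 2 * (n * Q ^ 2) ≤ 256 * (D : ℝ) ^ 32 * E := by gcongr; exact hpow 2 (by norm_num)
  have t3 : x ^ 4 * (n * Q ^ 2) ≤ 256 * (D : ℝ) ^ 32 * E := by gcongr; exact hpow 4 (by norm_num)
  have t4 : x ^ 4 * Q ≤ 256 * (D : ℝ) ^ 32 * E := by gcongr; exact hpow 4 (by norm_num)
  have e : n ^ 2 * (q * Q ^ 2) + (n ^ 3 * (q ^ 2 * Q ^ 2) + (n ^ 5 * (q ^ 4 * Q ^ 2) +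
      n ^ 4 * (q ^ 4 * Q))) = x ^ 1 * (n * Q ^ 2) + x ^ 2 * (n * Q ^ 2) + x ^ 4 * (n * Q ^ 2) +
        x ^ 4 * Q := by rw [hx]; ring
  rw [e]; linarith

/-- The weight `L = q n` loses only a constant in the exponent, and `n exp (-q n) ≤ exp (-t) / log
n`. Degree at most 1 brings a factor `q n ≤ 2 log n`, leaving `exp (-t)`: this is where the surplus
must tend to infinity. Ignoring special neighbours costs a factor `D`, absorbed by `1 / log n ≤ D ^
(-8)`; for the special vertices themselves the factor `q s` replaces `q n`. -/
lemma degree_terms_le {n s D : ℕ} {q t : ℝ} (hD : 1 ≤ D) (hn : 0 < n) (hq : 0 ≤ q) (hq1 : q ≤ 1)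
    (hlog : (D : ℝ) ^ 8 ≤ Real.log n) (hqn : Real.log n + Real.log (Real.log n) + t ≤ q * n)
    (ht : 0 ≤ t) (hqn' : q * n ≤ 2 * Real.log n) (hx1 : 1 ≤ q * n) (hqs : q * s ≤ Real.log D) :
    n * lowDegBound q (q * n) ((n : ℝ) - 1) 1 + (n * lowDegBound q (q * n) ((n : ℝ) - s - 1) 0 +
      s * lowDegBound q (q * n) ((n : ℝ) - s - 1) 1) ≤
      2 * Real.exp 2 * Real.exp (-t) + Real.exp 2 * (D : ℝ)⁻¹ + Real.exp 2 * (D : ℝ)⁻¹ := by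
  have hn' : (0 : ℝ) < n := by exact_mod_cast hn
  have hD1 : (1 : ℝ) ≤ D := by exact_mod_cast hD
  have hDpos : (0 : ℝ) < D := by linarith
  have hlD : Real.log D ≤ D := (Real.log_le_self hDpos.le)
  set x := q * n with hx
  have hx0 : 0 < x := by linarith
  have hqpos : 0 < q := by
    rcases hq.lt_or_eq with h | h
    · exact h
    · rw [hx, ← h] at hx1; norm_num at hx1
  have hD8 : (1 : ℝ) ≤ D ^ 8 := one_le_pow₀ hD1
  have hLpos : 0 < Real.log n := by linarith
  have hq' : q * (1 - 1 / x) = q - 1 / n := by rw [hx]; field_simp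
  have hEx : n * Real.exp (-x) ≤ Real.exp (-t) / Real.log n := by
    calc n * Real.exp (-x) ≤ Real.exp (Real.log n) *
          Real.exp (-(Real.log n + Real.log (Real.log n) + t)) := by
          rw [Real.exp_log hn']; gcongr
      _ = Real.exp (-t) / Real.exp (Real.log (Real.log n)) := by
          rw [← Real.exp_add, ← Real.exp_sub]; congr 1; ring
      _ = _ := by rw [Real.exp_log hLpos]
  have hs0 : (0 : ℝ) ≤ s := Nat.cast_nonneg s
  have hw : ∀ c : ℝ, 0 ≤ c → x - q * c - 2 ≤ q * (1 - 1 / x) * (n - c - 1) := by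
    intro c hc
    rw [hq']
    have : (q - 1 / n) * (n - c - 1) = x - q * c - q - 1 + c / n + 1 / n := by
      rw [hx]; field_simp; ring
    rw [this]
    have h1 : 0 ≤ c / n := by positivity
    have h2 : 0 ≤ 1 / (n : ℝ) := by positivity
    linarith
  have hET : Real.exp (-t) ≤ 1 := Real.exp_le_one_iff.2 (by linarith)
  have hnL : n * Real.exp (-x) ≤ 1 / (D : ℝ) ^ 8 := by
    refine hEx.trans ?_
    gcongr
  have g1 : n * lowDegBound q x ((n : ℝ) - 1) 1 ≤ 2 * Real.exp 2 * Real.exp (-t) := by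
    unfold lowDegBound
    have := hw 0 le_rfl
    rw [mul_zero, sub_zero, sub_zero] at this
    calc (n : ℝ) * (x ^ 1 * Real.exp (-(q * (1 - 1 / x) * (n - 1))))
        ≤ n * (x ^ 1 * Real.exp (2 + -x)) := by gcongr; linarith
      _ = x * Real.exp 2 * (n * Real.exp (-x)) := by rw [Real.exp_add]; ring
      _ ≤ (2 * Real.log n) * Real.exp 2 * (Real.exp (-t) / Real.log n) := by gcongr
      _ = _ := by field_simp
  have hb : Real.exp (-(q * (1 - 1 / x) * (n - s - 1))) ≤ D * Real.exp 2 * Real.exp (-x) := by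
    have := hw s hs0
    calc Real.exp (-(q * (1 - 1 / x) * (n - s - 1))) ≤ Real.exp (Real.log D + 2 + -x) := by
          apply Real.exp_le_exp.2; linarith
      _ = _ := by rw [Real.exp_add, Real.exp_add, Real.exp_log hDpos]
  have g2 : n * lowDegBound q x ((n : ℝ) - s - 1) 0 ≤ Real.exp 2 * (D : ℝ)⁻¹ := by
    unfold lowDegBound
    calc (n : ℝ) * (x ^ 0 * Real.exp (-(q * (1 - 1 / x) * (n - s - 1))))
        ≤ n * (x ^ 0 * (D * Real.exp 2 * Real.exp (-x))) := by gcongr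
      _ = Real.exp 2 * (D * (n * Real.exp (-x))) := by ring
      _ ≤ Real.exp 2 * (D * (1 / (D : ℝ) ^ 8)) := by gcongr
      _ ≤ _ := by
          gcongr
          rw [mul_one_div, div_le_iff₀ (by positivity)]
          calc (D : ℝ) ≤ D ^ 7 := le_self_pow₀ hD1 (by norm_num)
            _ = _ := by field_simp
  have g3 : s * lowDegBound q x ((n : ℝ) - s - 1) 1 ≤ Real.exp 2 * (D : ℝ)⁻¹ := by
    unfold lowDegBound
    calc (s : ℝ) * (x ^ 1 * Real.exp (-(q * (1 - 1 / x) * (n - s - 1))))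
        ≤ s * (x ^ 1 * (D * Real.exp 2 * Real.exp (-x))) := by gcongr
      _ = Real.exp 2 * ((q * s) * D * (n * Real.exp (-x))) := by rw [hx]; ring
      _ ≤ Real.exp 2 * (D * D * (1 / (D : ℝ) ^ 8)) := by gcongr; linarith
      _ ≤ _ := by
          gcongr
          rw [mul_one_div, div_le_iff₀ (by positivity)]
          calc (D : ℝ) * D = D ^ 2 := by ring
            _ ≤ D ^ 7 := pow_le_pow_right₀ hD1 (by norm_num)
            _ = _ := by field_simp
  linarith

theorem prG_not_typical_le_failureBound {n s D : ℕ} (q : I) {t : ℝ} (hD : 100 ≤ D)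
    (hn : D ^ 7 ≤ n) (ht : 0 ≤ t)
    (hlog : (D : ℝ) ^ 8 ≤ Real.log n) (hlog' : Real.log n ≤ 2 * (D : ℝ) ^ 8)
    (hqn : Real.log n + Real.log (Real.log n) + t ≤ q * n) (hqn' : (q : ℝ) * n ≤ 2 * Real.log n)
    (hqs : (q : ℝ) * s ≤ Real.log D) (hfb : failureBound D t ≤ 1 / 2) :
    prG (Fin n) q {G | ¬ TypicalGraph G s (D ^ 6) (joinSize n D) D} ≤ failureBound D t := by
  have hD' : (100 : ℝ) ≤ D := by exact_mod_cast hD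
  have hn0 : 0 < n := lt_of_lt_of_le (by positivity) hn
  obtain ⟨h1, h2⟩ : Real.exp 2 * (D : ℝ) ^ 14 * Real.exp (-D) ≤ 1 ∧
      8 * Real.exp 2 * ((D : ℝ) ^ 4 * Real.exp (-((D : ℝ) ^ 4 / 2))) ≤ 1 / 2 := by
    have a1 : 0 ≤ Real.exp 2 * (D : ℝ) ^ 14 * Real.exp (-D) := by positivity
    have a2 : 0 ≤ Real.exp 2 * ((D : ℝ) ^ 4 * Real.exp (-((D : ℝ) ^ 4 / 2))) := by positivity
    have a3 : 0 ≤ 1024 * (D : ℝ) ^ 32 * Real.exp (-((D : ℝ) ^ 8 / 2)) := by positivity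
    have a4 : 0 ≤ 2 * Real.exp 2 * Real.exp (-t) + Real.exp 2 * (D : ℝ)⁻¹ +
      Real.exp 2 * (D : ℝ)⁻¹ := by positivity
    unfold failureBound at hfb
    constructor <;> linarith
  have hD8 : (1 : ℝ) ≤ D ^ 8 := one_le_pow₀ (by linarith)
  have hll : 0 ≤ Real.log (Real.log n) := Real.log_nonneg (by linarith)
  have hx : Real.log n ≤ q * n := by linarith
  have hx1 : 1 ≤ (q : ℝ) * n := by linarith
  have hm : 1 ≤ joinSize n D := by simp [joinSize]
  refine (prG_not_typical_le (L := D) (L' := q * n) q hm (by omega) (by linarith) hx1).trans ?_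
  have T1 := joined_term_le (by omega) hm (lt_joinSize_mul (n := n) (D := D) (by omega)).le q.2.1
    (by linarith) h1
  have T2 := sparse_term_le hD hn0 (joinSize_mul_le hn) q.2.1 (by linarith) h2
  have T3 := small_terms_le (by omega) hn0 q.2.1 (by linarith) hlog
    (lowDegBound_nonneg (by linarith)) (lowDegBound_small_le hD q.2.2 hlog hx hqs)
  have T4 := degree_terms_le (by omega) hn0 q.2.1 q.2.2 hlog hqn ht hqn' hx1 hqs
  unfold failureBound
  linarith

/-- The arithmetic of the parameters at scale `D`. -/
theorem prG_not_ordered_le_failureBound {n s D : ℕ} {p p₁ p₂ : I} {t : ℝ}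
    (hpp : (1 - p : ℝ) = (1 - p₁) * (1 - p₂)) (hD : 1000 ≤ D) (ht : 0 ≤ t) (hs : 0 < s)
    (hlog : (D : ℝ) ^ 8 ≤ Real.log n) (hlog' : Real.log n ≤ 2 * (D : ℝ) ^ 8)
    (hqn : Real.log n + Real.log (Real.log n) + t ≤ p₁ * n) (hqn' : (p₁ : ℝ) * n ≤ 2 * Real.log n)
    (hsl : s * Real.log n ≤ n * (Real.log D / 100)) (hpn : 324 * 7 ≤ (p₂ : ℝ) * n)
    (hfb : failureBound D t ≤ 1 / 2) :
    prG (Fin n) p {G | HasOrderedHamiltonCycle G s}ᶜ ≤ failureBound D t + Real.exp (-n) := by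
  have hD' : (1000 : ℝ) ≤ D := by exact_mod_cast hD
  have hDpos : (0 : ℝ) < D := by linarith
  have hlDpos : 0 < Real.log D := Real.log_pos (by linarith)
  have hlD : Real.log D ≤ D := Real.log_le_self hDpos.le
  have hn8R : (D : ℝ) ^ 8 ≤ n := hlog.trans (Real.log_le_self (Nat.cast_nonneg n))
  have hn8 : D ^ 8 ≤ n := by exact_mod_cast hn8R
  have hn7 : D ^ 7 ≤ n := (Nat.pow_le_pow_right (by omega) (by norm_num)).trans hn8
  have hnpos : (0 : ℝ) < n := lt_of_lt_of_le (by positivity) hn8R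
  set m := joinSize n D with hm
  have hm1 : 1 ≤ m := by simp [hm, joinSize]
  have hm7 : m * D ^ 7 ≤ 2 * n := joinSize_mul_le hn7
  have hm6 : 500 * (m * D ^ 6) ≤ n := by
    have : m * D ^ 6 * 1000 ≤ m * D ^ 6 * D := by gcongr
    have e : m * D ^ 6 * D = m * D ^ 7 := by ring
    omega
  have hmD : m * D ≤ m * D ^ 6 := Nat.mul_le_mul_left _ (Nat.le_self_pow (by norm_num) _)
  have hmmD : m * 1000 ≤ m * D := Nat.mul_le_mul_left _ hD
  have hn0 : 1000 * 1000 ≤ n := by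
    calc 1000 * 1000 = 1000 ^ 2 := by norm_num
      _ ≤ D ^ 2 := by gcongr
      _ ≤ D ^ 8 := Nat.pow_le_pow_right (by omega) (by norm_num)
      _ ≤ n := hn8
  have h8 : (D : ℝ) * 1000 ≤ D ^ 8 := by
    have : (D : ℝ) ^ 8 = D * (D * D ^ 6) := by ring
    rw [this]
    have : (1 : ℝ) ≤ D ^ 6 := one_le_pow₀ (by linarith)
    gcongr; nlinarith
  have hsR : (s : ℝ) * 1000 ≤ n / 100 := by
    have : (s : ℝ) * 1000 * D ≤ n / 100 * D := by
      calc (s : ℝ) * 1000 * D = s * (D * 1000) := by ring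
        _ ≤ s * Real.log n := by gcongr; linarith
        _ ≤ n * (Real.log D / 100) := hsl
        _ ≤ n * (D / 100) := by gcongr
        _ = _ := by ring
    exact le_of_mul_le_mul_right this hDpos
  have hsN : s * 100000 ≤ n := by
    have : (s : ℝ) * 100000 ≤ n := by linarith
    exact_mod_cast this
  -- The least depth that gives `m` leaves; by minimality the trees have at most `m * D` leaves, a
  -- small fraction of `n`.
  set h := Nat.clog D m with hh
  have hmh : m ≤ D ^ h := Nat.le_pow_clog (by omega) m
  have hDh : D ^ h ≤ m * D := by
    rcases Nat.eq_zero_or_pos h with h0 | h0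
    · rw [h0, pow_zero]; nlinarith
    · have : D ^ (h - 1) < m := by
        by_contra hcon
        have := Nat.clog_le_of_le_pow (b := D) (not_lt.1 hcon)
        omega
      calc D ^ h = D ^ (h - 1) * D := by rw [← pow_succ]; congr 1; omega
        _ ≤ m * D := by gcongr
  have hDn : D ^ h ≤ n := by omega
  have hhR : (h : ℝ) * Real.log D ≤ Real.log n := by
    have : Real.log ((D : ℝ) ^ h) ≤ Real.log n :=
      Real.log_le_log (by positivity) (by exact_mod_cast hDn)
    rwa [Real.log_pow] at this
  -- Since `h` is at most `log n / log D`, the bound on `s log n` makes the total length of the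
  -- connections a small fraction of `n`.
  have hshR : (s : ℝ) * h ≤ n / 100 := by
    have : (s : ℝ) * h * Real.log D ≤ n / 100 * Real.log D := by
      calc (s : ℝ) * h * Real.log D = s * (h * Real.log D) := by ring
        _ ≤ s * Real.log n := by gcongr
        _ ≤ _ := hsl
        _ = _ := by ring
    exact le_of_mul_le_mul_right this hlDpos
  have hsh : s * h * 100 ≤ n := by
    have : (s : ℝ) * h * 100 ≤ n := by linarith
    exact_mod_cast this
  have hk : 2 * D ^ 4 * (D + 2) + 1 ≤ D ^ 6 := by
    have : 1 ≤ D ^ 4 := Nat.one_le_pow _ _ (by omega)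
    have : 2 * (D + 2) + 1 ≤ D ^ 2 := by nlinarith
    calc 2 * D ^ 4 * (D + 2) + 1 ≤ D ^ 4 * (2 * (D + 2) + 1) := by nlinarith
      _ ≤ D ^ 4 * D ^ 2 := by gcongr
      _ = D ^ 6 := by ring
  have hqs : (p₁ : ℝ) * s ≤ Real.log D := by
    have : (p₁ : ℝ) * s * n ≤ Real.log D * n := by
      calc (p₁ : ℝ) * s * n = s * (p₁ * n) := by ring
        _ ≤ s * (2 * Real.log n) := by gcongr
        _ = 2 * (s * Real.log n) := by ring
        _ ≤ 2 * (n * (Real.log D / 100)) := by gcongr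
        _ ≤ Real.log D * n := by
          have : 0 ≤ Real.log D * n := by positivity
          linarith
    exact le_of_mul_le_mul_right this hnpos
  have hnK : (n : ℝ) / 9 ≤ ((n / 8 : ℕ) : ℝ) := by
    have : n ≤ 9 * (n / 8) := by omega
    have : (n : ℝ) ≤ 9 * ((n / 8 : ℕ) : ℝ) := by exact_mod_cast this
    linarith
  have e1 : s * (2 * h + 2) = 2 * (s * h) + 2 * s := by ring
  have e2 : s * (2 * h + 4) = 2 * (s * h) + 4 * s := by ring
  have e3 : 2 * m * D = 2 * (m * D) := by ring
  -- Twofold expansion needs `3K` plus lower-order terms below `n`, while the booster count needs `K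
  -- ≥ n / 9`; `n / 8` meets both. The budget `n / 4` covers blocked vertices, path and two trees.
  refine (prG_not_ordered_le (k := D ^ 6) (m := m) (D := D) (K := n / 8) (h := h) (w := n / 4)
    hpp hk (by omega) hm1 hs (by omega) (by omega) (by omega) hmh (by omega) (by omega) (by omega)
    hnK hpn).trans ?_
  exact add_le_add (prG_not_typical_le_failureBound p₁ (by omega) hn7 ht hlog hlog' hqn hqn' hqs
    hfb) le_rfl

end Numerics

/-! ### Passage to the limit. -/

section Limit

open unitInterval MeasureTheory

/-- The scale of the construction at `n` vertices. -/
noncomputable def scale (n : ℕ) : ℕ := ⌊Real.log n ^ (1 / 8 : ℝ)⌋₊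

lemma tendsto_log_natCast : Tendsto (fun n : ℕ => Real.log n) atTop atTop :=
  Real.tendsto_log_atTop.comp tendsto_natCast_atTop_atTop

lemma tendsto_scale : Tendsto scale atTop atTop :=
  tendsto_nat_floor_atTop.comp
    ((tendsto_rpow_atTop (by norm_num)).comp tendsto_log_natCast)

lemma scale_pow_le {n : ℕ} : (scale n : ℝ) ^ 8 ≤ Real.log n := by
  have h0 : 0 ≤ Real.log n := Real.log_natCast_nonneg n
  calc (scale n : ℝ) ^ 8 ≤ (Real.log n ^ (1 / 8 : ℝ)) ^ 8 := by
        gcongr; exact Nat.floor_le (by positivity)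
    _ = Real.log n := by
        rw [← Real.rpow_natCast, ← Real.rpow_mul h0]; norm_num

lemma log_le_scale_pow {n : ℕ} (h : 100 ≤ scale n) : Real.log n ≤ 2 * (scale n : ℝ) ^ 8 := by
  have h0 : 0 ≤ Real.log n := Real.log_natCast_nonneg n
  have h' : (100 : ℝ) ≤ scale n := by exact_mod_cast h
  calc Real.log n = (Real.log n ^ (1 / 8 : ℝ)) ^ 8 := by
        rw [← Real.rpow_natCast, ← Real.rpow_mul h0]; norm_num
    _ ≤ ((scale n : ℝ) + 1) ^ 8 := by
        gcongr; exact (Nat.lt_floor_add_one _).le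
    _ ≤ (101 / 100 * (scale n : ℝ)) ^ 8 := by gcongr; linarith
    _ = (101 / 100) ^ 8 * (scale n : ℝ) ^ 8 := by rw [mul_pow]
    _ ≤ _ := by gcongr; norm_num

lemma log_log_le_log_scale {n : ℕ} (h : 100 ≤ scale n) :
    Real.log (Real.log n) ≤ 9 * Real.log (scale n) := by
  have h' : (100 : ℝ) ≤ scale n := by exact_mod_cast h
  have h8 : 0 < (scale n : ℝ) ^ 8 := by positivity
  have : Real.log n ≤ (scale n : ℝ) ^ 9 := by
    refine (log_le_scale_pow h).trans ?_
    rw [pow_succ _ 8, mul_comm]; gcongr; linarith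
  calc Real.log (Real.log n) ≤ Real.log ((scale n : ℝ) ^ 9) :=
        Real.log_le_log (h8.trans_le scale_pow_le) this
    _ = _ := by rw [Real.log_pow]; norm_num

/-- Splitting the edge probability `(log n + log log n + ω) / n` into two rounds. -/
lemma exists_two_rounds {n : ℕ} {p : I} {a w : ℝ} (hn : 0 < n) (hp : (p : ℝ) = (a + w) / n)
    (ha : 0 ≤ a) (hw : 0 < w) :
    ∃ p₁ p₂ : I, (1 - p : ℝ) = (1 - p₁) * (1 - p₂) ∧ (p₁ : ℝ) * n = a + w / 2 ∧
      w / 2 ≤ (p₂ : ℝ) * n := by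
  have hn' : (0 : ℝ) < n := by exact_mod_cast hn
  -- The first round keeps half of the surplus `w`. The second has probability `(p - x) / (1 - x)`,
  -- at least `p - x = w / (2n)`.
  set x : ℝ := (a + w / 2) / n with hx
  have hx0 : 0 ≤ x := by positivity
  have hxp : (p : ℝ) - x = w / 2 / n := by rw [hp, hx]; ring
  have hd : 0 < w / 2 / (n : ℝ) := by positivity
  have hp1 : (p : ℝ) ≤ 1 := p.2.2
  have hx1 : 0 < 1 - x := by linarith
  have hy : w / 2 / n ≤ (p - x) / (1 - x) := by
    rw [hxp, le_div_iff₀ hx1]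
    nlinarith
  have hy1 : ((p : ℝ) - x) / (1 - x) ≤ 1 := by rw [div_le_one hx1]; linarith
  have hxI : x ≤ 1 := by linarith
  have e1 : 1 - (p : ℝ) = (1 - x) * (1 - (p - x) / (1 - x)) := by field_simp; ring
  have e2 : x * n = a + w / 2 := by rw [hx]; field_simp
  refine ⟨⟨x, hx0, hxI⟩, ⟨(p - x) / (1 - x), hd.le.trans hy, hy1⟩, e1, e2, ?_⟩
  calc w / 2 = w / 2 / n * n := by field_simp
    _ ≤ _ := by gcongr

/-- The first `s₀` vertices are few at scale `scale n`. -/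
lemma eventually_order_constraint {ω₁ : ℕ → ℝ} {s₀ : ℕ → ℕ}
    (hω₁ : ω₁ =o[atTop] fun n : ℕ => Real.log (Real.log (Real.log n)))
    (hs₀ : ∀ᶠ n : ℕ in atTop, (s₀ n : ℝ) = ω₁ n * n / Real.log n) :
    ∀ᶠ n : ℕ in atTop, ((max (s₀ n) 1 : ℕ) : ℝ) * Real.log n ≤
      n * (Real.log (scale n) / 100) := by
  have hll := Real.tendsto_log_atTop.comp tendsto_log_natCast
  have hlll := Real.tendsto_log_atTop.comp hll
  have e1 := hω₁.bound one_pos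
  -- As `900 = 9 * 100`, this yields `ω₁ ≤ log log log n ≤ log log n / 900 ≤ log (scale n) / 100`.
  have e2 := (Real.isLittleO_log_id_atTop.comp_tendsto hll).bound
    (show (0 : ℝ) < 1 / 900 by norm_num)
  have e3 := (Real.isLittleO_log_id_atTop.comp_tendsto
    (tendsto_natCast_atTop_atTop (R := ℝ))).bound (show (0 : ℝ) < 1 / 100 by norm_num)
  filter_upwards [e1, e2, e3, hs₀, hll.eventually_ge_atTop 1, hlll.eventually_ge_atTop 0,
    tendsto_log_natCast.eventually_ge_atTop 1, tendsto_scale.eventually_ge_atTop 100]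
    with n h1 h2 h3 hs h4 h5 h6 h7
  simp only [Function.comp_apply, id_eq] at h1 h2 h3 h4 h5 h6
  rw [one_mul, Real.norm_of_nonneg h5, Real.norm_eq_abs] at h1
  rw [Real.norm_of_nonneg h5, Real.norm_of_nonneg (by linarith)] at h2
  rw [Real.norm_of_nonneg (by linarith), Real.norm_of_nonneg (Nat.cast_nonneg n)] at h3
  have h8 := log_log_le_log_scale h7
  have hn0 : (0 : ℝ) ≤ n := Nat.cast_nonneg n
  rcases le_total (s₀ n) 1 with h | h
  · rw [max_eq_right h, Nat.cast_one, one_mul]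
    have h7' : (100 : ℝ) ≤ scale n := by exact_mod_cast h7
    have : 1 ≤ Real.log (scale n) := by
      rw [Real.le_log_iff_exp_le (by linarith)]
      linarith [Real.exp_one_lt_d9]
    nlinarith
  · rw [max_eq_left h, hs, div_mul_cancel₀ _ (by linarith), mul_comm]
    refine mul_le_mul_of_nonneg_left ?_ hn0
    linarith [le_abs_self (ω₁ n)]

end Limit

theorem theorem3
    (ω ω₁ : ℕ → ℝ) (p : ℕ → unitInterval) (s₀ : ℕ → ℕ)
    (hω_top : Tendsto ω atTop atTop)
    (hω : ω =o[atTop] fun n : ℕ => Real.log (Real.log n))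
    (hp : ∀ᶠ n : ℕ in atTop,
      (p n : ℝ) = (Real.log n + Real.log (Real.log n) + ω n) / n)
    (hω₁ : ω₁ =o[atTop] fun n : ℕ => Real.log (Real.log (Real.log n)))
    (hs₀ : ∀ᶠ n : ℕ in atTop, (s₀ n : ℝ) = ω₁ n * n / Real.log n) :
    Tendsto
      (fun n : ℕ => SimpleGraph.binomialRandom (Fin n) (p n)
        {G : SimpleGraph (Fin n) | HasOrderedHamiltonCycle G (s₀ n)})
      atTop (𝓝 1) := by
  have hll := Real.tendsto_log_atTop.comp tendsto_log_natCast
  have hfb : Tendsto (fun n => failureBound (scale n) (ω n / 2)) atTop (𝓝 0) :=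
    tendsto_failureBound (tendsto_natCast_atTop_atTop.comp tendsto_scale)
      (hω_top.atTop_div_const (by norm_num))
  have hbound : Tendsto (fun n : ℕ => failureBound (scale n) (ω n / 2) + Real.exp (-n)) atTop
      (𝓝 0) := by
    simpa using hfb.add (Real.tendsto_exp_neg_atTop_nhds_zero.comp tendsto_natCast_atTop_atTop)
  have hfail : Tendsto (fun n : ℕ => prG (Fin n) (p n) {G | HasOrderedHamiltonCycle G (s₀ n)}ᶜ)
      atTop (𝓝 0) := by
    refine squeeze_zero' (.of_forall fun n => prG_nonneg _ _) ?_ hbound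
    have e2 := (Real.isLittleO_log_id_atTop.comp_tendsto tendsto_log_natCast).bound
      (show (0 : ℝ) < 1 / 2 by norm_num)
    -- The second round receives half of `ω`, so `ω ≥ 2 * (324 * 7)` is what the booster argument
    -- asks for.
    filter_upwards [hp, hω.bound one_pos, e2, eventually_order_constraint hω₁ hs₀,
      hfb.eventually_le_const (show (0 : ℝ) < 1 / 2 by norm_num),
      hω_top.eventually_ge_atTop (2 * (324 * 7)), tendsto_scale.eventually_ge_atTop 1000,
      hll.eventually_ge_atTop 0, tendsto_log_natCast.eventually_ge_atTop 0,
      eventually_gt_atTop 0] with n hpn h1 h2 hs hf hω' hD h3 h4 hn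
    simp only [Function.comp_apply, id_eq] at h1 h2 h3
    rw [one_mul, Real.norm_of_nonneg h3, Real.norm_of_nonneg (by linarith)] at h1
    rw [Real.norm_of_nonneg h3, Real.norm_of_nonneg h4] at h2
    obtain ⟨p₁, p₂, hpp, hp₁, hp₂⟩ := exists_two_rounds hn hpn (by linarith)
      (show 0 < ω n by linarith)
    -- The construction needs a special vertex to start from, so `s₀ n = 0` is replaced by 1, which
    -- only strengthens the requirement.
    refine (prG_mono _ (Set.compl_subset_compl.2 fun G hG =>
      HasOrderedHamiltonCycle.mono (le_max_left (s₀ n) 1) hG)).trans ?_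
    exact prG_not_ordered_le_failureBound hpp hD (by linarith) (by omega) scale_pow_le
      (log_le_scale_pow (by omega)) hp₁.ge (by linarith) hs (by linarith) hf
  rw [← ENNReal.tendsto_toReal_iff (fun n => MeasureTheory.measure_ne_top _ _) ENNReal.one_ne_top,
    ENNReal.toReal_one]
  have h1 := hfail.const_sub 1
  rw [sub_zero] at h1
  refine h1.congr fun n => ?_
  have := discreteMeasurableSpace_simpleGraph (V := Fin n)
  rw [prG, MeasureTheory.probReal_compl_eq_one_sub .of_discrete, sub_sub_cancel]
  rfl
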